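/- Theorem 2. Let $K,d\ge 1$, let $D_0,\dots,D_{K-1}\ge 1$, $\mu_\alpha\in\mathbb C$, and for each $\alpha$ let $A_\alpha=\{A_\alpha^m\}_{m=0}^{d-1}$ be $D_\alpha\times D_\alpha$ complex matrices that are left-canonical ($\sum_m A_\alpha^{m\dagger}A_\alpha^m=\mathbb 1$) and normal (for some $L\ge1$ the products $A_\alpha^{m_1}\cdots A_\alpha^{m_L}$ span all $D_\alpha\times D_\alpha$ matrices). For $A^m=\bigoplus_\alpha\mu_\alpha A_\alpha^m$ and a boundary matrix $X$ with diagonal blocks $X_\alpha$, let $$|\Psi_{\rm MPS}(X)\rangle=\sum_{\vec m}\mathrm{tr}(A^{m_1}\cdots A^{m_N}X)|\vec m\rangle=\sum_\alpha\mu_\alpha^N\sum_{\vec m}\mathrm{tr}(A_\alpha^{m_1}\cdots A_\alpha^{m_N}X_\alpha)|\vec m\rangle$$ (an MPS in canonical form, non-normal for $K\ge2$, written as a superposition of normal ones). Assume that each block satisfies the condition for preparing normal MPS: there are $q_\alpha\ge1$, a finite group $G_\alpha$ and a $D_\alpha$-dimensional irreducible projective unitary representation $B_\alpha$ of $G_\alpha$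 such that for every $g\in G_\alpha$ there is $h\in G_\alpha$ with $$\big[(B_\alpha^h)^T\otimes B_\alpha^g,\ \mathcal A_\alpha^\dagger\mathcal A_\alpha\big]=0,\qquad \mathcal A_\alpha=\sum_{i,j,\vec m}(A_\alpha^{m_1}\cdots A_\alpha^{m_{q_\alpha}})_{ij}\,|\vec m\rangle\langle ij|.$$ Let $q\ge1$ be any common multiple of the $q_\alpha$, let $\bar D=\mathrm{lcm}_\alpha D_\alpha$ and $\tilde A_\alpha^m=A_\alpha^m\otimes\mathbb 1_{\bar D/D_\alpha}$ (so $\tilde A_\alpha=A_\alpha$ if all $D_\alpha$ are equal). Then there are constants $T,r,p$ and gates $V$, all independent of the system size, such that for all $N=nq$, $n\ge1$, the following adaptive circuit (Protocol 2) on a line of qudits can be realized with depth at most $T$ (layers of disjoint unitary gates of range at most $r$, and rounds of computational basis measurements, with free classical processing of the outcomes), starting from the all-zero product state: (1) a GHZ state $K^{-1/2}\sum_\alpha|\alpha\rangle^{\otimes N+2}$ of $K$-dimensional block qudits (one per site and one at each edge) is prepared exactly and deterministically by an adaptive circuit on the block qudits and $K$-dimensional ancillas; (2) conditioned on the block index $\alpha$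 read from the block qudits, $n$ copies of the $q$-site MPS of $\tilde A_\alpha$, with boundaries entangled with two $\bar D$-dimensional bond qudits each, are prepared sequentially from the maximally entangled state of the bond qudits by a unitary dilation of $\sum_m\tilde A_\alpha^m\otimes|m\rangle\langle0|$; (3) all pairs of neighbouring non-edge bond qudits are measured, in an $\alpha$-conditioned way, by a POVM onto maximally entangled states given by unitary defects $\tilde B_\alpha^k$, $k=1,\dots,\eta$ (using one $p$-dimensional ancilla per pair); (4) conditioned on $\alpha$ and on the outcomes, each segment of $q$ sites is corrected by a unitary obtained from a pushing relation $O_p\tilde{\mathcal A}_\alpha=\tilde{\mathcal A}_\alpha(O_\ell^T\otimes O_r)$, where $\tilde{\mathcal A}_\alpha$ is the virtual-to-physical map of $q$ sites of $\tilde A_\alpha$ and $O_\ell,O_r$ are unitary, and the left edge bond qudit by the adjoint of a defect up to a phase; (5) the block qudits of the sites are Fourier transformed and measured, and an outcome-dependent phase gate is applied to an edge block qudit. For every sequence of measurement outcomes of nonzero probability the resulting state is exactly, up to a scalar factor, $$\sum_{\ell,r}\sum_{\vec m}\langle\ell|\tilde A^{m_1}\cdots\tilde A^{m_N}|r\rangle\,|\vec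 m\rangle\otimes|\ell r\rangle,\qquad \tilde A^m=\bigoplus_\alpha\tilde A_\alpha^m,$$ on the physical qudits and the two edges (each edge consisting of a block and a bond qudit), all other qudits being in computational basis states. (6) Moreover, for every $X$ with $|\Psi_{\rm MPS}(X)\rangle\ne0$ there is an orthonormal basis of the two edges such that measuring this state in it collapses the physical qudits, for one of the outcomes, onto a nonzero multiple of $|\Psi_{\rm MPS}(X)\rangle$. -/

import Mathlib

open scoped Kronecker

namespace MPSPrep

/-! ### Adaptive circuits on a line of qudits -/

section Circuits

variable {Q : Type} [Fintype Q] [DecidableEq Q]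

/-- A computational basis state of qudits `x : Q`, qudit `x` having dimension `dim x`. -/
abbrev Conf (dim : Q → ℕ) : Type := ∀ x, Fin (dim x)

/-- A (not necessarily normalized) pure state, by its amplitudes. -/
abbrev State (dim : Q → ℕ) : Type := Conf dim → ℂ

/-- The product state in which every qudit is in state `0`. -/
def ketZero (dim : Q → ℕ) [∀ x, NeZero (dim x)] : State dim :=
  fun c => if ∀ x, c x = 0 then 1 else 0

/-- A gate: `amp c c'` is the amplitude of `c' ↦ c`, used for `c`, `c'` that agree off `supp`. -/
structure Gate (dim : Q → ℕ) where
  supp : Finset Q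
  amp : Conf dim → Conf dim → ℂ

/-- The operator of a gate on the whole system: identity off `supp`. -/
def Gate.op {dim : Q → ℕ} (g : Gate dim) : Matrix (Conf dim) (Conf dim) ℂ :=
  fun c c' => if ∀ x, x ∉ g.supp → c x = c' x then g.amp c c' else 0

/-- The gate is a unitary acting only on the qudits of `supp`, and any two qudits of `supp` are at
distance at most `r` on the line (`pos x` is the position of qudit `x`). -/
structure Gate.IsLocalUnitary {dim : Q → ℕ} (pos : Q → ℕ) (r : ℕ) (g : Gate dim) : Prop where
  amp_congr : ∀ c c' e e' : Conf dim, (∀ x ∈ g.supp, c x = e x) → (∀ x ∈ g.supp, c' x = e' x) →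
    g.amp c c' = g.amp e e'
  unitary : g.op ∈ Matrix.unitaryGroup (Conf dim) ℂ
  diam_le : ∀ x ∈ g.supp, ∀ y ∈ g.supp, pos x ≤ pos y + r

/-- Apply the gates of a list one after the other. -/
noncomputable def applyGates {dim : Q → ℕ} (gs : List (Gate dim)) (ψ : State dim) : State dim :=
  gs.foldl (fun φ g => g.op.mulVec φ) ψ

/-- Adaptive circuits: layers of gates, and computational basis measurements of sets of qudits
after which the rest of the circuit depends on the outcome. -/
inductive AdaptiveCircuit (dim : Q → ℕ) : Type
  | nil : AdaptiveCircuit dim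
  | layer : List (Gate dim) → AdaptiveCircuit dim → AdaptiveCircuit dim
  | measure : Finset Q → (Conf dim → AdaptiveCircuit dim) → AdaptiveCircuit dim

namespace AdaptiveCircuit

variable {dim : Q → ℕ}

/-- Number of layers and measurement rounds, maximized over the outcomes. -/
def depth : AdaptiveCircuit dim → ℕ
  | nil => 0
  | layer _ C => C.depth + 1
  | measure _ f => (Finset.univ.sup fun o => (f o).depth) + 1

/-- Every layer consists of unitary gates of range at most `r` with pairwise disjoint supports. -/
def IsLocal (pos : Q → ℕ) (r : ℕ) : AdaptiveCircuit dim → Prop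
  | nil => True
  | layer gs C => (∀ g ∈ gs, g.IsLocalUnitary pos r) ∧
      gs.Pairwise (fun g g' => Disjoint g.supp g'.supp) ∧ C.IsLocal pos r
  | measure _ f => ∀ o, (f o).IsLocal pos r

/-- Only qudits of `S` are touched. -/
def ActsOn (S : Finset Q) : AdaptiveCircuit dim → Prop
  | nil => True
  | layer gs C => (∀ g ∈ gs, g.supp ⊆ S) ∧ C.ActsOn S
  | measure M f => M ⊆ S ∧ ∀ o, (f o).ActsOn S

/-- First `C`, then `C'`. -/
def andThen : AdaptiveCircuit dim → AdaptiveCircuit dim → AdaptiveCircuit dim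
  | nil, C' => C'
  | layer gs C, C' => layer gs (C.andThen C')
  | measure S f, C' => measure S fun o => (f o).andThen C'

/-- The unnormalized final states of all measurement branches. The squared norm of such a state is
the probability of its branch. An outcome of a measurement of `S` is a configuration that is `0`
off `S`. -/
def branches [∀ x, NeZero (dim x)] : AdaptiveCircuit dim → State dim → Set (State dim)
  | nil, ψ => {ψ}
  | layer gs C, ψ => C.branches (applyGates gs ψ)
  | measure S f, ψ => {φ | ∃ o : Conf dim, (∀ x, x ∉ S → o x = 0) ∧
      φ ∈ (f o).branches (fun c => if ∀ x ∈ S, c x = o x then ψ c else 0)}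

/-- Exact and deterministic preparation: started in the all-zero product state, in every branch
that occurs (with nonzero probability) the circuit ends in the state `χ` of the qudits of `T`, up to
a nonzero factor, and every other qudit is in a computational basis state. -/
def Prepares [∀ x, NeZero (dim x)] (C : AdaptiveCircuit dim) (T : Finset Q) (χ : State dim) :
    Prop :=
  ∀ φ ∈ C.branches (ketZero dim), φ ≠ 0 →
    ∃ (z : ℂ) (o : Conf dim), z ≠ 0 ∧ φ = fun c => if ∀ x, x ∉ T → c x = o x then z * χ c else 0

end AdaptiveCircuit

end Circuits

/-! ### Matrix product states -/

/-- The matrices `A^m` of a matrix product state with physical dimension `d`. -/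
abbrev MPSTensor (d : ℕ) (ι : Type) : Type := Fin d → Matrix ι ι ℂ

section MPS

variable {d : ℕ} {ι : Type} [Fintype ι] [DecidableEq ι]

/-- `A^{m_1} A^{m_2} ⋯ A^{m_N}`. -/
def wordProd (A : MPSTensor d ι) {N : ℕ} (m : Fin N → Fin d) : Matrix ι ι ℂ :=
  (List.ofFn fun x => A (m x)).prod

/-- The matrix product state of `N` sites with boundary matrix `X`. -/
def mps (A : MPSTensor d ι) (N : ℕ) (X : Matrix ι ι ℂ) : (Fin N → Fin d) → ℂ :=
  fun m => (wordProd A m * X).trace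

/-- Left-canonical form. -/
def IsLeftCanonical (A : MPSTensor d ι) : Prop :=
  ∑ m, (A m).conjTranspose * A m = 1

/-- Normality: after blocking finitely many sites the matrices span all matrices. -/
def IsNormal (A : MPSTensor d ι) : Prop :=
  ∃ L : ℕ, 0 < L ∧
    Submodule.span ℂ (Set.range fun m : Fin L → Fin d => wordProd A m) = ⊤

/-- The virtual-to-physical map of `q` blocked sites. -/
def virtualToPhysical (A : MPSTensor d ι) (q : ℕ) : Matrix (Fin q → Fin d) (ι × ι) ℂ :=
  fun m ij => wordProd A m ij.1 ij.2

/-- Irreducible projective unitary representations. -/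
structure IsProjIrrep {G : Type} [Group G] (B : G → Matrix ι ι ℂ) : Prop where
  unitary : ∀ g, B g ∈ Matrix.unitaryGroup ι ℂ
  mul : ∀ g h, ∃ ω : ℂ, ‖ω‖ = 1 ∧ B g * B h = ω • B (g * h)
  irreducible : ∀ W : Submodule ℂ (ι → ℂ), (∀ g, ∀ v ∈ W, (B g).mulVec v ∈ W) → W = ⊥ ∨ W = ⊤

/-- The sufficient condition for preparing a normal matrix product state with blocking parameter
`q`: the defects given by some irreducible projective representation of a finite group can be pushed
through `q` sites by unitaries, staying in the representation. -/
def HasPushableIrrep (A : MPSTensor d ι) (q : ℕ) : Prop :=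
  ∃ (G : Type) (_ : Group G) (_ : Finite G) (B : G → Matrix ι ι ℂ), IsProjIrrep B ∧
    ∀ g, ∃ h, Commute ((B h).transpose ⊗ₖ B g)
      ((virtualToPhysical A q).conjTranspose * virtualToPhysical A q)

end MPS

section Blocks

variable {K d : ℕ}

/-- The tensor `⨁_α μ_α A_α` with blocks `A_α` of dimension `D_α`. -/
def blockTensor (D : Fin K → ℕ) (μ : Fin K → ℂ) (A : ∀ α, MPSTensor d (Fin (D α))) :
    MPSTensor d (Σ α, Fin (D α)) :=
  fun m => Matrix.blockDiagonal' fun α => μ α • A α m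

/-- The common dimension of the inflated blocks. -/
def commonDim (D : Fin K → ℕ) : ℕ := Finset.univ.lcm D

instance (D : Fin K → ℕ) [∀ α, NeZero (D α)] : NeZero (commonDim D) :=
  ⟨by simpa [commonDim, Finset.lcm_eq_zero_iff] using fun α => NeZero.ne (D α)⟩

theorem mul_commonDim_div (D : Fin K → ℕ) (α : Fin K) :
    D α * (commonDim D / D α) = commonDim D :=
  Nat.mul_div_cancel' (Finset.dvd_lcm (Finset.mem_univ α))

/-- Inflation `A_α ⊗ 1` of a block to the common dimension. -/
def inflate (D : Fin K → ℕ) (A : ∀ α, MPSTensor d (Fin (D α))) (α : Fin K) :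
    MPSTensor d (Fin (commonDim D)) :=
  fun m =>
    let e := (finProdFinEquiv (m := D α) (n := commonDim D / D α)).trans
      (finCongr (mul_commonDim_div D α))
    Matrix.reindex e e (A α m ⊗ₖ (1 : Matrix (Fin (commonDim D / D α)) _ ℂ))

/-- The tensor `⨁_α A_α` with blocks of equal dimension; a bond index is a pair of an intra-block
index and a block index. -/
def directSum {D : ℕ} (A : Fin K → MPSTensor d (Fin D)) : MPSTensor d (Fin D × Fin K) :=
  fun m => Matrix.blockDiagonal fun α => A α m

end Blocks

/-! ### The preparation protocol -/

/-- The qudits used for a chain of `(n + 1) * q` sites made of `n + 1` segments of `q` sites, fused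
at `n` places: a physical and a block qudit on each site, two edge block qudits, two bond qudits for
each segment, a measurement ancilla for each fusion, and ancillas for the seed state. -/
inductive Qudit (n q : ℕ) : Type
  | phys : Fin ((n + 1) * q) → Qudit n q
  | block : Fin ((n + 1) * q) → Qudit n q
  | edgeL : Qudit n q
  | edgeR : Qudit n q
  | bondL : Fin (n + 1) → Qudit n q
  | bondR : Fin (n + 1) → Qudit n q
  | anc : Fin n → Qudit n q
  | seed : Fin ((n + 1) * q + 2) → Bool → Qudit n q
  deriving DecidableEq, Fintype

/-- Block and seed qudits have dimension `K`, bond qudits `D`, physical qudits `d` and measurement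
ancillas `p`. -/
def quditDim (K D d p : ℕ) {n q : ℕ} : Qudit n q → ℕ
  | .phys _ => d
  | .block _ => K
  | .edgeL => K
  | .edgeR => K
  | .bondL _ => D
  | .bondR _ => D
  | .anc _ => p
  | .seed _ _ => K

instance (K D d p n q : ℕ) [NeZero K] [NeZero D] [NeZero d] [NeZero p] (x : Qudit n q) :
    NeZero (quditDim K D d p x) := by
  cases x <;> simp only [quditDim] <;> infer_instance

/-- Positions on the line: site `x` is at `x + 1`, the two edges are at the ends, and segment `s`
occupies the positions `s * q + 1, …, s * q + q`. -/
def quditPos {n q : ℕ} : Qudit n q → ℕ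
  | .phys x => x + 1
  | .block x => x + 1
  | .edgeL => 0
  | .edgeR => (n + 1) * q + 1
  | .bondL s => s * q + 1
  | .bondR s => s * q + q
  | .anc s => s * q + q
  | .seed x _ => x

section Protocol

variable {K D d p : ℕ} [NeZero K] [NeZero D] [NeZero d] [NeZero p]

/-- The choice of the gates that do not depend on the length of the chain. -/
structure ProtocolGates (A : Fin K → MPSTensor d (Fin D)) (p : ℕ) [NeZero p] where
  /-- preparation of the maximally entangled state of two bond qudits -/
  bell : Matrix (Fin D × Fin D) (Fin D × Fin D) ℂ
  bell_unitary : bell ∈ Matrix.unitaryGroup _ ℂ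
  bell_zero : ∀ i j, bell (i, j) (0, 0) = if i = j then 1 / (Real.sqrt D : ℂ) else 0
  /-- block `α`: unitary `∑_m A_α^m ⊗ |m⟩⟨0| + C` that adds one site -/
  site : Fin K → Matrix (Fin D × Fin d) (Fin D × Fin d) ℂ
  site_unitary : ∀ α, site α ∈ Matrix.unitaryGroup _ ℂ
  site_zero : ∀ α i j m, site α (i, m) (j, 0) = A α m i j
  /-- number of the defects that fusion measurements can leave -/
  η : ℕ
  /-- the unitary defects of block `α`, i.e. the maximally entangled states measured -/
  defect : Fin K → Fin η → Matrix (Fin D) (Fin D) ℂ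
  defect_unitary : ∀ α k, defect α k ∈ Matrix.unitaryGroup _ ℂ
  /-- how the outcomes are labelled -/
  label : Fin η ↪ Fin D × Fin D × Fin p
  /-- block `α`: unitary dilation of the isometry `(D / √η) ∑_k |k⟩⟨B_α^k|`, where
  `⟨B_α^k| = (1 / √D) ∑_{ij} (B_α^k)_{ij} ⟨ij|` -/
  fuse : Fin K → Matrix (Fin D × Fin D × Fin p) (Fin D × Fin D × Fin p) ℂ
  fuse_unitary : ∀ α, fuse α ∈ Matrix.unitaryGroup _ ℂ
  fuse_label : ∀ α k i j, fuse α (label k) (i, j, 0) = (Real.sqrt (D / η) : ℂ) * defect α k i j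
  fuse_other : ∀ α l i j, l ∉ Set.range label → fuse α l (i, j, 0) = 0

/-- The block qudits, those at the edges included. -/
def blockQudits (n q : ℕ) : Finset (Qudit n q) :=
  {.edgeL, .edgeR} ∪ Finset.univ.image Qudit.block

/-- The block qudits and the seed ancillas. -/
def seedQudits (n q : ℕ) : Finset (Qudit n q) :=
  blockQudits n q ∪ Finset.univ.image fun y : Fin ((n + 1) * q + 2) × Bool => .seed y.1 y.2

/-- The GHZ state of all block qudits. -/
noncomputable def ghz (K D d p n q : ℕ) : State (quditDim K D d p (n := n) (q := q)) :=
  fun c => if (c .edgeR).val = (c .edgeL).val ∧ ∀ x, (c (.block x)).val = (c .edgeL).val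
    then 1 / (Real.sqrt K : ℂ) else 0

/-- The choices made for a chain of `n + 1` segments of `q` sites. -/
structure ProtocolChoices {A : Fin K → MPSTensor d (Fin D)} (V : ProtocolGates A p) (n q : ℕ) where
  /-- adaptive circuit for the GHZ state -/
  seed : AdaptiveCircuit (quditDim K D d p (n := n) (q := q))
  seed_actsOn : seed.ActsOn (seedQudits n q)
  seed_prepares : seed.Prepares (blockQudits n q) (ghz K D d p n q)
  /-- correction applied in block `α` to the sites of segment `s`, given the fusion outcomes -/
  corr : Conf (quditDim K D d p (n := n) (q := q)) → Fin K → Fin (n + 1) →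
    Matrix (Fin q → Fin d) (Fin q → Fin d) ℂ
  corr_unitary : ∀ o α s, corr o α s ∈ Matrix.unitaryGroup _ ℂ
  /-- the corrections come from unitary pushing relations of the block -/
  corr_pushing : ∀ o α s,
    ∃ L ∈ Matrix.unitaryGroup (Fin D) ℂ, ∃ R ∈ Matrix.unitaryGroup (Fin D) ℂ,
      corr o α s * virtualToPhysical (A α) q = virtualToPhysical (A α) q * (L.transpose ⊗ₖ R)
  /-- correction applied in block `α` to the left edge bond qudit, given the fusion outcomes -/
  edge : Conf (quditDim K D d p (n := n) (q := q)) → Fin K → Matrix (Fin D) (Fin D) ℂ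
  edge_defect : ∀ o α, ∃ (k : Fin V.η) (z : ℂ), ‖z‖ = 1 ∧ edge o α = z • (V.defect α k).conjTranspose

variable {A : Fin K → MPSTensor d (Fin D)} (V : ProtocolGates A p) {n q : ℕ} [NeZero q]

/-- The `t`-th site of segment `s`. -/
def siteOf (s : Fin (n + 1)) (t : Fin q) : Fin ((n + 1) * q) := finProdFinEquiv (s, t)

/-- Prepare the bond qudits of segment `s` in the maximally entangled state. -/
def bellGate (s : Fin (n + 1)) : Gate (quditDim K D d p (n := n) (q := q)) where
  supp := {.bondL s, .bondR s}
  amp c c' := V.bell (c (.bondL s), c (.bondR s)) (c' (.bondL s), c' (.bondR s))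

/-- Add site `t` to segment `s`, conditioned on the block qudit of that site. -/
def siteGate (t : Fin q) (s : Fin (n + 1)) : Gate (quditDim K D d p (n := n) (q := q)) where
  supp := {.bondL s, .phys (siteOf s t), .block (siteOf s t)}
  amp c c' := if c (.block (siteOf s t)) = c' (.block (siteOf s t)) then
    V.site (c (.block (siteOf s t))) (c (.bondL s), c (.phys (siteOf s t)))
      (c' (.bondL s), c' (.phys (siteOf s t))) else 0

/-- Basis change before the fusion measurement between segments `s` and `s + 1`, conditioned on an
adjacent block qudit. -/
def fuseGate (s : Fin n) : Gate (quditDim K D d p (n := n) (q := q)) where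
  supp := {.bondR s.castSucc, .bondL s.succ, .anc s, .block (siteOf s.succ 0)}
  amp c c' := if c (.block (siteOf s.succ 0)) = c' (.block (siteOf s.succ 0)) then
    V.fuse (c (.block (siteOf s.succ 0))) (c (.bondR s.castSucc), c (.bondL s.succ), c (.anc s))
      (c' (.bondR s.castSucc), c' (.bondL s.succ), c' (.anc s)) else 0

/-- The qudits measured for fusion: all bond qudits except the two at the edges, and ancillas. -/
def fusedQudits (n q : ℕ) : Finset (Qudit n q) :=
  Finset.univ.biUnion fun s : Fin n => {.bondR s.castSucc, .bondL s.succ, .anc s}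

variable {V}

/-- Correction on segment `s` given the fusion outcomes `o`, conditioned on a block qudit. -/
def corrGate (P : ProtocolChoices V n q) (o : Conf (quditDim K D d p (n := n) (q := q)))
    (s : Fin (n + 1)) : Gate (quditDim K D d p (n := n) (q := q)) where
  supp := insert (.block (siteOf s 0)) (Finset.univ.image fun t => .phys (siteOf s t))
  amp c c' := if c (.block (siteOf s 0)) = c' (.block (siteOf s 0)) then
    P.corr o (c (.block (siteOf s 0))) s
      (fun t => c (.phys (siteOf s t))) (fun t => c' (.phys (siteOf s t))) else 0

/-- Correction on the left edge given the fusion outcomes `o`, conditioned on its block qudit. -/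
def edgeGate (P : ProtocolChoices V n q) (o : Conf (quditDim K D d p (n := n) (q := q))) :
    Gate (quditDim K D d p (n := n) (q := q)) where
  supp := {.bondL 0, .edgeL}
  amp c c' := if c .edgeL = c' .edgeL then P.edge o (c .edgeL) (c (.bondL 0)) (c' (.bondL 0)) else 0

/-- Fourier gate on the block qudit of site `x`; measuring afterwards is measuring in the basis of
eigenvectors of the shift operator. -/
noncomputable def fourierGate (K D d p : ℕ) {n q : ℕ} (x : Fin ((n + 1) * q)) :
    Gate (quditDim K D d p (n := n) (q := q)) where
  supp := {.block x}
  amp c c' := Complex.exp (-(2 * Real.pi * Complex.I *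
    ((c (.block x)).val : ℂ) * ((c' (.block x)).val : ℂ) / (K : ℂ))) / (Real.sqrt K : ℂ)

/-- Phase gate on the left edge block qudit, given the outcomes `k` of the block measurements. -/
noncomputable def phaseGate (K D d p : ℕ) {n q : ℕ}
    (k : Conf (quditDim K D d p (n := n) (q := q))) :
    Gate (quditDim K D d p (n := n) (q := q)) where
  supp := {.edgeL}
  amp c c' := if c .edgeL = c' .edgeL then
    Complex.exp (2 * Real.pi * Complex.I * ((c .edgeL).val : ℂ) / (K : ℂ) *
      ∑ x, ((k (.block x)).val : ℂ)) else 0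

/-- The protocol up to the measurement of the edges: GHZ seed, block-conditioned preparation of the
segments site by site, fusion measurements, block-conditioned corrections, disentangling of the
block qudits of the sites. -/
noncomputable def protocol (P : ProtocolChoices V n q) :
    AdaptiveCircuit (quditDim K D d p (n := n) (q := q)) :=
  P.seed.andThen <|
  .layer ((List.finRange (n + 1)).map (bellGate V)) <|
  (List.finRange q).reverse.foldr
    (fun t C => .layer ((List.finRange (n + 1)).map (siteGate V t)) C) <|
  .layer ((List.finRange n).map (fuseGate V)) <|
  .measure (fusedQudits n q) fun o =>
  .layer (edgeGate P o :: (List.finRange (n + 1)).map (corrGate P o)) <|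
  .layer ((List.finRange ((n + 1) * q)).map (fourierGate K D d p)) <|
  .measure (Finset.univ.image Qudit.block) fun k =>
  .layer [phaseGate K D d p k] .nil

/-- The qudits that carry the prepared state: physical qudits, edge bond and edge block qudits. -/
def outputQudits (n q : ℕ) : Finset (Qudit n q) :=
  {.edgeL, .edgeR, .bondL 0, .bondR (Fin.last n)} ∪ Finset.univ.image Qudit.phys

/-- The amplitude of `|m⟩ |ℓ r⟩` in the matrix product state of the tensor `⨁_α A_α` whose boundary
conditions are entangled with two edges, `∑_{ℓ r} ∑_m ⟨ℓ| A^{m_1} ⋯ A^{m_N} |r⟩ |m⟩ |ℓ r⟩`. Each of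
`ℓ` and `r` is a pair of an intra-block index and a block index. -/
def edgeEntangledAmp (A : Fin K → MPSTensor d (Fin D)) {N : ℕ} (m : Fin N → Fin d)
    (e : (Fin D × Fin K) × (Fin D × Fin K)) : ℂ :=
  wordProd (directSum A) m e.1 e.2

/-- This state on the output qudits of the protocol. -/
def edgeEntangledMPS (A : Fin K → MPSTensor d (Fin D)) (p n q : ℕ) :
    State (quditDim K D d p (n := n) (q := q)) :=
  fun c => edgeEntangledAmp A (fun x => c (.phys x))
    ((c (.bondL 0), c .edgeL), (c (.bondR (Fin.last n)), c .edgeR))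

/-- The unnormalized state of the physical qudits after the two edges of this state are measured in
the orthonormal basis given by the rows of the unitary `W`, with outcome `o`. -/
def edgeMeasuredMPS (A : Fin K → MPSTensor d (Fin D)) (N : ℕ)
    (W : Matrix ((Fin D × Fin K) × (Fin D × Fin K)) ((Fin D × Fin K) × (Fin D × Fin K)) ℂ)
    (o : (Fin D × Fin K) × (Fin D × Fin K)) : (Fin N → Fin d) → ℂ :=
  fun m => ∑ e, W o e * edgeEntangledAmp A m e

end Protocol

end MPSPrep

open MPSPrep

set_option linter.unusedSectionVars false
set_option linter.unusedSimpArgs false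

open scoped Kronecker

namespace MPSPrep


/-! ### Layers of disjoint gates -/

section CircuitCalculus

variable {Q : Type} [Fintype Q] [DecidableEq Q] {dim : Q → ℕ}

/-! Three facts carry the theorem.

In a GHZ superposition the block index can be read at every site, so within the component `α` each
conditioned layer acts as a product of local operators. Starting from Bell pairs, every segment
comes to carry the matrix product `W_s` of its `q` sites, up to `1/√D`. A fusion contracts
neighbouring segments with a matrix `B_s` determined by its outcome. After the fusions the amplitude
of component `α` is therefore proportional to an entry of `W_0 B_0 W_1 ⋯ B_{n-1} W_n`
(`fuseLayer_segState`, written with `pathSum`).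

The defects `B_s` can be removed by local physical unitaries. If a bond unitary commutes with `𝒜†𝒜`,
applying it to `𝒜` does not change the Gram matrix, and two matrices with equal Gram matrices differ
by a unitary on the physical side (`exists_unitary_mul_eq`, `Pushable.of_commute`). The defects are
closed under products and adjoints up to phases. Working from the right end, the right factor on a
segment is chosen as the inverse of the defect times the left factor of the next segment
(`exists_corrections`). The chain then telescopes (`pathSum_conj`), and only one defect survives, at
the left edge, where it is undone. That the defects form a complete set of measurement outcomes is
Schur orthogonality (`IsProjIrrep.twirl`).

The superposition over blocks must stay coherent, so no outcome may carry information about `α`. For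
this, all blocks get the same bond dimension (`A_α ⊗ 1`, with Weyl matrices completing the defects)
and the same set of outcomes, namely the product of the index sets of all blocks
(`exists_defects_inflate`). The weight of an outcome is then common to all blocks
(`PushableDefects.fuseMatrix_eq`). Measuring the block qudits of the sites in the Fourier basis
leaves only a phase linear in the block index, which one edge gate cancels
(`exp_mul_prod_fourierMatrix`).

The GHZ state comes from measuring the differences of neighbouring block qudits and shifting by
their partial sums (`mem_branches_seedCircuit`). The coefficients `μ_α^N` and the boundary matrix
enter only at the end, as a vector on the two edges (`sum_edgeWeight`). -/

theorem Gate.op_apply (g : Gate dim) (c c' : Conf dim) :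
    g.op c c' = if ∀ x, x ∉ g.supp → c x = c' x then g.amp c c' else 0 := rfl

/-- The amplitude of a gate depends only on the qudits of its support. -/
def Gate.Congr (g : Gate dim) : Prop :=
  ∀ c c' e e' : Conf dim, (∀ x ∈ g.supp, c x = e x) → (∀ x ∈ g.supp, c' x = e' x) →
    g.amp c c' = g.amp e e'

theorem applyGates_cons (g : Gate dim) (gs : List (Gate dim)) (ψ : State dim) :
    applyGates (g :: gs) ψ = applyGates gs (g.op.mulVec ψ) := rfl

/-- Disjointness leaves a single intermediate configuration between input `c'` and output `c`: after
the first gate, it equals `c'` on the supports still to be acted on and `c` elsewhere. Hence the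
amplitudes multiply without any sum. -/
theorem applyGates_apply (gs : List (Gate dim)) (hc : ∀ g ∈ gs, g.Congr)
    (hd : gs.Pairwise fun g g' => Disjoint g.supp g'.supp) (ψ : State dim) (c : Conf dim) :
    applyGates gs ψ c = ∑ c', (if ∀ x, (∀ g ∈ gs, x ∉ g.supp) → c x = c' x then
      (gs.map fun g => g.amp c c').prod else 0) * ψ c' := by
  induction gs generalizing ψ with
  | nil =>
    have : ∀ c' : Conf dim, (∀ x, (∀ g ∈ ([] : List (Gate dim)), x ∉ g.supp) → c x = c' x) ↔
        c = c' := fun c' => by simp [funext_iff]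
    simp only [this]
    simp [applyGates]
  | cons g gs ih =>
    rw [List.pairwise_cons] at hd
    rw [applyGates_cons, ih (fun g' hg' => hc g' (List.mem_cons_of_mem _ hg')) hd.2]
    simp only [Matrix.mulVec, dotProduct, Finset.mul_sum, ← mul_assoc]
    rw [Finset.sum_comm]
    refine Finset.sum_congr rfl fun c' _ => ?_
    rw [← Finset.sum_mul]
    congr 1
    classical
    set w : Conf dim := fun x => if ∃ h ∈ gs, x ∈ h.supp then c' x else c x with hw
    have hwc : ∀ x, (∀ h ∈ gs, x ∉ h.supp) → w x = c x := by
      intro x hx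
      rw [hw]
      exact if_neg (by push Not; exact hx)
    have hwc' : ∀ h ∈ gs, ∀ x ∈ h.supp, w x = c' x := fun h hh x hx => if_pos ⟨h, hh, hx⟩
    have hwg : ∀ x ∈ g.supp, w x = c x := fun x hx =>
      hwc x fun h hh hxh => Finset.disjoint_left.1 (hd.1 h hh) hx hxh
    rw [Finset.sum_eq_single w]
    · rw [if_pos fun x hx => (hwc x hx).symm, Gate.op_apply]
      have key : (∀ x, x ∉ g.supp → w x = c' x) ↔
          ∀ x, (∀ g' ∈ g :: gs, x ∉ g'.supp) → c x = c' x := by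
        simp only [List.forall_mem_cons]
        refine ⟨fun h x hx => ?_, fun h x hx => ?_⟩
        · rw [← hwc x hx.2, h x hx.1]
        · by_cases hx' : ∃ h ∈ gs, x ∈ h.supp
          · exact if_pos hx'
          · push Not at hx'
            rw [hwc x hx', h x ⟨hx, hx'⟩]
      simp only [key, mul_ite, mul_zero]
      refine if_congr Iff.rfl ?_ rfl
      rw [List.map_cons, List.prod_cons, mul_comm]
      congr 1
      · exact hc g List.mem_cons_self _ _ _ _ hwg fun _ _ => rfl
      · congr 1
        refine List.map_congr_left fun h hh => ?_
        exact hc h (List.mem_cons_of_mem _ hh) _ _ _ _ (fun _ _ => rfl) (hwc' h hh)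
    · intro e _ he
      by_contra hne
      obtain ⟨h1, h2⟩ := mul_ne_zero_iff.1 hne
      rw [ite_ne_right_iff] at h1
      rw [Gate.op_apply, ite_ne_right_iff] at h2
      refine he (funext fun x => ?_)
      by_cases hx : ∃ h ∈ gs, x ∈ h.supp
      · obtain ⟨h, hh, hxh⟩ := hx
        rw [hwc' h hh x hxh]
        exact h2.1 x fun hxg => Finset.disjoint_left.1 (hd.1 h hh) hxg hxh
      · push Not at hx
        rw [hwc x hx, h1.1 x hx]
    · simp

/-- A layer of gates, the `s`-th of which acts by the matrix `a s` on local configurations `X`. -/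
theorem layer_apply {Y : Type} (E : Y → Conf dim) (hE : Function.Surjective E)
    (hE' : Function.Injective E) {m : ℕ} (g : Fin m → Gate dim)
    (hc : ∀ s, (g s).Congr) (hd : ∀ s t, s ≠ t → Disjoint (g s).supp (g t).supp)
    {X : Type} [Fintype X] (set : (Fin m → X) → Y) (c : Y) (a : Fin m → X → ℂ)
    (inj : Function.Injective set)
    (hset : ∀ x y, (∀ s, y ∉ (g s).supp) → E c y = E (set x) y)
    (hamp : ∀ x s, (g s).amp (E c) (E (set x)) = a s (x s))
    (hzero : ∀ c', (∀ y, (∀ s, y ∉ (g s).supp) → E c y = E c' y) →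
      (∀ s, (g s).amp (E c) (E c') ≠ 0) → ∃ x, set x = c') (ψ : State dim) :
    applyGates ((List.finRange m).map g) ψ (E c) = ∑ x, (∏ s, a s (x s)) * ψ (E (set x)) := by
  rw [applyGates_apply]
  · symm
    -- Only configurations reachable by changing the local parts contribute. By `hzero`, any other
    -- one disagrees off the supports or makes some amplitude vanish.
    refine Fintype.sum_of_injective (fun x => E (set x)) (hE'.comp inj) _ _ ?_ ?_
    · intro e he
      obtain ⟨e, rfl⟩ := hE e
      by_contra hne
      have h1 := (mul_ne_zero_iff.1 hne).1
      rw [ite_ne_right_iff] at h1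
      obtain ⟨h1, h2⟩ := h1
      rw [List.map_map, ← List.ofFn_eq_map, List.prod_ofFn, Finset.prod_ne_zero_iff] at h2
      simp only [List.mem_map, List.mem_finRange, true_and, forall_exists_index,
        forall_apply_eq_imp_iff] at h1
      obtain ⟨x, rfl⟩ := hzero e h1 fun s => h2 s (Finset.mem_univ s)
      exact he ⟨x, rfl⟩
    · intro x
      rw [if_pos]
      · rw [List.map_map, ← List.ofFn_eq_map, List.prod_ofFn]
        simp only [Function.comp_apply, hamp]
      · intro y hy
        refine hset x y fun s => hy _ ?_
        simp
  · simpa using hc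
  · rw [List.pairwise_map]
    exact (List.nodup_finRange m).imp fun h => hd _ _ h

/-- Access to a part `X` of a configuration. -/
structure Lens (Y X : Type) where
  get : Y → X
  set : X → Y → Y
  get_set : ∀ x y, get (set x y) = x
  set_get : ∀ y, set (get y) y = y
  set_set : ∀ x x' y, set x (set x' y) = set x y

/-- The gate acts by the matrices `U` on the part of the configuration given by a lens. -/
structure Gate.ActsBy {Y X : Type} (E : Y → Conf dim) (g : Gate dim) (l : Lens Y X)
    (U : Y → Matrix X X ℂ) : Prop where
  const : ∀ x y, U (l.set x y) = U y
  op_eq : ∀ c c', (∀ x, x ∉ g.supp → E c x = E c' x) →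
    g.amp (E c) (E c') ≠ 0 → l.set (l.get c') c = c'
  agree : ∀ x c y, y ∉ g.supp → E c y = E (l.set x c) y
  amp_eq : ∀ x c, g.amp (E c) (E (l.set x c)) = U c (l.get c) x

variable {Y X : Type} [Fintype X] {E : Y → Conf dim} {g : Gate dim} {l : Lens Y X}
  {U : Y → Matrix X X ℂ}

theorem Gate.ActsBy.mulVec_apply (h : g.ActsBy E l U) (hE : E.Bijective) (ψ : State dim) (c : Y) :
    g.op.mulVec ψ (E c) = ∑ x, U c (l.get c) x * ψ (E (l.set x c)) := by
  symm
  refine Fintype.sum_of_injective (fun x => E (l.set x c)) (hE.1.comp fun x x' hx => ?_) _ _ ?_ ?_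
  · simpa [l.get_set] using congrArg l.get hx
  · intro e he
    obtain ⟨e, rfl⟩ := hE.2 e
    by_contra hne
    have h1 : g.op (E c) (E e) ≠ 0 := (mul_ne_zero_iff.1 hne).1
    rw [Gate.op_apply, ite_ne_right_iff] at h1
    exact he ⟨l.get e, congrArg E (h.op_eq c e h1.1 h1.2)⟩
  · intro x
    change _ = g.op (E c) (E (l.set x c)) * _
    rw [Gate.op_apply, if_pos (h.agree x c), h.amp_eq]

/-- The operator is block diagonal: a nonzero entry requires two configurations that differ only in
the part seen by the lens. On such a fibre the block is `U c`, which is constant along the fibre, so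
unitarity can be checked blockwise. -/
theorem Gate.ActsBy.op_mem_unitaryGroup [DecidableEq X] (h : g.ActsBy E l U) (hE : E.Bijective)
    (hU : ∀ c, U c ∈ Matrix.unitaryGroup X ℂ) : g.op ∈ Matrix.unitaryGroup (Conf dim) ℂ := by
  rw [Matrix.mem_unitaryGroup_iff]
  ext e e'
  obtain ⟨c, rfl⟩ := hE.2 e
  obtain ⟨c', rfl⟩ := hE.2 e'
  rw [Matrix.mul_apply]
  change g.op.mulVec (fun f => star g.op f (E c')) (E c) = _
  rw [h.mulVec_apply hE]
  classical
  have hop : ∀ x, star g.op (E (l.set x c)) (E c') =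
      if l.set (l.get c') c = c' then star (U c (l.get c') x) else 0 := by
    intro x
    rw [Matrix.star_apply, Gate.op_apply]
    split_ifs with h1 h2 h2
    · have : l.set x c = l.set x c' := by rw [← h2, l.set_set]
      rw [this, h.amp_eq, ← h2, h.const, l.get_set]
    · by_contra hne
      have h3 := h.op_eq _ _ h1 (by simpa using hne)
      rw [l.get_set] at h3
      apply h2
      conv_rhs => rw [← l.set_get c']
      rw [← l.set_set _ x c, ← h3, l.set_set]
    · exfalso
      refine h1 fun y hy => ?_
      rw [← h2, ← h.agree (l.get c') c y hy, ← h.agree x c y hy]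
    · simp
  simp only [hop, mul_ite, mul_zero]
  by_cases h2 : l.set (l.get c') c = c'
  · simp only [if_pos h2]
    have := congrFun (congrFun (Matrix.mem_unitaryGroup_iff.1 (hU c)) (l.get c)) (l.get c')
    simp only [Matrix.mul_apply, Matrix.star_apply] at this
    rw [this, Matrix.one_apply, Matrix.one_apply]
    refine if_congr ⟨fun h3 => ?_, fun h3 => ?_⟩ rfl rfl
    · rw [← h3, l.set_get] at h2
      rw [h2]
    · rw [hE.1 h3]
  · simp only [if_neg h2, Finset.sum_const_zero]
    rw [Matrix.one_apply, if_neg]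
    intro h3
    exact h2 (by rw [hE.1 h3, l.set_get])

theorem Gate.ActsBy.isLocalUnitary [DecidableEq X] (h : g.ActsBy E l U) (hE : E.Bijective)
    (hU : ∀ c, U c ∈ Matrix.unitaryGroup X ℂ) {pos : Q → ℕ} {r : ℕ} (hc : g.Congr)
    (hr : ∀ x ∈ g.supp, ∀ y ∈ g.supp, pos x ≤ pos y + r) : g.IsLocalUnitary pos r :=
  ⟨hc, h.op_mem_unitaryGroup hE hU, hr⟩

end CircuitCalculus

/-! ### Composition of adaptive circuits: depth, locality and branches -/

namespace AdaptiveCircuit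

variable {Q : Type} [Fintype Q] [DecidableEq Q] {dim : Q → ℕ}

theorem depth_andThen (C C' : AdaptiveCircuit dim) :
    (C.andThen C').depth ≤ C.depth + C'.depth := by
  induction C with
  | nil => simp [andThen, depth]
  | layer gs C ih => simp only [andThen, depth]; omega
  | measure S f ih =>
    simp only [andThen, depth]
    have : (Finset.univ.sup fun o => ((f o).andThen C').depth) ≤
        (Finset.univ.sup fun o => (f o).depth) + C'.depth := by
      refine Finset.sup_le fun o _ => (ih o).trans ?_
      have := Finset.le_sup (f := fun o => (f o).depth) (Finset.mem_univ o)
      simpa using this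
    omega

theorem IsLocal.andThen {pos : Q → ℕ} {r : ℕ} {C C' : AdaptiveCircuit dim} (h : C.IsLocal pos r)
    (h' : C'.IsLocal pos r) : (C.andThen C').IsLocal pos r := by
  induction C with
  | nil => exact h'
  | layer gs C ih => exact ⟨h.1, h.2.1, ih h.2.2⟩
  | measure S f ih => exact fun o => ih o (h o)

theorem mem_branches_andThen [∀ x, NeZero (dim x)] {C C' : AdaptiveCircuit dim} {ψ φ : State dim} :
    φ ∈ (C.andThen C').branches ψ ↔ ∃ χ ∈ C.branches ψ, φ ∈ C'.branches χ := by
  induction C generalizing ψ with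
  | nil => simp [andThen, branches]
  | layer gs C ih => exact ih
  | measure S f ih =>
    simp only [andThen, branches, Set.mem_ofPred_eq, ih]
    constructor
    · rintro ⟨o, ho, χ, h1, h2⟩
      exact ⟨χ, ⟨o, ho, h1⟩, h2⟩
    · rintro ⟨χ, ⟨o, ho, h1⟩, h2⟩
      exact ⟨o, ho, χ, h1, h2⟩

/-- The outermost layer of a circuit acts first, whereas `foldr` on states applies the last list
element first. Reversing the list reconciles the two, so in the protocol sites are added from right
to left within a segment. -/
theorem branches_foldr_layer [∀ x, NeZero (dim x)] {ι : Type} (G : ι → List (Gate dim))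
    (l : List ι) (C : AdaptiveCircuit dim) (ψ : State dim) :
    (l.reverse.foldr (fun t C => layer (G t) C) C).branches ψ =
      C.branches (l.foldr (fun t φ => applyGates (G t) φ) ψ) := by
  rw [List.foldr_reverse]
  induction l generalizing C with
  | nil => rfl
  | cons t l ih => rw [List.foldl_cons, ih]; rfl

theorem depth_foldr_layer {ι : Type} (G : ι → List (Gate dim)) (l : List ι)
    (C : AdaptiveCircuit dim) :
    (l.foldr (fun t C => layer (G t) C) C).depth = l.length + C.depth := by
  induction l with
  | nil => simp
  | cons t l ih => simp only [List.foldr_cons, depth, ih, List.length_cons]; omega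

theorem IsLocal.foldr_layer {pos : Q → ℕ} {r : ℕ} {ι : Type} {G : ι → List (Gate dim)}
    (hG : ∀ t, (∀ g ∈ G t, g.IsLocalUnitary pos r) ∧
      (G t).Pairwise fun g g' => Disjoint g.supp g'.supp) (l : List ι)
    {C : AdaptiveCircuit dim} (hC : C.IsLocal pos r) :
    (l.foldr (fun t C => layer (G t) C) C).IsLocal pos r := by
  induction l with
  | nil => exact hC
  | cons t l ih => exact ⟨(hG t).1, (hG t).2, ih⟩

end AdaptiveCircuit


/-! ### Configurations of the qudits of the protocol -/

/-- A configuration, as a tuple of functions. -/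
@[ext]
structure Cfg (K D d p n q : ℕ) where
  ph : Fin (n + 1) → Fin q → Fin d
  bl : Fin ((n + 1) * q) → Fin K
  eL : Fin K
  eR : Fin K
  bL : Fin (n + 1) → Fin D
  bR : Fin (n + 1) → Fin D
  an : Fin n → Fin p
  sd : Fin ((n + 1) * q + 2) → Bool → Fin K

section Configurations

variable {K D d p n q : ℕ}

/-- The configuration given by a tuple. -/
def Cfg.conf (κ : Cfg K D d p n q) : Conf (quditDim K D d p (n := n) (q := q))
  | .phys x => κ.ph (finProdFinEquiv.symm x).1 (finProdFinEquiv.symm x).2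
  | .block x => κ.bl x
  | .edgeL => κ.eL
  | .edgeR => κ.eR
  | .bondL s => κ.bL s
  | .bondR s => κ.bR s
  | .anc s => κ.an s
  | .seed x b => κ.sd x b

theorem siteOf_inj {s s' : Fin (n + 1)} {t t' : Fin q} :
    siteOf s t = siteOf s' t' ↔ s = s' ∧ t = t' := by
  simp [siteOf]

theorem siteOf_val (s : Fin (n + 1)) (t : Fin q) : (siteOf s t : ℕ) = s * q + t := by
  simp [siteOf, finProdFinEquiv, mul_comm, add_comm]

theorem exists_siteOf (x : Fin ((n + 1) * q)) : ∃ (s : Fin (n + 1)) (t : Fin q), siteOf s t = x :=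
  ⟨(finProdFinEquiv.symm x).1, (finProdFinEquiv.symm x).2,
    finProdFinEquiv.apply_symm_apply x⟩

@[simp] theorem Cfg.conf_phys (κ : Cfg K D d p n q) (s : Fin (n + 1)) (t : Fin q) :
    κ.conf (.phys (siteOf s t)) = κ.ph s t := by
  change κ.ph (finProdFinEquiv.symm (finProdFinEquiv (s, t))).1
    (finProdFinEquiv.symm (finProdFinEquiv (s, t))).2 = _
  rw [Equiv.symm_apply_apply]

@[simp] theorem Cfg.conf_block (κ : Cfg K D d p n q) (x) : κ.conf (.block x) = κ.bl x := rfl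
@[simp] theorem Cfg.conf_edgeL (κ : Cfg K D d p n q) : κ.conf .edgeL = κ.eL := rfl
@[simp] theorem Cfg.conf_edgeR (κ : Cfg K D d p n q) : κ.conf .edgeR = κ.eR := rfl
@[simp] theorem Cfg.conf_bondL (κ : Cfg K D d p n q) (s) : κ.conf (.bondL s) = κ.bL s := rfl
@[simp] theorem Cfg.conf_bondR (κ : Cfg K D d p n q) (s) : κ.conf (.bondR s) = κ.bR s := rfl
@[simp] theorem Cfg.conf_anc (κ : Cfg K D d p n q) (s) : κ.conf (.anc s) = κ.an s := rfl
@[simp] theorem Cfg.conf_seed (κ : Cfg K D d p n q) (x b) : κ.conf (.seed x b) = κ.sd x b := rfl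

/-- The tuple of a configuration. -/
def Cfg.ofConf (c : Conf (quditDim K D d p (n := n) (q := q))) : Cfg K D d p n q where
  ph s t := c (.phys (siteOf s t))
  bl x := c (.block x)
  eL := c .edgeL
  eR := c .edgeR
  bL s := c (.bondL s)
  bR s := c (.bondR s)
  an s := c (.anc s)
  sd x b := c (.seed x b)

theorem forall_qudit {P : Qudit n q → Prop} : (∀ y, P y) ↔
    (∀ s t, P (.phys (siteOf s t))) ∧ (∀ x, P (.block x)) ∧ P .edgeL ∧ P .edgeR ∧
    (∀ s, P (.bondL s)) ∧ (∀ s, P (.bondR s)) ∧ (∀ s, P (.anc s)) ∧ ∀ x b, P (.seed x b) := by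
  refine ⟨fun h => by simp [h], fun ⟨h1, h2, h3, h4, h5, h6, h7, h8⟩ y => ?_⟩
  cases y with
  | phys x => obtain ⟨s, t, rfl⟩ := exists_siteOf x; exact h1 s t
  | block x => exact h2 x
  | edgeL => exact h3
  | edgeR => exact h4
  | bondL s => exact h5 s
  | bondR s => exact h6 s
  | anc s => exact h7 s
  | seed x b => exact h8 x b

/-- Allows every state to be evaluated on `κ.conf` only, where the values have non-dependent types
and can be changed by record update. -/
theorem Cfg.conf_bijective :
    Function.Bijective (Cfg.conf : Cfg K D d p n q → Conf
        (quditDim K D d p (n := n) (q := q))) := by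
  refine ⟨fun κ κ' h => ?_, fun c => ⟨ofConf c, ?_⟩⟩
  · have h' := forall_qudit.1 (congrFun h)
    simp only [conf_phys, conf_block, conf_edgeL, conf_edgeR, conf_bondL, conf_bondR, conf_anc,
      conf_seed] at h'
    ext : 1
    · funext s t; exact h'.1 s t
    · funext x; exact h'.2.1 x
    · exact h'.2.2.1
    · exact h'.2.2.2.1
    · funext s; exact h'.2.2.2.2.1 s
    · funext s; exact h'.2.2.2.2.2.1 s
    · funext s; exact h'.2.2.2.2.2.2.1 s
    · funext x b; exact h'.2.2.2.2.2.2.2 x b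
  · funext y
    revert y
    exact forall_qudit.2 ⟨fun s t => conf_phys _ _ _, fun _ => rfl, rfl, rfl, fun _ => rfl,
      fun _ => rfl, fun _ => rfl, fun _ _ => rfl⟩

/-- Agreement of two configurations off a set of qudits. -/
theorem Cfg.agree_iff {S : Qudit n q → Prop} {κ κ' : Cfg K D d p n q} :
    (∀ y, ¬ S y → κ.conf y = κ'.conf y) ↔
    (∀ s t, ¬ S (.phys (siteOf s t)) → κ.ph s t = κ'.ph s t) ∧
    (∀ x, ¬ S (.block x) → κ.bl x = κ'.bl x) ∧ (¬ S .edgeL → κ.eL = κ'.eL) ∧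
    (¬ S .edgeR → κ.eR = κ'.eR) ∧
    (∀ s, ¬ S (.bondL s) → κ.bL s = κ'.bL s) ∧ (∀ s, ¬ S (.bondR s) → κ.bR s = κ'.bR s) ∧
    (∀ s, ¬ S (.anc s) → κ.an s = κ'.an s) ∧
    ∀ x b, ¬ S (.seed x b) → κ.sd x b = κ'.sd x b := by
  rw [forall_qudit]
  simp only [conf_phys, conf_block, conf_edgeL, conf_edgeR, conf_bondL, conf_bondR, conf_anc,
    conf_seed]
  exact Iff.rfl

end Configurations

/-! ### The gates of the protocol: local action, unitarity, range, disjointness -/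

section Gates

theorem update_apply₂ {α β γ : Type} [DecidableEq α] (f : α → β → γ) (s : α) (g : β → γ) (x : α)
    (y : β) : Function.update f s g x y = if x = s then g y else f x y := by
  rw [Function.update_apply]; split_ifs <;> rfl

variable {K D d p : ℕ} [NeZero K] [NeZero D] [NeZero d] [NeZero p]
  {A : Fin K → MPSTensor d (Fin D)} (V : ProtocolGates A p) {n q : ℕ} [NeZero q]

/-- The two bond qudits of a segment. -/
def bondLens (s : Fin (n + 1)) : Lens (Cfg K D d p n q) (Fin D × Fin D) where
  get κ := (κ.bL s, κ.bR s)
  set x κ := { κ with bL := Function.update κ.bL s x.1, bR := Function.update κ.bR s x.2 }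
  get_set _ _ := by simp
  set_get _ := by simp
  set_set _ _ _ := by simp

/-- The left bond qudit of a segment and the physical qudit of one of its sites. -/
def siteLens (t : Fin q) (s : Fin (n + 1)) : Lens (Cfg K D d p n q) (Fin D × Fin d) where
  get κ := (κ.bL s, κ.ph s t)
  set x κ := { κ with
    bL := Function.update κ.bL s x.1
    ph := Function.update κ.ph s (Function.update (κ.ph s) t x.2) }
  get_set _ _ := by simp
  set_get _ := by simp
  set_set _ _ _ := by simp

/-- The bond qudits of a fusion and its ancilla. -/
def fuseLens (s : Fin n) : Lens (Cfg K D d p n q) (Fin D × Fin D × Fin p) where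
  get κ := (κ.bR s.castSucc, κ.bL s.succ, κ.an s)
  set x κ := { κ with
    bR := Function.update κ.bR s.castSucc x.1
    bL := Function.update κ.bL s.succ x.2.1
    an := Function.update κ.an s x.2.2 }
  get_set _ _ := by simp
  set_get _ := by simp
  set_set _ _ _ := by simp

/-- The physical qudits of a segment. -/
def physLens (s : Fin (n + 1)) : Lens (Cfg K D d p n q) (Fin q → Fin d) where
  get κ := κ.ph s
  set x κ := { κ with ph := Function.update κ.ph s x }
  get_set _ _ := by simp
  set_get _ := by simp
  set_set _ _ _ := by simp

/-- The left edge bond qudit. -/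
def edgeLens : Lens (Cfg K D d p n q) (Fin D) where
  get κ := κ.bL 0
  set x κ := { κ with bL := Function.update κ.bL 0 x }
  get_set _ _ := by simp
  set_get _ := by simp
  set_set _ _ _ := by simp

/-- The block qudit of a site. -/
def blockLens (x : Fin ((n + 1) * q)) : Lens (Cfg K D d p n q) (Fin K) where
  get κ := κ.bl x
  set a κ := { κ with bl := Function.update κ.bl x a }
  get_set _ _ := by simp
  set_get _ := by simp
  set_set _ _ _ := by simp

/-- The trivial part of a configuration. -/
def trivialLens : Lens (Cfg K D d p n q) Unit where
  get _ := ()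
  set _ κ := κ
  get_set _ _ := rfl
  set_get _ := rfl
  set_set _ _ _ := rfl

theorem bellGate_congr (s : Fin (n + 1)) : (bellGate V (q := q) s).Congr := by
  intro c c' e e' h h'
  simp only [bellGate] at h h' ⊢
  rw [h (.bondL s) (by simp),
    h' (.bondL s) (by simp),
    h (.bondR s) (by simp),
    h' (.bondR s) (by simp)]

theorem bellGate_actsBy (s : Fin (n + 1)) :
    (bellGate V (q := q) s).ActsBy Cfg.conf (bondLens s) (fun _ => V.bell) where
  const _ _ := rfl
  op_eq c c' h h0 := by
    rw [Cfg.agree_iff] at h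
    simp [bellGate, siteOf_inj, -Bool.forall_bool] at h
    simp only [bondLens]
    ext : 1 <;> simp only [Function.update_eq_iff, funext_iff] <;> grind
  agree x c := by
    rw [Cfg.agree_iff]
    simp +contextual [bellGate, bondLens, siteOf_inj, Function.update_apply, -Bool.forall_bool]
  amp_eq x c := by
    simp [bellGate, bondLens]

theorem siteGate_congr (t : Fin q) (s : Fin (n + 1)) : (siteGate V t s).Congr := by
  intro c c' e e' h h'
  simp only [siteGate] at h h' ⊢
  rw [h (.bondL s) (by simp),
    h' (.bondL s) (by simp),
    h (.phys (siteOf s t)) (by simp),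
    h' (.phys (siteOf s t)) (by simp),
    h (.block (siteOf s t)) (by simp),
    h' (.block (siteOf s t)) (by simp)]

/-- The controlling block qudit lies in the support but is kept outside the lens. It only selects
the matrix, so each control value gives its own unitary block. The other conditioned gates are
treated in the same way. -/
theorem siteGate_actsBy (t : Fin q) (s : Fin (n + 1)) :
    (siteGate V t s).ActsBy Cfg.conf (siteLens t s) (fun κ => V.site (κ.bl (siteOf s t))) where
  const _ _ := rfl
  op_eq c c' h h0 := by
    rw [Cfg.agree_iff] at h
    simp [siteGate, siteOf_inj, -Bool.forall_bool] at h
    -- A nonzero amplitude forces the control to be unchanged, which agreement off the support does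
    -- not give.
    have hb : c.bl (siteOf s t) = c'.bl (siteOf s t) := by
      by_contra hne
      exact h0 (if_neg hne)
    simp only [siteLens]
    ext : 1 <;> simp only [Function.update_eq_iff, funext_iff] <;> grind [update_apply₂]
  agree x c := by
    rw [Cfg.agree_iff]
    simp +contextual [siteGate, siteLens, siteOf_inj, Function.update_apply, update_apply₂, -Bool.forall_bool]
  amp_eq x c := by
    simp [siteGate, siteLens]; exact if_pos rfl

theorem fuseGate_congr (s : Fin n) : (fuseGate V (q := q) s).Congr := by
  intro c c' e e' h h'
  simp only [fuseGate] at h h' ⊢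
  rw [h (.bondR s.castSucc) (by simp),
    h' (.bondR s.castSucc) (by simp),
    h (.bondL s.succ) (by simp),
    h' (.bondL s.succ) (by simp),
    h (.anc s) (by simp),
    h' (.anc s) (by simp),
    h (.block (siteOf s.succ 0)) (by simp),
    h' (.block (siteOf s.succ 0)) (by simp)]

theorem fuseGate_actsBy (s : Fin n) :
    (fuseGate V (q := q) s).ActsBy Cfg.conf (fuseLens s)
        (fun κ => V.fuse (κ.bl (siteOf s.succ 0))) where
  const _ _ := rfl
  op_eq c c' h h0 := by
    rw [Cfg.agree_iff] at h
    simp [fuseGate, siteOf_inj, -Bool.forall_bool] at h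
    have hb : c.bl (siteOf s.succ 0) = c'.bl (siteOf s.succ 0) := by
      by_contra hne
      exact h0 (if_neg hne)
    simp only [fuseLens]
    ext : 1 <;> simp only [Function.update_eq_iff, funext_iff] <;> grind
  agree x c := by
    rw [Cfg.agree_iff]
    simp +contextual [fuseGate, fuseLens, siteOf_inj, Function.update_apply, -Bool.forall_bool]
  amp_eq x c := by
    simp [fuseGate, fuseLens]; exact if_pos rfl

variable {V}

theorem corrGate_congr (P : ProtocolChoices V n q) (o : Conf (quditDim K D d p (n := n) (q := q)))
    (s : Fin (n + 1)) : (corrGate P o s).Congr := by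
  intro c c' e e' h h'
  simp only [corrGate] at h h' ⊢
  have h1 : ∀ t, c (.phys (siteOf s t)) = e (.phys (siteOf s t)) := fun t => h _ (by simp)
  have h2 : ∀ t, c' (.phys (siteOf s t)) = e' (.phys (siteOf s t)) := fun t => h' _ (by simp)
  simp only [h1, h2]
  rw [h (.block (siteOf s 0)) (by simp),
    h' (.block (siteOf s 0)) (by simp)]

theorem corrGate_actsBy (P : ProtocolChoices V n q)
    (o : Conf (quditDim K D d p (n := n) (q := q))) (s : Fin (n + 1)) :
    (corrGate P o s).ActsBy Cfg.conf (physLens s) (fun κ => P.corr o (κ.bl (siteOf s 0)) s) where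
  const _ _ := rfl
  op_eq c c' h h0 := by
    rw [Cfg.agree_iff] at h
    simp [corrGate, siteOf_inj, -Bool.forall_bool] at h
    have hb : c.bl (siteOf s 0) = c'.bl (siteOf s 0) := by
      by_contra hne
      exact h0 (if_neg hne)
    simp only [physLens]
    ext : 1 <;> simp only [Function.update_eq_iff, funext_iff] <;> grind [update_apply₂]
  agree x c := by
    rw [Cfg.agree_iff]
    simp +contextual [corrGate, physLens, siteOf_inj, Function.update_apply, update_apply₂, -Bool.forall_bool]
    exact fun s₁ t h h' => absurd h'.symm h
  amp_eq x c := by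
    simp [corrGate, physLens]; exact if_pos rfl

theorem edgeGate_congr (P : ProtocolChoices V n q)
    (o : Conf (quditDim K D d p (n := n) (q := q))) : (edgeGate P o).Congr := by
  intro c c' e e' h h'
  simp only [edgeGate] at h h' ⊢
  rw [h (.bondL 0) (by simp),
    h' (.bondL 0) (by simp),
    h (.edgeL) (by simp),
    h' (.edgeL) (by simp)]

theorem edgeGate_actsBy (P : ProtocolChoices V n q)
    (o : Conf (quditDim K D d p (n := n) (q := q))) :
    (edgeGate P o).ActsBy Cfg.conf (edgeLens) (fun κ => P.edge o κ.eL) where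
  const _ _ := rfl
  op_eq c c' h h0 := by
    rw [Cfg.agree_iff] at h
    simp [edgeGate, siteOf_inj, -Bool.forall_bool] at h
    have hb : c.eL = c'.eL := by
      by_contra hne
      exact h0 (if_neg hne)
    simp only [edgeLens]
    ext : 1 <;> simp only [Function.update_eq_iff, funext_iff] <;> grind
  agree x c := by
    rw [Cfg.agree_iff]
    simp +contextual [edgeGate, edgeLens, siteOf_inj, Function.update_apply, -Bool.forall_bool]
  amp_eq x c := by
    simp [edgeGate, edgeLens]; exact if_pos rfl

/-- The matrix of the discrete Fourier transform. -/
noncomputable def fourierMatrix (K : ℕ) : Matrix (Fin K) (Fin K) ℂ := fun a b =>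
  Complex.exp (-(2 * Real.pi * Complex.I * (a.val : ℂ) * (b.val : ℂ) / (K : ℂ))) / (Real.sqrt K : ℂ)

theorem fourierGate_congr (x : Fin ((n + 1) * q)) : (fourierGate K D d p x).Congr := by
  intro c c' e e' h h'
  simp only [fourierGate] at h h' ⊢
  rw [h (.block x) (by simp),
    h' (.block x) (by simp)]

theorem fourierGate_actsBy (x : Fin ((n + 1) * q)) :
    (fourierGate K D d p x).ActsBy Cfg.conf (blockLens x) (fun _ => fourierMatrix K) where
  const _ _ := rfl
  op_eq c c' h h0 := by
    rw [Cfg.agree_iff] at h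
    simp [fourierGate, siteOf_inj, -Bool.forall_bool] at h
    simp only [blockLens]
    ext : 1 <;> simp only [Function.update_eq_iff, funext_iff] <;> grind
  agree x c := by
    rw [Cfg.agree_iff]
    simp +contextual [fourierGate, blockLens, siteOf_inj, Function.update_apply, -Bool.forall_bool]
  amp_eq x c := by
    simp [fourierGate, blockLens, fourierMatrix]

theorem phaseGate_congr (k : Conf (quditDim K D d p (n := n) (q := q))) :
    (phaseGate K D d p k).Congr := by
  intro c c' e e' h h'
  simp only [phaseGate] at h h' ⊢
  rw [h (.edgeL) (by simp),
    h' (.edgeL) (by simp)]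

/-- The gate is diagonal: with nothing in the lens it is a `1 × 1` matrix, a phase chosen by the
edge qudit. -/
theorem phaseGate_actsBy (k : Conf (quditDim K D d p (n := n) (q := q))) :
    (phaseGate K D d p k).ActsBy Cfg.conf (trivialLens) (fun κ => Matrix.of fun _ _ =>
      Complex.exp (2 * Real.pi * Complex.I * (κ.eL.val : ℂ) / (K : ℂ) *
        ∑ x, ((k (.block x)).val : ℂ))) where
  const _ _ := rfl
  op_eq c c' h h0 := by
    rw [Cfg.agree_iff] at h
    simp [phaseGate, siteOf_inj, -Bool.forall_bool] at h
    have hb : c.eL = c'.eL := by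
      by_contra hne
      exact h0 (if_neg hne)
    simp only [trivialLens]
    ext : 1 <;> grind
  agree x c := by
    rw [Cfg.agree_iff]
    simp +contextual [phaseGate, trivialLens, siteOf_inj, Function.update_apply, -Bool.forall_bool]
  amp_eq x c := by
    simp only [phaseGate, trivialLens, Matrix.of_apply]
    rw [if_pos trivial]
    rfl

/-- A geometric sum with ratio `exp(2πi(b - a)/K)`. For `a ≠ b` the ratio is not `1`, while its
`K`-th power is `1`. -/
theorem sum_fourier (a b : Fin K) :
    ∑ x : Fin K, Complex.exp (-(2 * Real.pi * Complex.I * (a.val : ℂ) * (x.val : ℂ) / (K : ℂ))) *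
      star (Complex.exp (-(2 * Real.pi * Complex.I * (b.val : ℂ) * (x.val : ℂ) / (K : ℂ)))) =
      if a = b then (K : ℂ) else 0 := by
  have hK : (K : ℂ) ≠ 0 := Nat.cast_ne_zero.2 (NeZero.ne K)
  have key : ∀ x : Fin K,
      Complex.exp (-(2 * Real.pi * Complex.I * (a.val : ℂ) * (x.val : ℂ) / (K : ℂ))) *
      star (Complex.exp (-(2 * Real.pi * Complex.I * (b.val : ℂ) * (x.val : ℂ) / (K : ℂ)))) =
      Complex.exp (2 * Real.pi * Complex.I * (((b.val : ℤ) - a.val : ℤ) / (K : ℂ))) ^ x.val := by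
    intro x
    rw [Complex.star_def, ← Complex.exp_conj, ← Complex.exp_add, ← Complex.exp_nat_mul]
    congr 1
    simp only [map_neg, map_div₀, map_mul, Complex.conj_I, Complex.conj_ofReal, map_ofNat,
      map_natCast]
    push_cast
    field_simp
    ring
  simp only [key]
  rw [Fin.sum_univ_eq_sum_range (fun k => Complex.exp _ ^ k) K]
  split_ifs with h
  · simp [h]
  · have hne : Complex.exp
      (2 * Real.pi * Complex.I * (((b.val : ℤ) - a.val : ℤ) / (K : ℂ))) ≠ 1 := by
      rw [Ne, Complex.exp_eq_one_iff]
      rintro ⟨k, hk⟩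
      have h1 : ((((b.val : ℤ) - a.val : ℤ) : ℂ)) = ((k * K : ℤ) : ℂ) := by
        have := Complex.two_pi_I_ne_zero
        rw [mul_comm (k : ℂ)] at hk
        have h2 := mul_left_cancel₀ this hk
        rw [div_eq_iff hK] at h2
        rw [h2]; push_cast; ring
      have h1 := Int.cast_injective h1
      have ha := a.isLt
      have hb := b.isLt
      apply h
      ext
      -- The difference of two elements of `Fin K` is smaller than `K` in absolute value, so it is a
      -- multiple of `K` only if it is zero.
      have hk0 : k = 0 := by
        by_contra hk0
        rcases lt_or_gt_of_ne hk0 with hk | hk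
        · have : k * K ≤ -1 * K := by gcongr; omega
          omega
        · have : 1 * (K : ℤ) ≤ k * K := by gcongr; omega
          omega
      rw [hk0] at h1
      omega
    rw [geom_sum_eq hne, ← Complex.exp_nat_mul]
    have : (K : ℂ) * (2 * Real.pi * Complex.I * (((b.val : ℤ) - a.val : ℤ) / (K : ℂ))) =
        ((b.val : ℤ) - a.val : ℤ) * (2 * Real.pi * Complex.I) := by field_simp
    rw [this, Complex.exp_int_mul_two_pi_mul_I]
    simp

theorem fourierMatrix_mem_unitaryGroup : fourierMatrix K ∈ Matrix.unitaryGroup (Fin K) ℂ := by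
  have hK : (K : ℂ) ≠ 0 := Nat.cast_ne_zero.2 (NeZero.ne K)
  have hs : (Real.sqrt K : ℂ) * (Real.sqrt K : ℂ) = K := by
    rw [← Complex.ofReal_mul, Real.mul_self_sqrt (Nat.cast_nonneg K), Complex.ofReal_natCast]
  rw [Matrix.mem_unitaryGroup_iff]
  ext a b
  rw [Matrix.mul_apply]
  simp only [Matrix.star_apply, fourierMatrix, star_div₀]
  simp only [div_mul_div_comm]
  rw [← Finset.sum_div, sum_fourier, Matrix.one_apply]
  simp only [Complex.star_def, Complex.conj_ofReal, hs]
  split_ifs <;> simp [hK]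

/-- A segment occupies `q` consecutive positions, and gates joining segments, edges or seed ancillas
reach only to a neighbouring position. The range `q + 1` is a convenient common bound, not a sharp
one. -/
theorem bellGate_isLocalUnitary (s : Fin (n + 1)) :
    (bellGate V (q := q) s).IsLocalUnitary quditPos (q + 1) := by
  refine (bellGate_actsBy V s).isLocalUnitary Cfg.conf_bijective (fun _ => V.bell_unitary)
    (bellGate_congr V s) ?_
  simp [bellGate, quditPos]
  omega

theorem siteGate_isLocalUnitary (t : Fin q) (s : Fin (n + 1)) :
    (siteGate V t s).IsLocalUnitary quditPos (q + 1) := by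
  refine (siteGate_actsBy V t s).isLocalUnitary Cfg.conf_bijective (fun _ => V.site_unitary _)
    (siteGate_congr V t s) ?_
  simp [siteGate, quditPos, siteOf_val]
  omega

theorem fuseGate_isLocalUnitary (s : Fin n) :
    (fuseGate V (q := q) s).IsLocalUnitary quditPos (q + 1) := by
  refine (fuseGate_actsBy V s).isLocalUnitary Cfg.conf_bijective (fun _ => V.fuse_unitary _)
    (fuseGate_congr V s) ?_
  simp [fuseGate, quditPos, siteOf_val, add_mul]
  omega

theorem corrGate_isLocalUnitary (P : ProtocolChoices V n q)
    (o : Conf (quditDim K D d p (n := n) (q := q))) (s : Fin (n + 1)) :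
    (corrGate P o s).IsLocalUnitary quditPos (q + 1) := by
  refine (corrGate_actsBy P o s).isLocalUnitary Cfg.conf_bijective (fun _ => P.corr_unitary _ _ _)
    (corrGate_congr P o s) ?_
  simp [corrGate, quditPos, siteOf_val]
  exact ⟨fun a => by omega, fun a => ⟨by omega, fun b => by omega⟩⟩

theorem edgeGate_isLocalUnitary (P : ProtocolChoices V n q)
    (o : Conf (quditDim K D d p (n := n) (q := q))) :
    (edgeGate P o).IsLocalUnitary quditPos (q + 1) := by
  refine (edgeGate_actsBy P o).isLocalUnitary Cfg.conf_bijective (fun κ => ?_)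
    (edgeGate_congr P o) ?_
  · obtain ⟨k, z, hz, h⟩ := P.edge_defect o κ.eL
    rw [h, Matrix.mem_unitaryGroup_iff, Matrix.star_eq_conjTranspose, Matrix.conjTranspose_smul,
      Matrix.conjTranspose_conjTranspose, smul_mul_smul_comm, Complex.star_def, Complex.mul_conj,
      Complex.normSq_eq_norm_sq, hz, ← Matrix.star_eq_conjTranspose,
      Matrix.mem_unitaryGroup_iff'.1 (V.defect_unitary _ k)]
    simp
  · simp [edgeGate, quditPos]

theorem fourierGate_isLocalUnitary (x : Fin ((n + 1) * q)) :
    (fourierGate K D d p x).IsLocalUnitary quditPos (q + 1) := by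
  refine (fourierGate_actsBy x).isLocalUnitary Cfg.conf_bijective
    (fun _ => fourierMatrix_mem_unitaryGroup) (fourierGate_congr x) ?_
  simp [fourierGate]

theorem phaseGate_isLocalUnitary (k : Conf (quditDim K D d p (n := n) (q := q))) :
    (phaseGate K D d p k).IsLocalUnitary quditPos (q + 1) := by
  refine (phaseGate_actsBy k).isLocalUnitary Cfg.conf_bijective (fun κ => ?_)
    (phaseGate_congr k) ?_
  · rw [Matrix.mem_unitaryGroup_iff]
    ext
    simp only [Matrix.of_apply, Matrix.mul_apply, Finset.univ_unique, Finset.sum_singleton, Matrix.star_apply,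
      Matrix.one_apply_eq, Complex.star_def, ← Complex.exp_conj, ← Complex.exp_add]
    rw [← Complex.exp_zero]
    congr 1
    simp only [map_div₀, map_mul, Complex.conj_I, Complex.conj_ofReal, map_ofNat, map_natCast,
      map_sum]
    ring
  · simp [phaseGate]

theorem disjoint_bellGate {s s' : Fin (n + 1)} (h : s ≠ s') :
    Disjoint (bellGate V (q := q) s).supp (bellGate V (q := q) s').supp := by
  simp [bellGate, h, h.symm]

theorem disjoint_siteGate (t : Fin q) {s s' : Fin (n + 1)} (h : s ≠ s') :
    Disjoint (siteGate V t s).supp (siteGate V t s').supp := by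
  simp [siteGate, siteOf_inj, h, h.symm]

theorem disjoint_fuseGate {s s' : Fin n} (h : s ≠ s') :
    Disjoint (fuseGate V (q := q) s).supp (fuseGate V (q := q) s').supp := by
  simp [fuseGate, siteOf_inj, h, h.symm]

theorem disjoint_corrGate (P : ProtocolChoices V n q)
    (o : Conf (quditDim K D d p (n := n) (q := q))) {s s' : Fin (n + 1)} (h : s ≠ s') :
    Disjoint (corrGate P o s).supp (corrGate P o s').supp := by
  simp [corrGate, siteOf_inj, h, h.symm, Finset.disjoint_left]

theorem disjoint_edgeGate_corrGate (P : ProtocolChoices V n q)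
    (o : Conf (quditDim K D d p (n := n) (q := q))) (s : Fin (n + 1)) :
    Disjoint (edgeGate P o).supp (corrGate P o s).supp := by
  simp [corrGate, edgeGate, Finset.disjoint_left]

theorem disjoint_fourierGate {x y : Fin ((n + 1) * q)} (h : x ≠ y) :
    Disjoint (fourierGate K D d p x).supp (fourierGate K D d p y).supp := by
  simp [fourierGate, h, h.symm]

end Gates


/-! ### Completion of orthonormal columns to a unitary -/

/-- An orthonormal family indexed by part of `ι` extends to an orthonormal basis indexed by `ι`.
Every dilation in the construction comes from this: Bell pairs, added sites, fusion, GHZ pairs and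
the final edge basis. -/
theorem exists_unitary_extension {ι : Type} [Fintype ι] [DecidableEq ι] (s : Set ι)
    (M : Matrix ι ι ℂ)
    (h : ∀ j ∈ s, ∀ j' ∈ s, ∑ i, star (M i j) * M i j' = if j = j' then 1 else 0) :
    ∃ U ∈ Matrix.unitaryGroup ι ℂ, ∀ i, ∀ j ∈ s, U i j = M i j := by
  let v : ι → EuclideanSpace ℂ ι := fun j => WithLp.toLp 2 fun i => M i j
  have hv : Orthonormal ℂ (s.domRestrict v) := by
    rw [orthonormal_iff_ite]
    rintro ⟨j, hj⟩ ⟨j', hj'⟩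
    have := h j hj j' hj'
    simp only [Set.domRestrict_apply, PiLp.inner_apply, RCLike.inner_apply, v, Subtype.mk.injEq]
    rw [← this]
    exact Finset.sum_congr rfl fun i _ => mul_comm _ _
  obtain ⟨b, hb⟩ := hv.exists_orthonormalBasis_extension_of_card_eq (by simp)
  refine ⟨Matrix.of fun i j => b j i, ?_, fun i j hj => ?_⟩
  · rw [Matrix.mem_unitaryGroup_iff']
    ext j j'
    have := orthonormal_iff_ite.1 b.orthonormal j j'
    simp only [PiLp.inner_apply, RCLike.inner_apply] at this
    rw [Matrix.mul_apply, Matrix.one_apply, ← this]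
    exact Finset.sum_congr rfl fun i _ => mul_comm _ _
  · simp [hb j hj, v]

/-! ### The seed state -/

section Line

variable {K D d p n q : ℕ}

/-- The block qudits in their order on the line. -/
def lineQudit (x : Fin ((n + 1) * q + 2)) : Qudit n q :=
  Fin.cases .edgeL (Fin.lastCases .edgeR .block) x

@[simp] theorem lineQudit_zero : lineQudit (n := n) (q := q) 0 = .edgeL := rfl

@[simp] theorem lineQudit_last : lineQudit (n := n) (q := q) (Fin.last _) = .edgeR := by
  rw [← Fin.succ_last]
  simp [lineQudit, -Fin.succ_last]

@[simp] theorem lineQudit_succ (x : Fin ((n + 1) * q)) :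
    lineQudit x.castSucc.succ = .block x := by
  simp [lineQudit]

theorem forall_line {P : Fin ((n + 1) * q + 2) → Prop} :
    (∀ x, P x) ↔ P 0 ∧ P (Fin.last _) ∧ ∀ x : Fin ((n + 1) * q), P x.castSucc.succ := by
  rw [Fin.forall_fin_succ, Fin.forall_fin_succ', Fin.succ_last]
  tauto

/-- The values of the block qudits in their order on the line. -/
def Cfg.line (κ : Cfg K D d p n q) : Fin ((n + 1) * q + 2) → Fin K :=
  Fin.cons κ.eL (Fin.snoc (α := fun _ => Fin K) κ.bl κ.eR)

@[simp] theorem Cfg.line_zero (κ : Cfg K D d p n q) : κ.line 0 = κ.eL := rfl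

@[simp] theorem Cfg.line_last (κ : Cfg K D d p n q) : κ.line (Fin.last _) = κ.eR := by
  rw [← Fin.succ_last]
  simp [line, -Fin.succ_last]

@[simp] theorem Cfg.line_succ (κ : Cfg K D d p n q) (x : Fin ((n + 1) * q)) :
    κ.line x.castSucc.succ = κ.bl x := by
  simp [line]

/-- Replace the values of the block qudits. -/
def Cfg.withLine (b : Fin ((n + 1) * q + 2) → Fin K) (κ : Cfg K D d p n q) : Cfg K D d p n q :=
  { κ with eL := b 0, eR := b (Fin.last _), bl := fun x => b x.castSucc.succ }

@[simp] theorem Cfg.line_withLine (b) (κ : Cfg K D d p n q) : (κ.withLine b).line = b :=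
  funext (forall_line.2 ⟨line_zero _, line_last _, line_succ _⟩)

@[simp] theorem Cfg.withLine_line (κ : Cfg K D d p n q) : κ.withLine κ.line = κ := by
  ext : 1
  · rfl
  · funext x; exact line_succ κ x
  · rfl
  · exact line_last κ
  all_goals rfl

@[simp] theorem Cfg.withLine_withLine (b b') (κ : Cfg K D d p n q) :
    (κ.withLine b).withLine b' = κ.withLine b' := rfl

theorem Cfg.ofConf_conf (κ : Cfg K D d p n q) : ofConf κ.conf = κ := by
  ext : 1
  · funext s t; exact conf_phys κ s t
  all_goals rfl

theorem Cfg.line_ofConf {c e : Conf (quditDim K D d p (n := n) (q := q))} :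
    ∀ x, c (lineQudit x) = e (lineQudit x) → (ofConf c).line x = (ofConf e).line x := by
  refine forall_line.2 ⟨fun h => h, fun h => ?_, fun y h => ?_⟩
  · rw [lineQudit_last] at h
    rw [line_last, line_last]
    exact h
  · rw [lineQudit_succ] at h
    rw [line_succ, line_succ]
    exact h

theorem Cfg.agree_iff_line {S : Qudit n q → Prop} {κ κ' : Cfg K D d p n q} :
    (∀ y, ¬ S y → κ.conf y = κ'.conf y) ↔
    (∀ s t, ¬ S (.phys (siteOf s t)) → κ.ph s t = κ'.ph s t) ∧
    (∀ x, ¬ S (lineQudit x) → κ.line x = κ'.line x) ∧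
    (∀ s, ¬ S (.bondL s) → κ.bL s = κ'.bL s) ∧ (∀ s, ¬ S (.bondR s) → κ.bR s = κ'.bR s) ∧
    (∀ s, ¬ S (.anc s) → κ.an s = κ'.an s) ∧
    ∀ x b, ¬ S (.seed x b) → κ.sd x b = κ'.sd x b := by
  rw [agree_iff, forall_line (P := fun x => ¬ S (lineQudit x) → κ.line x = κ'.line x)]
  simp only [line_zero, line_last, line_succ, lineQudit_zero, lineQudit_last, lineQudit_succ]
  tauto

theorem Cfg.ext_line {κ κ' : Cfg K D d p n q} (h1 : κ.ph = κ'.ph) (h2 : κ.line = κ'.line)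
    (h3 : κ.bL = κ'.bL) (h4 : κ.bR = κ'.bR) (h5 : κ.an = κ'.an) (h6 : κ.sd = κ'.sd) : κ = κ' := by
  have h := Cfg.agree_iff_line (S := fun _ => False) (κ := κ) (κ' := κ')
  refine conf_bijective.1 (funext fun y => h.2 ?_ y id)
  simp [h1, h2, h3, h4, h5, h6]

theorem lineQudit_injective : Function.Injective (lineQudit (n := n) (q := q)) := by
  refine forall_line.2 ⟨forall_line.2 ?_, forall_line.2 ?_, fun x => forall_line.2 ?_⟩ <;> simp

@[simp] theorem lineQudit_inj {x y : Fin ((n + 1) * q + 2)} : lineQudit x = lineQudit y ↔ x = y :=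
  lineQudit_injective.eq_iff

@[simp] theorem lineQudit_ne (x : Fin ((n + 1) * q + 2)) :
    (∀ y, lineQudit x ≠ .phys y) ∧ (∀ y, lineQudit x ≠ .bondL y) ∧ (∀ y, lineQudit x ≠ .bondR y) ∧
    (∀ y, lineQudit x ≠ .anc y) ∧ ∀ y b, lineQudit x ≠ .seed y b := by
  revert x
  exact forall_line.2 (by simp)

theorem quditPos_lineQudit (x : Fin ((n + 1) * q + 2)) : quditPos (lineQudit x) = x := by
  revert x
  exact forall_line.2 (by simp [quditPos])

theorem lineQudit_mem (x : Fin ((n + 1) * q + 2)) : lineQudit x ∈ blockQudits n q := by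
  revert x
  exact forall_line.2 (by simp [blockQudits])

end Line


/-! ### Gates of the GHZ circuit -/

section Seed

variable {K D d p : ℕ} [NeZero K] [NeZero D] [NeZero d] [NeZero p] {n q : ℕ} [NeZero q]

/-- A gate on a block qudit and its seed ancilla. -/
def pairGate (D d p : ℕ) (W : Matrix (Fin K × Fin K) (Fin K × Fin K) ℂ)
    (x : Fin ((n + 1) * q + 2)) : Gate (quditDim K D d p (n := n) (q := q)) where
  supp := {lineQudit x, .seed x false}
  amp c c' := W ((Cfg.ofConf c).line x, (Cfg.ofConf c).sd x false)
    ((Cfg.ofConf c').line x, (Cfg.ofConf c').sd x false)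

/-- Add the value of a block qudit to the seed ancilla of the next one. -/
def linkGate (K D d p : ℕ) [NeZero K] (y : Fin ((n + 1) * q + 1)) :
    Gate (quditDim K D d p (n := n) (q := q)) where
  supp := {lineQudit y.castSucc, .seed y.succ false}
  amp c c' := if (Cfg.ofConf c).line y.castSucc = (Cfg.ofConf c').line y.castSucc then
    (if (Cfg.ofConf c).sd y.succ false + (Cfg.ofConf c).line y.castSucc =
      (Cfg.ofConf c').sd y.succ false then 1 else 0) else 0

/-- Shift the value of a block qudit. -/
def shiftGate (D d p : ℕ) (σ : Fin K) (x : Fin ((n + 1) * q + 2)) :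
    Gate (quditDim K D d p (n := n) (q := q)) where
  supp := {lineQudit x}
  amp c c' := if (Cfg.ofConf c).line x - σ = (Cfg.ofConf c').line x then 1 else 0

theorem pairGate_congr (W : Matrix (Fin K × Fin K) (Fin K × Fin K) ℂ)
    (x : Fin ((n + 1) * q + 2)) : (pairGate D d p W x).Congr := by
  intro c c' e e' h h'
  have h1 := Cfg.line_ofConf x (h _ (by simp [pairGate]))
  have h2 := Cfg.line_ofConf x (h' _ (by simp [pairGate]))
  have h3 : (Cfg.ofConf c).sd x false = (Cfg.ofConf e).sd x false := h _ (by simp [pairGate])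
  have h4 : (Cfg.ofConf c').sd x false = (Cfg.ofConf e').sd x false := h' _ (by simp [pairGate])
  simp only [pairGate, h1, h2, h3, h4]

theorem linkGate_congr (y : Fin ((n + 1) * q + 1)) : (linkGate K D d p y).Congr := by
  intro c c' e e' h h'
  have h1 := Cfg.line_ofConf y.castSucc (h _ (by simp [linkGate]))
  have h2 := Cfg.line_ofConf y.castSucc (h' _ (by simp [linkGate]))
  have h3 : (Cfg.ofConf c).sd y.succ false = (Cfg.ofConf e).sd y.succ false :=
    h _ (by simp [linkGate])
  have h4 : (Cfg.ofConf c').sd y.succ false = (Cfg.ofConf e').sd y.succ false :=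
    h' _ (by simp [linkGate])
  simp only [linkGate, h1, h2, h3, h4]

theorem shiftGate_congr (σ : Fin K) (x : Fin ((n + 1) * q + 2)) :
    (shiftGate D d p σ x).Congr := by
  intro c c' e e' h h'
  have h1 := Cfg.line_ofConf x (h _ (by simp [shiftGate]))
  have h2 := Cfg.line_ofConf x (h' _ (by simp [shiftGate]))
  simp only [shiftGate, h1, h2]

/-- A block qudit and its seed ancilla. -/
def pairLens (x : Fin ((n + 1) * q + 2)) : Lens (Cfg K D d p n q) (Fin K × Fin K) where
  get κ := (κ.line x, κ.sd x false)
  set a κ := ({ κ with sd := Function.update κ.sd x (Function.update (κ.sd x) false a.2) } :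
    Cfg K D d p n q).withLine (Function.update κ.line x a.1)
  get_set a κ := by
    rw [Cfg.line_withLine]
    simp [Cfg.withLine]
  set_get κ := by
    simp
  set_set a a' κ := by
    rw [Cfg.line_withLine]
    simp [Cfg.withLine]

/-- A seed ancilla. -/
def seedLens (y : Fin ((n + 1) * q + 1)) : Lens (Cfg K D d p n q) (Fin K) where
  get κ := κ.sd y.succ false
  set a κ := { κ with sd := Function.update κ.sd y.succ (Function.update (κ.sd y.succ) false a) }
  get_set _ _ := by simp
  set_get _ := by simp
  set_set _ _ _ := by simp

/-- A qudit of the line. -/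
def lineLens (x : Fin ((n + 1) * q + 2)) : Lens (Cfg K D d p n q) (Fin K) where
  get κ := κ.line x
  set a κ := κ.withLine (Function.update κ.line x a)
  get_set a κ := by simp
  set_get κ := by simp
  set_set a a' κ := by simp

theorem pairGate_actsBy (W : Matrix (Fin K × Fin K) (Fin K × Fin K) ℂ)
    (x : Fin ((n + 1) * q + 2)) :
    (pairGate D d p W x).ActsBy Cfg.conf (pairLens x) fun _ => W where
  const _ _ := rfl
  op_eq c c' h _ := by
    rw [Cfg.agree_iff_line] at h
    simp [pairGate, -Bool.forall_bool, (lineQudit_ne x).1, fun y => ((lineQudit_ne x).1 y).symm,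
      fun y => ((lineQudit_ne x).2.1 y).symm, fun y => ((lineQudit_ne x).2.2.1 y).symm,
      fun y => ((lineQudit_ne x).2.2.2.1 y).symm,
      fun y b => ((lineQudit_ne x).2.2.2.2 y b).symm] at h
    obtain ⟨h1, h2, h3, h4, h5, h6⟩ := h
    refine Cfg.ext_line (funext fun s => funext fun t => h1 s t) ?_ (funext h3) (funext h4)
      (funext h5) ?_
    · simp only [pairLens, Cfg.line_withLine, Function.update_eq_iff]
      exact ⟨trivial, h2⟩
    · simp only [pairLens, Cfg.withLine, funext_iff]
      grind [update_apply₂]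
  agree a c := by
    rw [Cfg.agree_iff_line]
    have : ((pairLens x).set a c).line = Function.update c.line x a.1 := Cfg.line_withLine _ _
    simp +contextual [pairGate, this]
    simp +contextual [pairLens, Function.update_apply, update_apply₂, Cfg.withLine]
  amp_eq a c := by
    have : ((pairLens x).set a c).line = Function.update c.line x a.1 := Cfg.line_withLine _ _
    simp only [pairGate, Cfg.ofConf_conf, this]
    simp [pairLens, Cfg.withLine]

theorem linkGate_actsBy (y : Fin ((n + 1) * q + 1)) :
    (linkGate K D d p y).ActsBy Cfg.conf (seedLens y) fun κ => Matrix.of fun a a' =>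
      if a + κ.line y.castSucc = a' then 1 else 0 where
  const _ _ := rfl
  op_eq c c' h h0 := by
    rw [Cfg.agree_iff_line] at h
    have hb : c.line y.castSucc = c'.line y.castSucc := by
      by_contra hne
      refine h0 (if_neg ?_)
      rwa [Cfg.ofConf_conf, Cfg.ofConf_conf]
    simp [linkGate, -Bool.forall_bool, fun z => ((lineQudit_ne y.castSucc).1 z).symm,
      fun z => ((lineQudit_ne y.castSucc).2.1 z).symm,
      fun z => ((lineQudit_ne y.castSucc).2.2.1 z).symm,
      fun z => ((lineQudit_ne y.castSucc).2.2.2.1 z).symm,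
      fun z b => ((lineQudit_ne y.castSucc).2.2.2.2 z b).symm] at h
    obtain ⟨h1, h2, h3, h4, h5, h6⟩ := h
    refine Cfg.ext_line (funext fun s => funext fun t => h1 s t) (funext fun x => ?_) (funext h3)
      (funext h4) (funext h5) ?_
    · change c.line x = _
      by_cases hx : x = y.castSucc
      · rw [hx, hb]
      · exact h2 x hx
    · simp only [seedLens, funext_iff]
      grind [update_apply₂]
  agree a c := by
    rw [Cfg.agree_iff_line]
    have : ((seedLens y).set a c).line = c.line := rfl
    simp +contextual [linkGate, this]
    simp +contextual [seedLens, Function.update_apply, update_apply₂]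
  amp_eq a c := by
    have : ((seedLens y).set a c).line = c.line := rfl
    simp only [linkGate, Cfg.ofConf_conf, this, if_true]
    simp [seedLens]

theorem shiftGate_actsBy (σ : Fin K) (x : Fin ((n + 1) * q + 2)) :
    (shiftGate D d p σ x).ActsBy Cfg.conf (lineLens x) fun _ => Matrix.of fun a a' =>
      if a - σ = a' then 1 else 0 where
  const _ _ := rfl
  op_eq c c' h h0 := by
    rw [Cfg.agree_iff_line] at h
    simp [shiftGate, -Bool.forall_bool, fun z => ((lineQudit_ne x).1 z).symm,
      fun z => ((lineQudit_ne x).2.1 z).symm,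
      fun z => ((lineQudit_ne x).2.2.1 z).symm,
      fun z => ((lineQudit_ne x).2.2.2.1 z).symm,
      fun z b => ((lineQudit_ne x).2.2.2.2 z b).symm] at h
    obtain ⟨h1, h2, h3, h4, h5, h6⟩ := h
    refine Cfg.ext_line (funext fun s => funext fun t => h1 s t) ?_ (funext h3)
      (funext h4) (funext h5) (funext fun z => funext fun b => h6 z b)
    simp only [lineLens, Cfg.line_withLine, Function.update_eq_iff]
    exact ⟨trivial, h2⟩
  agree a c := by
    rw [Cfg.agree_iff_line]
    simp +contextual [shiftGate, lineLens]
    simp [Cfg.withLine]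
  amp_eq a c := by
    simp [shiftGate, Cfg.ofConf_conf, lineLens]

theorem pairGate_isLocalUnitary {W : Matrix (Fin K × Fin K) (Fin K × Fin K) ℂ}
    (hW : W ∈ Matrix.unitaryGroup _ ℂ) (x : Fin ((n + 1) * q + 2)) :
    (pairGate D d p W x).IsLocalUnitary quditPos (q + 1) := by
  refine (pairGate_actsBy W x).isLocalUnitary Cfg.conf_bijective (fun _ => hW)
    (pairGate_congr W x) ?_
  simp [pairGate, quditPos_lineQudit]
  simp [quditPos]

theorem linkGate_isLocalUnitary (y : Fin ((n + 1) * q + 1)) :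
    (linkGate K D d p y).IsLocalUnitary quditPos (q + 1) := by
  refine (linkGate_actsBy y).isLocalUnitary Cfg.conf_bijective (fun κ => ?_)
    (linkGate_congr y) ?_
  · rw [Matrix.mem_unitaryGroup_iff]
    ext a b
    simp [Matrix.mul_apply, Matrix.one_apply, Matrix.star_apply, apply_ite, eq_comm]
  · simp [linkGate, quditPos_lineQudit]
    simp [quditPos]
    omega

theorem shiftGate_isLocalUnitary (σ : Fin K) (x : Fin ((n + 1) * q + 2)) :
    (shiftGate D d p σ x).IsLocalUnitary quditPos (q + 1) := by
  refine (shiftGate_actsBy σ x).isLocalUnitary Cfg.conf_bijective (fun κ => ?_)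
    (shiftGate_congr σ x) ?_
  · rw [Matrix.mem_unitaryGroup_iff]
    ext a b
    simp [Matrix.mul_apply, Matrix.one_apply, Matrix.star_apply, apply_ite, eq_comm]
  · simp [shiftGate]

end Seed


/-! ### The GHZ circuit: evolution, outcomes and resources -/

section SeedCircuit

variable {K D d p : ℕ} [NeZero K] [NeZero D] [NeZero d] [NeZero p] {n q : ℕ} [NeZero q]

theorem ketZero_conf (κ : Cfg K D d p n q) : ketZero (quditDim K D d p) κ.conf =
    if (∀ s t, κ.ph s t = 0) ∧ (∀ x, κ.line x = 0) ∧ (∀ s, κ.bL s = 0) ∧ (∀ s, κ.bR s = 0) ∧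
      (∀ s, κ.an s = 0) ∧ ∀ x b, κ.sd x b = 0 then 1 else 0 := by
  refine if_congr ?_ rfl rfl
  rw [forall_qudit, forall_line (P := fun x => κ.line x = 0)]
  simp only [Cfg.line_zero, Cfg.line_last, Cfg.line_succ, Cfg.conf_phys, Cfg.conf_block,
    Cfg.conf_edgeL, Cfg.conf_edgeR, Cfg.conf_bondL, Cfg.conf_bondR, Cfg.conf_anc, Cfg.conf_seed]
  constructor
  · rintro ⟨h1, h2, h3, h4, h5, h6, h7, h8⟩
    exact ⟨h1, ⟨h3, h4, h2⟩, h5, h6, h7, h8⟩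
  · rintro ⟨h1, ⟨h3, h4, h2⟩, h5, h6, h7, h8⟩
    exact ⟨h1, h2, h3, h4, h5, h6, h7, h8⟩

theorem Cfg.agree_iff_line' {ι : Type} {g : ι → Finset (Qudit n q)} {κ κ' : Cfg K D d p n q} :
    (∀ y, (∀ i, y ∉ g i) → κ.conf y = κ'.conf y) ↔
    (∀ s t, (∀ i, .phys (siteOf s t) ∉ g i) → κ.ph s t = κ'.ph s t) ∧
    (∀ x, (∀ i, lineQudit x ∉ g i) → κ.line x = κ'.line x) ∧
    (∀ s, (∀ i, .bondL s ∉ g i) → κ.bL s = κ'.bL s) ∧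
    (∀ s, (∀ i, .bondR s ∉ g i) → κ.bR s = κ'.bR s) ∧
    (∀ s, (∀ i, .anc s ∉ g i) → κ.an s = κ'.an s) ∧
    ∀ x b, (∀ i, .seed x b ∉ g i) → κ.sd x b = κ'.sd x b := by
  have := Cfg.agree_iff_line (S := fun y => ∃ i, y ∈ g i) (κ := κ) (κ' := κ')
  simpa only [not_exists] using this

/-- Replace the values of the first seed ancillas. -/
def Cfg.withSeed (z : Fin ((n + 1) * q + 2) → Fin K) (κ : Cfg K D d p n q) : Cfg K D d p n q :=
  { κ with sd := fun x b => if b then κ.sd x true else z x }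

@[simp] theorem Cfg.line_withSeed (z) (κ : Cfg K D d p n q) : (κ.withSeed z).line = κ.line := rfl

/-- All qudits outside of the line and the first seed ancillas are zero. -/
def Cfg.RestZero (κ : Cfg K D d p n q) : Prop :=
  (∀ s t, κ.ph s t = 0) ∧ (∀ s, κ.bL s = 0) ∧ (∀ s, κ.bR s = 0) ∧ (∀ s, κ.an s = 0) ∧
    ∀ x, κ.sd x true = 0

instance (κ : Cfg K D d p n q) : Decidable κ.RestZero := by unfold Cfg.RestZero; infer_instance

theorem lineQudit_ne' (x : Fin ((n + 1) * q + 2)) :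
    (∀ y, .phys y ≠ lineQudit x) ∧ (∀ y, .bondL y ≠ lineQudit x) ∧ (∀ y, .bondR y ≠ lineQudit x) ∧
    (∀ y, .anc y ≠ lineQudit x) ∧ ∀ y b, .seed y b ≠ lineQudit x :=
  ⟨fun y => ((lineQudit_ne x).1 y).symm, fun y => ((lineQudit_ne x).2.1 y).symm,
    fun y => ((lineQudit_ne x).2.2.1 y).symm, fun y => ((lineQudit_ne x).2.2.2.1 y).symm,
    fun y b => ((lineQudit_ne x).2.2.2.2 y b).symm⟩

/-- On the all-zero input only the local input `(0, 0)` of each pair survives, so the amplitude is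
the product of the first columns. -/
theorem pairLayer_apply
    (W : Fin ((n + 1) * q + 2) → Matrix (Fin K × Fin K) (Fin K × Fin K) ℂ)
    (κ : Cfg K D d p n q) :
    applyGates ((List.finRange _).map fun x => pairGate D d p (W x) x) (ketZero _) κ.conf =
      if κ.RestZero then ∏ x, W x (κ.line x, κ.sd x false) (0, 0) else 0 := by
  rw [layer_apply Cfg.conf Cfg.conf_bijective.2 Cfg.conf_bijective.1
    (X := Fin K × Fin K) (fun x => pairGate D d p (W x) x) (fun x => pairGate_congr _ x) ?_
    (fun z => (κ.withSeed fun x => (z x).2).withLine fun x => (z x).1) κ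
    (fun x => W x (κ.line x, κ.sd x false))]
  · rw [Finset.sum_eq_single fun _ => (0, 0)]
    · rw [ketZero_conf, mul_ite, mul_one, mul_zero]
      refine if_congr ?_ rfl rfl
      rw [Cfg.line_withLine]
      simp [Cfg.RestZero, Cfg.withSeed, Cfg.withLine]
    · intro z _ hz
      rw [ketZero_conf, if_neg, mul_zero]
      rw [Cfg.line_withLine]
      rintro ⟨-, h1, -, -, -, h2⟩
      exact hz (funext fun x => Prod.ext (h1 x) (h2 x false))
    · simp
  · intro z z' h
    have h1 := congrArg Cfg.line h
    rw [Cfg.line_withLine, Cfg.line_withLine] at h1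
    have h2 := congrArg Cfg.sd h
    exact funext fun x => Prod.ext (congrFun h1 x) (congrFun (congrFun h2 x) false)
  · intro z
    rw [Cfg.agree_iff_line']
    simp [pairGate, Cfg.withLine, Cfg.withSeed, lineQudit_ne', -Prod.mk.injEq]
  · intro z x
    simp only [pairGate, Cfg.ofConf_conf, Cfg.line_withLine]
    simp [Cfg.withLine, Cfg.withSeed]
  · intro κ' h _
    rw [Cfg.agree_iff_line'] at h
    simp [pairGate, lineQudit_ne', -Bool.forall_bool] at h
    obtain ⟨h1, h3, h4, h5, h6⟩ := h
    refine ⟨fun x => (κ'.line x, κ'.sd x false), Cfg.ext_line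
        (funext fun s => funext fun t => h1 s t)
      (Cfg.line_withLine _ _) (funext h3) (funext h4) (funext h5) ?_⟩
    funext x b
    cases b
    · rfl
    · exact h6 x
  · intro s t h
    simp [pairGate, lineQudit_ne', h, h.symm]

/-- Each gate is a controlled permutation, so an output configuration has exactly one preimage. The
sum on the right is the ancilla value before the gate; the value after it is therefore lower by the
value of the preceding block qudit. The ancilla at position `0` is the target of no gate, hence the
`Fin.cons`. -/
theorem linkLayer_apply (ψ : State (quditDim K D d p (n := n) (q := q))) (κ : Cfg K D d p n q) :
    applyGates ((List.finRange _).map (linkGate K D d p)) ψ κ.conf =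
      ψ (κ.withSeed (Fin.cons (κ.sd 0 false)
        fun y => κ.sd y.succ false + κ.line y.castSucc)).conf := by
  rw [layer_apply Cfg.conf Cfg.conf_bijective.2 Cfg.conf_bijective.1
    (X := Fin K) (linkGate K D d p) linkGate_congr ?_
    (fun z => κ.withSeed (Fin.cons (κ.sd 0 false) z)) κ
    (fun y z => if κ.sd y.succ false + κ.line y.castSucc = z then 1 else 0)]
  · simp only [Finset.prod_ite_zero, Finset.mem_univ, forall_true_left, Finset.prod_const_one,
      ite_mul, one_mul, zero_mul]
    rw [Finset.sum_eq_single fun y => κ.sd y.succ false + κ.line y.castSucc]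
    · simp
    · intro z _ hz
      rw [if_neg]
      intro h
      exact hz (funext fun x => (h x).symm)
    · simp
  · intro z z' h
    have h2 := congrArg Cfg.sd h
    funext y
    simpa [Cfg.withSeed] using congrFun (congrFun h2 y.succ) false
  · intro z
    rw [Cfg.agree_iff_line']
    simp [linkGate, Cfg.withSeed, lineQudit_ne', -Prod.mk.injEq]
    refine ⟨fun x _ => rfl, Fin.cases (fun _ => rfl) fun y h => ?_⟩
    exact absurd rfl (h y)
  · intro z x
    simp only [linkGate, Cfg.ofConf_conf, Cfg.line_withSeed]
    simp [Cfg.withSeed]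
  · intro κ' h hne
    rw [Cfg.agree_iff_line'] at h
    simp [linkGate, lineQudit_ne', -Bool.forall_bool] at h
    obtain ⟨h1, h2, h3, h4, h5, h6⟩ := h
    refine ⟨fun x => κ'.sd x.succ false, Cfg.ext_line (funext fun s => funext fun t => h1 s t)
      ?_ (funext h3) (funext h4) (funext h5) ?_⟩
    · funext x
      change κ.line x = _
      refine Fin.lastCases (h2 _ ?_) (fun y => ?_) x
      · intro y h
        exact absurd h (Fin.castSucc_lt_last y).ne'
      · by_contra hy
        refine hne y (if_neg ?_)
        rwa [Cfg.ofConf_conf, Cfg.ofConf_conf]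
    · funext x b
      cases b
      · change (Fin.cons (κ.sd 0 false) _ : Fin _ → Fin K) x = _
        refine Fin.cases (h6 _ _ ?_) (fun y => ?_) x
        · intro y h
          exact absurd h (Fin.succ_ne_zero y).symm
        · rfl
      · exact h6 _ _ (by simp)
  · intro s t h
    simp [linkGate, lineQudit_ne', h, h.symm]

theorem shiftLayer_apply (σ : Fin ((n + 1) * q + 2) → Fin K)
    (ψ : State (quditDim K D d p (n := n) (q := q))) (κ : Cfg K D d p n q) :
    applyGates ((List.finRange _).map fun x => shiftGate D d p (σ x) x) ψ κ.conf =
      ψ (κ.withLine fun x => κ.line x - σ x).conf := by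
  rw [layer_apply Cfg.conf Cfg.conf_bijective.2 Cfg.conf_bijective.1
    (X := Fin K) (fun x => shiftGate D d p (σ x) x) (fun x => shiftGate_congr _ x) ?_
    (fun z => κ.withLine z) κ
    (fun x z => if κ.line x - σ x = z then 1 else 0)]
  · simp only [Finset.prod_ite_zero, Finset.mem_univ, forall_true_left, Finset.prod_const_one,
      ite_mul, one_mul, zero_mul]
    rw [Finset.sum_eq_single fun x => κ.line x - σ x]
    · simp
    · intro z _ hz
      rw [if_neg]
      intro h
      exact hz (funext fun x => (h x).symm)
    · simp
  · intro z z' h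
    simpa using congrArg Cfg.line h
  · intro z
    rw [Cfg.agree_iff_line']
    simp [shiftGate, lineQudit_ne']
    simp [Cfg.withLine]
  · intro z x
    simp only [shiftGate, Cfg.ofConf_conf, Cfg.line_withLine]
  · intro κ' h _
    rw [Cfg.agree_iff_line'] at h
    simp [shiftGate, lineQudit_ne', -Bool.forall_bool] at h
    obtain ⟨h1, h3, h4, h5, h6⟩ := h
    exact ⟨κ'.line, Cfg.ext_line (funext fun s => funext fun t => h1 s t)
      (Cfg.line_withLine _ _) (funext h3) (funext h4) (funext h5) (funext fun x => funext (h6 x))⟩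
  · intro s t h
    simp [shiftGate, h, h.symm]

/-- The columns prepared on a block qudit and its seed ancilla: a uniform superposition at the first
position, a maximally entangled pair elsewhere. -/
noncomputable def pairVec (K : ℕ) [NeZero K] {N : ℕ} (x : Fin (N + 2)) (y : Fin K × Fin K) : ℂ :=
  if y.2 = (if x = 0 then 0 else y.1) then 1 / (Real.sqrt K : ℂ) else 0

theorem exists_pairMatrix {N : ℕ} (x : Fin (N + 2)) :
    ∃ W ∈ Matrix.unitaryGroup (Fin K × Fin K) ℂ, ∀ y, W y (0, 0) = pairVec K x y := by
  have hK : (K : ℂ) ≠ 0 := Nat.cast_ne_zero.2 (NeZero.ne K)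
  have hs : (Real.sqrt K : ℂ) * (Real.sqrt K : ℂ) = K := by
    rw [← Complex.ofReal_mul, Real.mul_self_sqrt (Nat.cast_nonneg K), Complex.ofReal_natCast]
  have H : ∑ y, star (pairVec K x y) * pairVec K x y = 1 := by
    simp only [pairVec, apply_ite star, star_zero, star_div₀, star_one, Complex.star_def,
      Complex.conj_ofReal, ite_mul, zero_mul, mul_ite, mul_zero, ← ite_and, and_self,
      Fintype.sum_prod_type, Finset.sum_ite_eq', Finset.mem_univ, if_true, Finset.sum_const,
      Finset.card_univ, Fintype.card_fin, nsmul_eq_mul, div_mul_div_comm, one_mul, hs]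
    exact mul_one_div_cancel hK
  obtain ⟨W, hW, h⟩ := exists_unitary_extension {((0 : Fin K), (0 : Fin K))}
    (fun y _ => pairVec K x y) fun j hj j' hj' => by
      obtain rfl : j = (0, 0) := hj
      obtain rfl : j' = (0, 0) := hj'
      rw [if_pos rfl, H]
  exact ⟨W, hW, fun y => h y _ rfl⟩

/-- The adaptive circuit for the GHZ state. -/
def seedCircuit (D d p : ℕ)
    (W : Fin ((n + 1) * q + 2) → Matrix (Fin K × Fin K) (Fin K × Fin K) ℂ) :
    AdaptiveCircuit (quditDim K D d p (n := n) (q := q)) :=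
  .layer ((List.finRange _).map fun x => pairGate D d p (W x) x) <|
  .layer ((List.finRange _).map (linkGate K D d p)) <|
  .measure (Finset.univ.image fun x => .seed x false) fun o =>
  .layer ((List.finRange _).map fun x =>
    shiftGate D d p (Fin.partialSum (fun y => -(Cfg.ofConf o).sd y.succ false) x) x) .nil

/-- The GHZ state of the block qudits, with seed ancillas in the state `σ`. -/
def seedState (σ : Fin ((n + 1) * q + 2) → Bool → Fin K) (κ : Cfg K D d p n q) : ℂ :=
  if κ.eR = κ.eL ∧ (∀ x, κ.bl x = κ.eL) ∧ (∀ s t, κ.ph s t = 0) ∧ (∀ s, κ.bL s = 0) ∧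
    (∀ s, κ.bR s = 0) ∧ (∀ s, κ.an s = 0) ∧ κ.sd = σ then 1 else 0

theorem line_const_iff (κ : Cfg K D d p n q) :
    (∀ y : Fin ((n + 1) * q + 1), κ.line y.castSucc = κ.line y.succ) ↔
      κ.eR = κ.eL ∧ ∀ x, κ.bl x = κ.eL := by
  have h := forall_line (P := fun x => κ.line x = κ.line 0)
  simp only [Cfg.line_zero, Cfg.line_last, Cfg.line_succ, true_and] at h
  rw [← h]
  refine ⟨fun h => ?_, fun h y => ?_⟩
  · exact Fin.induction rfl fun y hy => by rw [← h y, hy]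
  · rw [h, h]

/-- After the link layer the ancilla at `y + 1` holds the difference of the line values at `y + 1`
and `y`. Measuring it fixes all differences and leaves the value at `0` in uniform superposition.
Shifting position `x` by minus the sum of the differences up to `x` makes the line constant, which
is a GHZ state. -/
theorem mem_branches_seedCircuit
    {W : Fin ((n + 1) * q + 2) → Matrix (Fin K × Fin K) (Fin K × Fin K) ℂ}
    (hW : ∀ x y, W x y (0, 0) = pairVec K x y)
    {φ : State (quditDim K D d p (n := n) (q := q))}
    (hφ : φ ∈ (seedCircuit D d p W).branches (ketZero _)) :
    ∃ (z : ℂ) (σ : _), ∀ κ, φ κ.conf = z * seedState σ κ := by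
  obtain ⟨o, -, rfl⟩ := hφ
  set u : Fin ((n + 1) * q + 2) → Fin K := fun x => (Cfg.ofConf o).sd x false with hu
  -- Each of the `(n + 1) * q + 2` pairs contributes `1/√K`. The first ancilla is prepared in `0`
  -- and never changed, so a branch reading another value there has amplitude zero.
  refine ⟨if u 0 = 0 then (1 / (Real.sqrt K : ℂ)) ^ ((n + 1) * q + 2) else 0,
    fun x b => if b then 0 else u x, fun κ => ?_⟩
  rw [shiftLayer_apply, linkLayer_apply, pairLayer_apply]
  have hm : ∀ κ : Cfg K D d p n q,
      (∀ x ∈ Finset.univ.image fun x => Qudit.seed (n := n) (q := q) x false,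
      κ.conf x = o x) ↔ ∀ x, κ.sd x false = u x := by
    intro κ
    simp only [Finset.mem_image, Finset.mem_univ, true_and, forall_exists_index,
      forall_apply_eq_imp_iff]
    rfl
  simp only [hm, hW, pairVec, Finset.prod_ite_zero, Finset.mem_univ, forall_true_left,
    Finset.prod_const, Finset.card_univ, Fintype.card_fin, Cfg.line_withSeed, Cfg.line_withLine]
  set τ := Fin.partialSum fun y : Fin ((n + 1) * q + 1) => -(Cfg.ofConf o).sd y.succ false with hτ
  have hτ0 : τ 0 = 0 := Fin.partialSum_zero _
  have hτs : ∀ y : Fin ((n + 1) * q + 1), τ y.succ = τ y.castSucc - u y.succ := fun y => by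
    rw [hτ, Fin.partialSum_succ, sub_eq_add_neg]
  have key : ((∀ x, κ.sd x false = u x) ∧ κ.RestZero ∧
      ∀ i, (Fin.cons (κ.sd 0 false) fun y => κ.sd y.succ false +
          (κ.line y.castSucc - τ y.castSucc) :
        Fin _ → Fin K) i = if i = 0 then 0 else κ.line i - τ i) ↔
      (κ.eR = κ.eL ∧ (∀ x, κ.bl x = κ.eL) ∧ (∀ s t, κ.ph s t = 0) ∧ (∀ s, κ.bL s = 0) ∧
        (∀ s, κ.bR s = 0) ∧ (∀ s, κ.an s = 0) ∧ κ.sd = fun x b => if b then 0 else u x) ∧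
        u 0 = 0 := by
    rw [Fin.forall_fin_succ (P := fun i => (Fin.cons (κ.sd 0 false) _ : Fin _ → Fin K) i = _),
      ← and_assoc (a := κ.eR = κ.eL), ← line_const_iff]
    simp only [Fin.cons_zero, Fin.cons_succ, if_true, Fin.succ_ne_zero, if_false, Cfg.RestZero,
      funext_iff, Bool.forall_bool, forall_and, Bool.false_eq_true, hτs]
    constructor
    · rintro ⟨h1, ⟨h2, h3, h4, h5, h6⟩, h7, h8⟩
      refine ⟨⟨fun y => ?_, h2, h3, h4, h5, h1, h6⟩, by rw [← h1, h7]⟩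
      have := h8 y
      rw [h1, ← add_sub_assoc, sub_eq_sub_iff_add_eq_add] at this
      have h9 : κ.line y.castSucc + (u y.succ + τ y.castSucc) =
          κ.line y.succ + (u y.succ + τ y.castSucc) := by
        rw [← sub_eq_zero] at this ⊢
        rw [← this]; abel
      exact add_right_cancel h9
    · rintro ⟨⟨h8, h2, h3, h4, h5, h1, h6⟩, h7⟩
      refine ⟨h1, ⟨h2, h3, h4, h5, h6⟩, by rw [h1, h7], fun y => ?_⟩
      rw [h1, h8]
      abel
  rw [seedState, mul_ite, mul_one, mul_zero]
  simp only [← ite_and]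
  refine if_congr key rfl rfl

theorem seedCircuit_isLocal
    {W : Fin ((n + 1) * q + 2) → Matrix (Fin K × Fin K) (Fin K × Fin K) ℂ}
    (hW : ∀ x, W x ∈ Matrix.unitaryGroup _ ℂ) :
    (seedCircuit D d p W).IsLocal quditPos (q + 1) := by
  simp only [seedCircuit, AdaptiveCircuit.IsLocal, List.forall_mem_map, List.pairwise_map, and_true]
  refine ⟨fun x _ => pairGate_isLocalUnitary (hW x) x, ?_, fun y _ => linkGate_isLocalUnitary y, ?_,
    fun o => ⟨fun x _ => shiftGate_isLocalUnitary _ x, ?_⟩⟩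
  all_goals refine (List.nodup_finRange _).imp fun h => ?_
  · simp [pairGate, lineQudit_ne', Ne.symm h, Ne.symm (Ne.symm h)]
  · simp [linkGate, lineQudit_ne', Ne.symm h, Ne.symm (Ne.symm h)]
  · simp [shiftGate, Ne.symm h, Ne.symm (Ne.symm h)]

theorem seedCircuit_actsOn
    {W : Fin ((n + 1) * q + 2) → Matrix (Fin K × Fin K) (Fin K × Fin K) ℂ} :
    (seedCircuit D d p W).ActsOn (seedQudits n q) := by
  have h1 : ∀ x, lineQudit x ∈ seedQudits n q := fun x =>
    Finset.mem_union_left _ (lineQudit_mem x)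
  have h2 : ∀ x b, .seed x b ∈ seedQudits n q := fun x b =>
    Finset.mem_union_right _ (Finset.mem_image.2 ⟨(x, b), Finset.mem_univ _, rfl⟩)
  simp only [seedCircuit, AdaptiveCircuit.ActsOn, List.forall_mem_map, and_true]
  refine ⟨fun x _ => ?_, fun y _ => ?_, ?_, fun o x _ => ?_⟩
  · simp [pairGate, Finset.insert_subset_iff, h1, h2]
  · simp [linkGate, Finset.insert_subset_iff, h1, h2]
  · simp [Finset.subset_iff, h2]
  · simp [shiftGate, h1]

theorem seedCircuit_depth
    (W : Fin ((n + 1) * q + 2) → Matrix (Fin K × Fin K) (Fin K × Fin K) ℂ) :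
    (seedCircuit D d p W).depth ≤ 4 := by
  simp only [seedCircuit, AdaptiveCircuit.depth]
  have : (Finset.univ.sup fun _ : Conf (quditDim K D d p (n := n) (q := q)) => 0 + 1) ≤ 1 :=
    Finset.sup_le fun _ _ => le_rfl
  omega

theorem seedCircuit_prepares
    {W : Fin ((n + 1) * q + 2) → Matrix (Fin K × Fin K) (Fin K × Fin K) ℂ}
    (hW : ∀ x y, W x y (0, 0) = pairVec K x y) :
    (seedCircuit D d p W).Prepares (blockQudits n q) (ghz K D d p n q) := by
  intro φ hφ hne
  obtain ⟨z, σ, h⟩ := mem_branches_seedCircuit hW hφ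
  have hK : (Real.sqrt K : ℂ) ≠ 0 := by
    simpa using NeZero.ne K
  have hz : z ≠ 0 := by
    rintro rfl
    refine hne (funext fun c => ?_)
    obtain ⟨κ, rfl⟩ := Cfg.conf_bijective.2 c
    simp [h]
  -- `seedState` has amplitudes `1`, `ghz` has `1/√K`; the factor compensates.
  refine ⟨z * Real.sqrt K, Cfg.conf ⟨fun _ _ => 0, fun _ => 0, 0, 0, fun _ => 0, fun _ => 0,
    fun _ => 0, σ⟩, mul_ne_zero hz hK, funext fun c => ?_⟩
  obtain ⟨κ, rfl⟩ := Cfg.conf_bijective.2 c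
  rw [h, seedState, ghz]
  have hagree := Cfg.agree_iff (S := fun y => y ∈ blockQudits n q) (κ := κ)
    (κ' := ⟨fun _ _ => 0, fun _ => 0, 0, 0, fun _ => 0, fun _ => 0, fun _ => 0, σ⟩)
  have hval : ((κ.conf .edgeR).val = (κ.conf .edgeL).val ∧
      ∀ x, (κ.conf (.block x)).val = (κ.conf .edgeL).val) ↔ κ.eR = κ.eL ∧ ∀ x, κ.bl x = κ.eL := by
    simp only [← Fin.val_inj]
    exact Iff.rfl
  simp only [hagree, hval, mul_ite, mul_one, mul_zero, mul_one_div, mul_div_cancel_right₀ _ hK,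
    ← ite_and]
  refine if_congr ?_ rfl rfl
  simp only [blockQudits, funext_iff]
  simp [-Bool.forall_bool]
  tauto

end SeedCircuit


/-! ### Chains of matrices -/

section Chain

variable {ι : Type} [Fintype ι] [DecidableEq ι]

/-- The product `F 0 * G 0 * F 1 * ⋯ * G (n - 1) * F n`, as a sum over the intermediate indices. -/
def pathSum {n : ℕ} (F : Fin (n + 1) → Matrix ι ι ℂ) (G : Fin n → Matrix ι ι ℂ) : Matrix ι ι ℂ :=
  Matrix.of fun l r => ∑ x : Fin n → ι × ι, (∏ s, G s (x s).1 (x s).2) *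
    ∏ s, F s ((Fin.cons l fun s => (x s).2 : Fin (n + 1) → ι) s)
      ((Fin.snoc (fun s => (x s).1) r : Fin (n + 1) → ι) s)

theorem pathSum_apply {n : ℕ} (F : Fin (n + 1) → Matrix ι ι ℂ) (G : Fin n → Matrix ι ι ℂ)
    (l r : ι) :
    pathSum F G l r = ∑ x : Fin n → ι × ι, (∏ s, G s (x s).1 (x s).2) *
      ∏ s, F s ((Fin.cons l fun s => (x s).2 : Fin (n + 1) → ι) s)
        ((Fin.snoc (fun s => (x s).1) r : Fin (n + 1) → ι) s) := rfl

theorem pathSum_zero (F : Fin 1 → Matrix ι ι ℂ) (G : Fin 0 → Matrix ι ι ℂ) : pathSum F G = F 0 := by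
  ext l r
  simp [pathSum_apply, Fin.snoc]

theorem pathSum_succ {n : ℕ} (F : Fin (n + 2) → Matrix ι ι ℂ) (G : Fin (n + 1) → Matrix ι ι ℂ) :
    pathSum F G = F 0 * G 0 * pathSum (fun s => F s.succ) fun s => G s.succ := by
  ext l r
  rw [pathSum_apply, ← (Fin.consEquiv fun _ => ι × ι).sum_comp, Fintype.sum_prod_type,
    Fintype.sum_prod_type_right, Matrix.mul_apply]
  refine Finset.sum_congr rfl fun j _ => ?_
  rw [Matrix.mul_apply, Finset.sum_mul]
  refine Finset.sum_congr rfl fun i _ => ?_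
  rw [pathSum_apply, Finset.mul_sum]
  refine Finset.sum_congr rfl fun x _ => ?_
  have h1 : (fun s => ((Fin.consEquiv fun _ => ι × ι) ((i, j), x) s).2) =
      (Fin.cons j fun s => (x s).2 : Fin (n + 1) → ι) := by
    funext s
    refine Fin.cases rfl (fun s => ?_) s
    simp [Fin.consEquiv]
  have h2 : (fun s => ((Fin.consEquiv fun _ => ι × ι) ((i, j), x) s).1) =
      (Fin.cons i fun s => (x s).1 : Fin (n + 1) → ι) := by
    funext s
    refine Fin.cases rfl (fun s => ?_) s
    simp [Fin.consEquiv]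
  rw [h1, h2, Fin.prod_univ_succ, Fin.prod_univ_succ (n := n + 1), ← Fin.cons_snoc_eq_snoc_cons]
  simp only [Fin.cons_zero, Fin.cons_succ, Fin.consEquiv_apply]
  ring

theorem pathSum_smul {n : ℕ} (F : Fin (n + 1) → Matrix ι ι ℂ) (G : Fin n → Matrix ι ι ℂ) (c : ℂ)
    (w : Fin n → ℂ) :
    pathSum (fun s => c • F s) (fun s => w s • G s) = (c ^ (n + 1) * ∏ s, w s) • pathSum F G := by
  ext l r
  simp only [pathSum_apply, Matrix.smul_apply, smul_eq_mul, Finset.prod_mul_distrib,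
    Finset.prod_const, Finset.card_univ, Fintype.card_fin, Finset.mul_sum]
  exact Finset.sum_congr rfl fun x _ => by ring

/-- A path sum is linear in each `F s` separately, so applying independent local operators to all
segments amounts to replacing each matrix by its local combination. -/
theorem sum_prod_mul_pathSum {n : ℕ} {X : Type} [Fintype X] [DecidableEq X]
    (a : Fin (n + 1) → X → ℂ) (F : Fin (n + 1) → X → Matrix ι ι ℂ) (G : Fin n → Matrix ι ι ℂ) :
    ∑ m : Fin (n + 1) → X, (∏ s, a s (m s)) • pathSum (fun s => F s (m s)) G =
      pathSum (fun s => ∑ x, a s x • F s x) G := by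
  ext l r
  simp only [Matrix.sum_apply, Matrix.smul_apply, smul_eq_mul, pathSum_apply, Finset.mul_sum]
  rw [Finset.sum_comm]
  refine Finset.sum_congr rfl fun x _ => ?_
  rw [Finset.prod_univ_sum, Fintype.piFinset_univ, Finset.mul_sum]
  refine Finset.sum_congr rfl fun m _ => ?_
  rw [Finset.prod_mul_distrib]
  ring

/-- The product telescopes: each junction `R_s B_s L_{s+1}` collapses to the identity, and only the
outermost left factor is left over. -/
theorem pathSum_conj {n : ℕ} (L M R : Fin (n + 1) → Matrix ι ι ℂ) (B : Fin n → Matrix ι ι ℂ)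
    (h : ∀ s : Fin n, R s.castSucc * B s * L s.succ = 1) (hR : R (Fin.last n) = 1) :
    pathSum (fun s => L s * M s * R s) B = L 0 * (List.ofFn M).prod := by
  induction n with
  | zero =>
    rw [pathSum_zero, List.ofFn_succ, List.ofFn_zero, List.prod_singleton]
    rw [show (0 : Fin 1) = Fin.last 0 from rfl, hR, mul_one]
  | succ n ih =>
    rw [pathSum_succ, ih (fun s => L s.succ) (fun s => M s.succ) (fun s => R s.succ) _
      (fun s => h s.succ) hR, List.ofFn_succ (f := M), List.prod_cons]
    have := h 0
    rw [Fin.castSucc_zero] at this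
    calc _ = L 0 * M 0 * (R 0 * B 0 * L (Fin.succ 0)) * (List.ofFn fun s => M s.succ).prod := by
          simp only [mul_assoc]
      _ = _ := by rw [this, mul_one, mul_assoc]

theorem wordProd_flatten {d n q : ℕ} (T : MPSTensor d ι) (m : Fin ((n + 1) * q) → Fin d) :
    wordProd T m = (List.ofFn fun s : Fin (n + 1) => wordProd T fun t => m (siteOf s t)).prod := by
  rw [wordProd, List.ofFn_mul, List.prod_flatten, List.map_ofFn]
  congr 2
  funext s
  simp only [Function.comp_apply, wordProd]
  congr 2
  funext t
  congr 2
  ext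
  rw [siteOf_val]

/-- The Kronecker form of the pushing relation is the vectorization of left and right
multiplication; the transpose accounts for the row index being contracted on the left. -/
theorem sum_smul_wordProd {d q : ℕ} {T : MPSTensor d ι} {L R : Matrix ι ι ℂ}
    {O : Matrix (Fin q → Fin d) (Fin q → Fin d) ℂ}
    (h : O * virtualToPhysical T q = virtualToPhysical T q * (L.transpose ⊗ₖ R))
    (m : Fin q → Fin d) : ∑ m', O m m' • wordProd T m' = L * wordProd T m * R := by
  ext i j
  have := congrFun (congrFun h m) (i, j)
  simp only [Matrix.mul_apply, virtualToPhysical, Fintype.sum_prod_type, Matrix.kroneckerMap_apply,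
    Matrix.transpose_apply] at this
  rw [Matrix.sum_apply]
  simp only [Matrix.smul_apply, smul_eq_mul, this, Matrix.mul_apply, Finset.sum_mul]
  rw [Finset.sum_comm]
  exact Finset.sum_congr rfl fun _ _ => Finset.sum_congr rfl fun _ _ => by ring

/-- Recursion from the right end. Once the segments to the right are corrected, they emit `L 0` to
their left; the combined defect `B 0 * L 0` again satisfies `P`, its adjoint is taken as the right
factor of the new segment, and pushing that factor through yields a new left factor. The rightmost
segment needs no correction, so nothing is left over on the right edge. -/
theorem exists_corrections {d q : ℕ} (T : MPSTensor d ι) (P : Matrix ι ι ℂ → Prop)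
    (hunit : ∀ M, P M → M ∈ Matrix.unitaryGroup ι ℂ) (hone : P 1)
    (hmul : ∀ M M', P M → P M' → P (M * M')) (hstar : ∀ M, P M → P (star M))
    (hpush : ∀ M, P M → ∃ L, P L ∧ ∃ O ∈ Matrix.unitaryGroup (Fin q → Fin d) ℂ,
      O * virtualToPhysical T q = virtualToPhysical T q * (L.transpose ⊗ₖ M)) :
    ∀ (n : ℕ) (B : Fin n → Matrix ι ι ℂ), (∀ s, P (B s)) →
    ∃ (L R : Fin (n + 1) → Matrix ι ι ℂ)
        (O : Fin (n + 1) → Matrix (Fin q → Fin d) (Fin q → Fin d) ℂ),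
      (∀ s, P (L s)) ∧ (∀ s, P (R s)) ∧ (∀ s, O s ∈ Matrix.unitaryGroup (Fin q → Fin d) ℂ) ∧
      (∀ s, O s * virtualToPhysical T q = virtualToPhysical T q * ((L s).transpose ⊗ₖ R s)) ∧
      (∀ s : Fin n, R s.castSucc * B s * L s.succ = 1) ∧ R (Fin.last n) = 1
  | 0, B, _ => ⟨fun _ => 1, fun _ => 1, fun _ => 1, fun _ => hone, fun _ => hone,
      fun _ => one_mem _, fun _ => by
        rw [Matrix.transpose_one, Matrix.one_kronecker_one, Matrix.one_mul, Matrix.mul_one],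
      fun s => s.elim0, rfl⟩
  | n + 1, B, hB => by
    obtain ⟨L, R, O, hL, hR, hO, h, h', hlast⟩ := exists_corrections T P hunit hone hmul hstar hpush n
      (fun s => B s.succ) fun s => hB s.succ
    have hM : P (B 0 * L 0) := hmul _ _ (hB 0) (hL 0)
    obtain ⟨L', hL', O', hO', hpush'⟩ := hpush _ (hstar _ hM)
    refine ⟨Fin.cons L' L, Fin.cons (star (B 0 * L 0)) R, Fin.cons O' O, Fin.cases hL' hL,
      Fin.cases (hstar _ hM) hR, Fin.cases hO' hO, Fin.cases hpush' h,
      Fin.cases ?_ (fun s => ?_), ?_⟩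
    · rw [← Fin.succ_last, Fin.cons_succ, hlast]
    · rw [Fin.castSucc_zero, Fin.cons_zero, Fin.cons_succ, mul_assoc,
        Matrix.mem_unitaryGroup_iff'.1 (hunit _ hM)]
    · rw [← Fin.succ_castSucc, Fin.cons_succ, Fin.cons_succ]
      exact h' s

end Chain
theorem wordProd_directSum {K d D N : ℕ} (T : Fin K → MPSTensor d (Fin D)) (m : Fin N → Fin d) :
    wordProd (directSum T) m = Matrix.blockDiagonal fun α => wordProd (T α) m := by
  simp only [wordProd, List.ofFn_eq_map]
  induction List.finRange N with
  | nil => exact Matrix.blockDiagonal_one.symm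
  | cons t l ih =>
    rw [List.map_cons, List.prod_cons, ih, directSum, ← Matrix.blockDiagonal_mul]
    rfl


/-! ### The layers of the protocol -/

section Layers

variable {K D d p : ℕ} [NeZero K] [NeZero D] [NeZero d] [NeZero p]
  {A : Fin K → MPSTensor d (Fin D)} (V : ProtocolGates A p) {n q : ℕ} [NeZero q]

theorem Cfg.agree_iff' {ι : Type} {g : ι → Finset (Qudit n q)} {κ κ' : Cfg K D d p n q} :
    (∀ y, (∀ i, y ∉ g i) → κ.conf y = κ'.conf y) ↔
    (∀ s t, (∀ i, .phys (siteOf s t) ∉ g i) → κ.ph s t = κ'.ph s t) ∧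
    (∀ x, (∀ i, .block x ∉ g i) → κ.bl x = κ'.bl x) ∧
    ((∀ i, .edgeL ∉ g i) → κ.eL = κ'.eL) ∧ ((∀ i, .edgeR ∉ g i) → κ.eR = κ'.eR) ∧
    (∀ s, (∀ i, .bondL s ∉ g i) → κ.bL s = κ'.bL s) ∧
    (∀ s, (∀ i, .bondR s ∉ g i) → κ.bR s = κ'.bR s) ∧
    (∀ s, (∀ i, .anc s ∉ g i) → κ.an s = κ'.an s) ∧
    ∀ x b, (∀ i, .seed x b ∉ g i) → κ.sd x b = κ'.sd x b := by
  have := Cfg.agree_iff (S := fun y => ∃ i, y ∈ g i) (κ := κ) (κ' := κ')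
  simpa only [not_exists] using this

variable (ψ : State (quditDim K D d p (n := n) (q := q))) (κ : Cfg K D d p n q)

theorem bellLayer_apply : applyGates ((List.finRange (n + 1)).map (bellGate V)) ψ κ.conf =
    ∑ x : Fin (n + 1) → Fin D × Fin D, (∏ s, V.bell (κ.bL s, κ.bR s) (x s)) *
      ψ { κ with bL := fun s => (x s).1, bR := fun s => (x s).2 : Cfg K D d p n q }.conf := by
  refine layer_apply Cfg.conf Cfg.conf_bijective.2 Cfg.conf_bijective.1 (bellGate V)
    (bellGate_congr V) (fun s t h => disjoint_bellGate h)
    (fun x : Fin (n + 1) → Fin D × Fin D =>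
      { κ with bL := fun s => (x s).1, bR := fun s => (x s).2 }) κ
    (fun s => V.bell (κ.bL s, κ.bR s)) ?_ ?_ (fun _ _ => rfl) ?_ ψ
  · intro x x' h
    exact funext fun s => Prod.ext (congrFun (congrArg Cfg.bL h) s) (congrFun (congrArg Cfg.bR h) s)
  · intro x
    rw [Cfg.agree_iff']
    simp [bellGate]
  · intro κ' h _
    rw [Cfg.agree_iff'] at h
    simp [bellGate, -Bool.forall_bool] at h
    refine ⟨fun s => (κ'.bL s, κ'.bR s), ?_⟩
    ext : 1 <;> simp only [funext_iff] <;> grind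

theorem siteLayer_apply (t : Fin q) :
    applyGates ((List.finRange (n + 1)).map (siteGate V t)) ψ κ.conf =
    ∑ x : Fin (n + 1) → Fin D × Fin d,
      (∏ s, V.site (κ.bl (siteOf s t)) (κ.bL s, κ.ph s t) (x s)) *
      ψ { κ with
        bL := fun s => (x s).1
        ph := fun s => Function.update (κ.ph s) t (x s).2 : Cfg K D d p n q }.conf := by
  refine layer_apply Cfg.conf Cfg.conf_bijective.2 Cfg.conf_bijective.1 (siteGate V t)
    (siteGate_congr V t) (fun s t' h => disjoint_siteGate t h)
    (fun x : Fin (n + 1) → Fin D × Fin d =>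
      { κ with bL := fun s => (x s).1, ph := fun s => Function.update (κ.ph s) t (x s).2 }) κ
    (fun s => V.site (κ.bl (siteOf s t)) (κ.bL s, κ.ph s t)) ?_ ?_ ?_ ?_ ψ
  · intro x x' h
    refine funext fun s => Prod.ext (congrFun (congrArg Cfg.bL h) s) ?_
    simpa using congrFun (congrFun (congrArg Cfg.ph h) s) t
  · intro x
    rw [Cfg.agree_iff']
    simp [siteGate, siteOf_inj]
    intro s t' h
    rw [Function.update_of_ne h]
  · intro x s
    simp [siteGate]
    exact if_pos rfl
  · intro κ' h hne
    rw [Cfg.agree_iff'] at h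
    simp [siteGate, siteOf_inj, -Bool.forall_bool] at h
    have hb : ∀ s, κ.bl (siteOf s t) = κ'.bl (siteOf s t) := fun s => by
      by_contra hs
      exact hne s (if_neg hs)
    refine ⟨fun s => (κ'.bL s, κ'.ph s t), ?_⟩
    ext : 1 <;> simp only [funext_iff] <;> grind [Function.update_apply]

/-- The outer two bond qudits take part in no fusion; `Fin.cons` and `Fin.snoc` put them back
unchanged around the fused ones. -/
theorem fuseLayer_apply : applyGates ((List.finRange n).map (fuseGate V)) ψ κ.conf =
    ∑ x : Fin n → Fin D × Fin D × Fin p,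
      (∏ s, V.fuse (κ.bl (siteOf s.succ 0)) (κ.bR s.castSucc, κ.bL s.succ, κ.an s) (x s)) *
      ψ { κ with
        bR := Fin.snoc (fun s => (x s).1) (κ.bR (Fin.last n))
        bL := Fin.cons (κ.bL 0) fun s => (x s).2.1
        an := fun s => (x s).2.2 : Cfg K D d p n q }.conf := by
  refine layer_apply Cfg.conf Cfg.conf_bijective.2 Cfg.conf_bijective.1 (fuseGate V)
    (fuseGate_congr V) (fun s t h => disjoint_fuseGate h)
    (fun x : Fin n → Fin D × Fin D × Fin p =>
      { κ with
        bR := Fin.snoc (fun s => (x s).1) (κ.bR (Fin.last n))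
        bL := Fin.cons (κ.bL 0) fun s => (x s).2.1
        an := fun s => (x s).2.2 : Cfg K D d p n q }) κ
    (fun s => V.fuse (κ.bl (siteOf s.succ 0)) (κ.bR s.castSucc, κ.bL s.succ, κ.an s))
    ?_ ?_ ?_ ?_ ψ
  · intro x x' h
    refine funext fun s => Prod.ext ?_ (Prod.ext ?_ (congrFun (congrArg Cfg.an h) s))
    · simpa using congrFun (congrArg Cfg.bR h) s.castSucc
    · simpa using congrFun (congrArg Cfg.bL h) s.succ
  · intro x
    rw [Cfg.agree_iff']
    simp [fuseGate]
    refine ⟨Fin.cases (fun _ => rfl) fun s h => absurd rfl (h s),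
      Fin.lastCases (fun _ => ?_) fun s h => absurd rfl (h s)⟩
    simp
  · intro x s
    simp [fuseGate]
    exact if_pos rfl
  · intro κ' h hne
    rw [Cfg.agree_iff'] at h
    simp [fuseGate, siteOf_inj, -Bool.forall_bool] at h
    have hb : ∀ s : Fin n, κ.bl (siteOf s.succ 0) = κ'.bl (siteOf s.succ 0) := fun s => by
      by_contra hs
      exact hne s (if_neg hs)
    obtain ⟨h1, h2, h3, h4, h5, h6, h7⟩ := h
    refine ⟨fun s => (κ'.bR s.castSucc, κ'.bL s.succ, κ'.an s), ?_⟩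
    ext : 1
    · exact funext fun s => funext fun t => h1 s t
    · refine funext fun x => ?_
      -- A block qudit either controls a fusion, and is then fixed by the nonzero amplitude, or lies
      -- outside all supports.
      by_cases hx : ∃ s : Fin n, x = siteOf s.succ 0
      · obtain ⟨s, rfl⟩ := hx
        exact hb s
      · exact h2 x (not_exists.1 hx)
    · exact h3
    · exact h4
    · refine funext (Fin.cases ?_ fun s => ?_)
      · exact h5 0 fun s => (Fin.succ_ne_zero s).symm
      · rfl
    · refine funext (Fin.lastCases ?_ fun s => ?_)
      · simpa using h6 (Fin.last n) fun s => (Fin.castSucc_lt_last s).ne'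
      · simp
    · rfl
    · exact funext fun x => funext fun b => h7 x b

variable {V}

theorem corrLayer_apply (P : ProtocolChoices V n q)
    (o : Conf (quditDim K D d p (n := n) (q := q))) :
    applyGates ((List.finRange (n + 1)).map (corrGate P o)) ψ κ.conf =
    ∑ m : Fin (n + 1) → Fin q → Fin d,
      (∏ s, P.corr o (κ.bl (siteOf s 0)) s (κ.ph s) (m s)) *
      ψ { κ with ph := m : Cfg K D d p n q }.conf := by
  refine layer_apply Cfg.conf Cfg.conf_bijective.2 Cfg.conf_bijective.1 (corrGate P o)
    (corrGate_congr P o) (fun s t h => disjoint_corrGate P o h)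
    (fun m : Fin (n + 1) → Fin q → Fin d => { κ with ph := m }) κ
    (fun s => P.corr o (κ.bl (siteOf s 0)) s (κ.ph s)) ?_ ?_ ?_ ?_ ψ
  · intro m m' h
    exact congrArg Cfg.ph h
  · intro m
    rw [Cfg.agree_iff']
    simp [corrGate]
  · intro m s
    simp [corrGate]
    exact if_pos rfl
  · intro κ' h hne
    rw [Cfg.agree_iff'] at h
    simp [corrGate, siteOf_inj, -Bool.forall_bool] at h
    have hb : ∀ s, κ.bl (siteOf s 0) = κ'.bl (siteOf s 0) := fun s => by
      by_contra hs
      exact hne s (if_neg hs)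
    refine ⟨κ'.ph, ?_⟩
    ext : 1 <;> simp only [funext_iff] <;> grind

theorem fourierLayer_apply :
    applyGates ((List.finRange ((n + 1) * q)).map (fourierGate K D d p)) ψ κ.conf =
    ∑ y : Fin ((n + 1) * q) → Fin K, (∏ x, fourierMatrix K (κ.bl x) (y x)) *
      ψ { κ with bl := y : Cfg K D d p n q }.conf := by
  refine layer_apply Cfg.conf Cfg.conf_bijective.2 Cfg.conf_bijective.1 (fourierGate K D d p)
    fourierGate_congr (fun s t h => disjoint_fourierGate h)
    (fun y : Fin ((n + 1) * q) → Fin K => { κ with bl := y }) κ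
    (fun x => fourierMatrix K (κ.bl x)) ?_ ?_ (fun _ _ => rfl) ?_ ψ
  · intro m m' h
    exact congrArg Cfg.bl h
  · intro m
    rw [Cfg.agree_iff']
    simp [fourierGate]
  · intro κ' h hne
    rw [Cfg.agree_iff'] at h
    simp [fourierGate, -Bool.forall_bool] at h
    refine ⟨κ'.bl, ?_⟩
    ext : 1 <;> simp only [funext_iff] <;> grind

end Layers


/-! ### Evolution from the GHZ state to the fused chain -/

section Evolution

theorem sum_prod_mul_prod {ι X : Type} [Fintype ι] [DecidableEq ι] [Fintype X] (z : ℂ)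
    (a f : ι → X → ℂ) :
    ∑ x : ι → X, (∏ s, a s (x s)) * (z * ∏ s, f s (x s)) = z * ∏ s, ∑ y, a s y * f s y := by
  rw [Finset.prod_univ_sum, Fintype.piFinset_univ, Finset.mul_sum]
  refine Finset.sum_congr rfl fun x _ => ?_
  rw [Finset.prod_mul_distrib]
  ring

variable {K D d p : ℕ} [NeZero K] [NeZero D] [NeZero d] [NeZero p]
  {A : Fin K → MPSTensor d (Fin D)} {V : ProtocolGates A p} {n q : ℕ} [NeZero q]

/-- All block qudits have the same value. -/
def Cfg.BlocksAgree (κ : Cfg K D d p n q) : Prop := κ.eR = κ.eL ∧ ∀ x, κ.bl x = κ.eL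

instance (κ : Cfg K D d p n q) : Decidable κ.BlocksAgree := by
  unfold Cfg.BlocksAgree; infer_instance

/-- A superposition over the blocks of product states of the segments. -/
def segState (loc : Fin K → (Fin q → Fin d) → Matrix (Fin D) (Fin D) ℂ)
    (σ : Fin ((n + 1) * q + 2) → Bool → Fin K) (κ : Cfg K D d p n q) : ℂ :=
  if κ.BlocksAgree ∧ (∀ s, κ.an s = 0) ∧ κ.sd = σ then
    ∏ s, loc κ.eL (κ.ph s) (κ.bL s) (κ.bR s) else 0

/-- The state of a segment to which the sites of `l` have been added. -/
noncomputable def siteLoc (A : Fin K → MPSTensor d (Fin D)) (l : List (Fin q)) (α : Fin K)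
    (m : Fin q → Fin d) : Matrix (Fin D) (Fin D) ℂ :=
  if ∀ t, t ∉ l → m t = 0 then (1 / (Real.sqrt D : ℂ)) • (l.map fun t => A α (m t)).prod else 0

theorem siteLoc_finRange (α : Fin K) (m : Fin q → Fin d) :
    siteLoc A (List.finRange q) α m = (1 / (Real.sqrt D : ℂ)) • wordProd (A α) m := by
  rw [siteLoc, if_pos (by simp), wordProd, List.ofFn_eq_map]

/-- A Bell pair, read as a matrix in its two bond indices, is `1/√D` times the identity, which is
the empty matrix product. -/
theorem bellLayer_seedState {ψ : State (quditDim K D d p (n := n) (q := q))} {z : ℂ}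
    {σ : Fin ((n + 1) * q + 2) → Bool → Fin K} (hψ : ∀ κ, ψ κ.conf = z * seedState σ κ)
    (κ : Cfg K D d p n q) :
    applyGates ((List.finRange (n + 1)).map (bellGate V)) ψ κ.conf =
      z * segState (siteLoc A []) σ κ := by
  rw [bellLayer_apply]
  have h : ∀ x : Fin (n + 1) → Fin D × Fin D,
      seedState σ { κ with bL := fun s => (x s).1, bR := fun s => (x s).2 : Cfg K D d p n q } =
      if κ.BlocksAgree ∧ (∀ s, κ.an s = 0) ∧ κ.sd = σ then
        ∏ s, (if (∀ t, κ.ph s t = 0) ∧ x s = (0, 0) then 1 else 0) else 0 := by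
    intro x
    rw [Finset.prod_ite_zero, Finset.prod_const_one, seedState]
    simp only [Cfg.BlocksAgree, Finset.mem_univ, forall_true_left, forall_and, Prod.ext_iff]
    split_ifs <;> tauto
  simp only [hψ, h, segState]
  split_ifs with hC
  · rw [sum_prod_mul_prod z (fun s => V.bell (κ.bL s, κ.bR s))
      (fun s x => if (∀ t, κ.ph s t = 0) ∧ x = (0, 0) then 1 else 0)]
    congr 1
    refine Finset.prod_congr rfl fun s _ => ?_
    simp only [siteLoc, List.not_mem_nil, not_false_eq_true, forall_true_left, List.map_nil,
      List.prod_nil]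
    split_ifs with hm
    · have hm' : ∀ t, κ.ph s t = 0 := hm
      simp only [hm', implies_true, true_and, mul_ite, mul_one, mul_zero, Finset.sum_ite_eq',
        Finset.mem_univ, if_true]
      rw [V.bell_zero]
      simp [Matrix.one_apply]
    · have hm' : ¬ ∀ t, κ.ph s t = 0 := hm
      simp [hm']
  · simp

/-- A site not yet added is in state `0`, so only the prescribed columns of the site unitary are
used. They multiply the matrix product by `A α (m t)` on the left. -/
theorem sum_site_mul_siteLoc {l : List (Fin q)} {t : Fin q} (ht : t ∉ l) (α : Fin K)
    (m : Fin q → Fin d) (i k : Fin D) :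
    ∑ x : Fin D × Fin d, V.site α (i, m t) x *
      siteLoc A l α (Function.update m t x.2) x.1 k = siteLoc A (t :: l) α m i k := by
  have hmap : ∀ a, (l.map fun t' => A α (Function.update m t a t')) = l.map fun t' => A α
      (m t') := by
    intro a
    refine List.map_congr_left fun t' ht' => ?_
    rw [Function.update_of_ne (by rintro rfl; exact ht ht')]
  have hcond : ∀ a, (∀ t', t' ∉ l → Function.update m t a t' = 0) ↔
      a = 0 ∧ ∀ t', t' ∉ t :: l → m t' = 0 := by
    intro a
    constructor
    · refine fun h => ⟨by simpa using h t ht, fun t' ht' => ?_⟩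
      rw [List.mem_cons, not_or] at ht'
      simpa [ht'.1] using h t' ht'.2
    · rintro ⟨rfl, h⟩ t' ht'
      by_cases h' : t' = t
      · rw [h', Function.update_self]
      · rw [Function.update_of_ne h', h t' (by simp [h', ht'])]
  simp only [siteLoc, hmap, hcond]
  rw [Fintype.sum_prod_type]
  by_cases hm : ∀ t', t' ∉ t :: l → m t' = 0
  · simp only [if_pos hm, and_iff_left hm]
    have h2 : ∀ j, ∑ a, V.site α (i, m t) (j, a) *
        (if a = 0 then (1 / (Real.sqrt D : ℂ)) • (l.map fun t' => A α (m t')).prod else 0 :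
          Matrix (Fin D) (Fin D) ℂ) j k =
        A α (m t) i j * ((1 / (Real.sqrt D : ℂ)) • (l.map fun t' => A α (m t')).prod) j k := by
      intro j
      rw [Finset.sum_eq_single 0, if_pos rfl, V.site_zero]
      · intro a _ ha
        rw [if_neg ha, Matrix.zero_apply, mul_zero]
      · simp
    simp only [h2]
    rw [← Matrix.mul_apply, List.map_cons, List.prod_cons, Matrix.mul_smul]
  · simp only [hm, and_false, if_false, Matrix.zero_apply, mul_zero, Finset.sum_const_zero]

/-- On the support of the state every control equals the left edge block qudit, so the layer applies
the same block's gate to all segments and preserves the product form. -/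
theorem siteLayer_segState {ψ : State (quditDim K D d p (n := n) (q := q))} {z : ℂ}
    {σ : Fin ((n + 1) * q + 2) → Bool → Fin K} {l : List (Fin q)} {t : Fin q} (ht : t ∉ l)
    (hψ : ∀ κ, ψ κ.conf = z * segState (siteLoc A l) σ κ) (κ : Cfg K D d p n q) :
    applyGates ((List.finRange (n + 1)).map (siteGate V t)) ψ κ.conf =
      z * segState (siteLoc A (t :: l)) σ κ := by
  rw [siteLayer_apply]
  simp only [hψ]
  have h : ∀ x : Fin (n + 1) → Fin D × Fin d,
      segState (siteLoc A l) σ { κ with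
        bL := fun s => (x s).1
        ph := fun s => Function.update (κ.ph s) t (x s).2 : Cfg K D d p n q } =
      if κ.BlocksAgree ∧ (∀ s, κ.an s = 0) ∧ κ.sd = σ then
        ∏ s, siteLoc A l κ.eL (Function.update (κ.ph s) t (x s).2) (x s).1 (κ.bR s) else 0 :=
    fun x => rfl
  simp only [h]
  rw [segState]
  split_ifs with hC
  · simp only [hC.1.2]
    rw [sum_prod_mul_prod z (fun s => V.site κ.eL (κ.bL s, κ.ph s t))
      (fun s x => siteLoc A l κ.eL (Function.update (κ.ph s) t x.2) x.1 (κ.bR s))]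
    congr 1
    exact Finset.prod_congr rfl fun s _ => sum_site_mul_siteLoc ht _ _ _ _
  · simp

theorem siteLayers_segState {ψ : State (quditDim K D d p (n := n) (q := q))} {z : ℂ}
    {σ : Fin ((n + 1) * q + 2) → Bool → Fin K}
    (hψ : ∀ κ, ψ κ.conf = z * segState (siteLoc A []) σ κ) {l : List (Fin q)} (hl : l.Nodup)
    (κ : Cfg K D d p n q) :
    l.foldr (fun t φ => applyGates ((List.finRange (n + 1)).map (siteGate V t)) φ) ψ κ.conf =
      z * segState (siteLoc A l) σ κ := by
  induction l generalizing κ with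
  | nil => exact hψ κ
  | cons t l ih =>
    rw [List.nodup_cons] at hl
    exact siteLayer_segState hl.1 (fun κ => ih hl.2 κ) κ

/-- The matrix that a fusion with outcome `x` inserts into block `α`. -/
def fuseMatrix (V : ProtocolGates A p) (α : Fin K) (x : Fin D × Fin D × Fin p) :
    Matrix (Fin D) (Fin D) ℂ :=
  Matrix.of fun i j => V.fuse α x (i, j, 0)

/-- The new values of the two fused bonds and the ancilla select a row of the fusion unitary. As the
ancilla enters in state `0`, this row is a matrix in the two old bond values, and summing over those
contracts the segments. -/
theorem fuseLayer_segState {ψ : State (quditDim K D d p (n := n) (q := q))} {z : ℂ}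
    {σ : Fin ((n + 1) * q + 2) → Bool → Fin K}
    {loc : Fin K → (Fin q → Fin d) → Matrix (Fin D) (Fin D) ℂ}
    (hψ : ∀ κ, ψ κ.conf = z * segState loc σ κ) (κ : Cfg K D d p n q) :
    applyGates ((List.finRange n).map (fuseGate V)) ψ κ.conf =
      z * if κ.BlocksAgree ∧ κ.sd = σ then
        pathSum (fun s => loc κ.eL (κ.ph s))
          (fun s => fuseMatrix V κ.eL (κ.bR s.castSucc, κ.bL s.succ, κ.an s))
          (κ.bL 0) (κ.bR (Fin.last n)) else 0 := by
  rw [fuseLayer_apply]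
  simp only [hψ]
  have h : ∀ x : Fin n → Fin D × Fin D × Fin p,
      segState loc σ { κ with
        bR := Fin.snoc (fun s => (x s).1) (κ.bR (Fin.last n))
        bL := Fin.cons (κ.bL 0) fun s => (x s).2.1
        an := fun s => (x s).2.2 : Cfg K D d p n q } =
      if κ.BlocksAgree ∧ (∀ s, (x s).2.2 = 0) ∧ κ.sd = σ then
        ∏ s, loc κ.eL (κ.ph s) ((Fin.cons (κ.bL 0) fun s => (x s).2.1 : Fin (n + 1) → Fin D) s)
          ((Fin.snoc (fun s => (x s).1) (κ.bR (Fin.last n)) : Fin (n + 1) → Fin D) s) else 0 :=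
    fun x => rfl
  simp only [h]
  split_ifs with hC
  · simp only [hC.1, hC.2, hC.1.2, true_and, and_true]
    rw [pathSum_apply, Finset.mul_sum]
    symm
    refine Fintype.sum_of_injective
      (fun x s => ((x s).1, (x s).2, 0) : (Fin n → Fin D × Fin D) → Fin n → Fin D × Fin D × Fin p)
      (fun x x' hx => ?_) _ _ ?_ ?_
    · funext s
      have := congrFun hx s
      simp only [Prod.mk.injEq] at this
      exact Prod.ext this.1 this.2.1
    · intro x hx
      rw [if_neg, mul_zero, mul_zero]
      intro h0
      exact hx ⟨fun s => ((x s).1, (x s).2.1), funext fun s =>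
        Prod.ext rfl (Prod.ext rfl (h0 s).symm)⟩
    · intro x
      simp only [implies_true, if_true, fuseMatrix, Matrix.of_apply]
      ring
  · rw [mul_zero]
    refine Finset.sum_eq_zero fun x _ => ?_
    rw [if_neg fun h' => hC ⟨h'.1, h'.2.2⟩, mul_zero, mul_zero]

end Evolution


/-! ### Corrections adapted to the fusion outcomes -/

section Choices

variable {K D d p : ℕ} [NeZero K] [NeZero D] [NeZero d] [NeZero p]
  {A : Fin K → MPSTensor d (Fin D)} (V : ProtocolGates A p)

/-- A defect of block `α`, up to a phase. -/
def IsDefect (α : Fin K) (M : Matrix (Fin D) (Fin D) ℂ) : Prop :=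
  ∃ (k : Fin V.η) (z : ℂ), ‖z‖ = 1 ∧ M = z • V.defect α k

/-- The defects form groups up to phases, and can be pushed through `q` sites. -/
structure PushableDefects (q : ℕ) : Prop where
  one_mem : ∀ α, IsDefect V α 1
  mul_mem : ∀ α M M', IsDefect V α M → IsDefect V α M' → IsDefect V α (M * M')
  star_mem : ∀ α M, IsDefect V α M → IsDefect V α (star M)
  push : ∀ α M, IsDefect V α M → ∃ L, IsDefect V α L ∧
    ∃ O ∈ Matrix.unitaryGroup (Fin q → Fin d) ℂ,
      O * virtualToPhysical (A α) q = virtualToPhysical (A α) q * (L.transpose ⊗ₖ M)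

variable {V} {n q : ℕ} [NeZero q]

theorem smul_mem_unitaryGroup {ι : Type} [Fintype ι] [DecidableEq ι] {M : Matrix ι ι ℂ}
    (hM : M ∈ Matrix.unitaryGroup ι ℂ) {z : ℂ} (hz : ‖z‖ = 1) :
    z • M ∈ Matrix.unitaryGroup ι ℂ := by
  rw [Matrix.mem_unitaryGroup_iff, star_smul, smul_mul_smul_comm, Complex.star_def,
    Complex.mul_conj, Complex.normSq_eq_norm_sq, hz, Matrix.mem_unitaryGroup_iff.1 hM]
  simp

theorem IsDefect.mem_unitaryGroup {α : Fin K} {M : Matrix (Fin D) (Fin D) ℂ}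
    (h : IsDefect V α M) : M ∈ Matrix.unitaryGroup (Fin D) ℂ := by
  obtain ⟨k, z, hz, rfl⟩ := h
  exact smul_mem_unitaryGroup (V.defect_unitary α k) hz

/-- The labels are shared by all blocks, so the index `k` and the weight `w` are independent of `α`.
This is what makes the fusion measurement reveal nothing about the block. -/
theorem PushableDefects.fuseMatrix_eq (h : PushableDefects V q) (x : Fin D × Fin D × Fin p) :
    ∃ (k : Fin V.η) (w : ℂ), ∀ α, fuseMatrix V α x = w • V.defect α k := by
  by_cases hx : x ∈ Set.range V.label
  · obtain ⟨k, rfl⟩ := hx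
    refine ⟨k, (Real.sqrt (D / V.η) : ℂ), fun α => ?_⟩
    ext i j
    rw [fuseMatrix, Matrix.of_apply, V.fuse_label, Matrix.smul_apply, smul_eq_mul]
  -- Such an outcome has amplitude zero; the index is arbitrary, and `one_mem` only supplies one.
  · obtain ⟨k, -⟩ := h.one_mem 0
    refine ⟨k, 0, fun α => ?_⟩
    ext i j
    rw [fuseMatrix, Matrix.of_apply, V.fuse_other α x i j hx]
    simp

/-- The outcome of a fusion. -/
def fuseOutcome (o : Cfg K D d p n q) (s : Fin n) : Fin D × Fin D × Fin p :=
  (o.bR s.castSucc, o.bL s.succ, o.an s)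

/-- The corrections undo all the defects. -/
def ProtocolChoices.Corrects (P : ProtocolChoices V n q) : Prop :=
  ∀ o, ∃ C : ℂ, ∀ (α : Fin K) (m : Fin (n + 1) → Fin q → Fin d),
    P.edge o α * pathSum (fun s => ∑ m', P.corr o α s (m s) m' •
      ((1 / (Real.sqrt D : ℂ)) • wordProd (A α) m'))
      (fun s => fuseMatrix V α (fuseOutcome (Cfg.ofConf o) s)) =
    C • (List.ofFn fun s => wordProd (A α) (m s)).prod

theorem PushableDefects.exists_choices (h : PushableDefects V q) (n : ℕ) :
    ∃ P : ProtocolChoices V n q, P.Corrects ∧ P.seed.IsLocal quditPos (q + 1) ∧ P.seed.depth ≤ 4 ∧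
      ∀ φ ∈ P.seed.branches (ketZero _), ∃ (z : ℂ) (σ : _), ∀ κ, φ κ.conf = z * seedState σ κ := by
  choose W hW hWv using fun x : Fin ((n + 1) * q + 2) => exists_pairMatrix (K := K) x
  choose k w hkw using h.fuseMatrix_eq
  choose L R O hL hR hO hpush hLR hlast using fun (o : Conf (quditDim K D d p (n := n) (q := q)))
    (α : Fin K) => exists_corrections (A α) (IsDefect V α) (fun M hM => hM.mem_unitaryGroup)
      (h.one_mem α) (h.mul_mem α) (h.star_mem α) (h.push α) n
      (fun s => V.defect α (k (fuseOutcome (Cfg.ofConf o) s)))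
      (fun s => ⟨_, 1, by simp, (one_smul ℂ _).symm⟩)
  refine ⟨{
    seed := seedCircuit D d p W
    seed_actsOn := seedCircuit_actsOn
    seed_prepares := seedCircuit_prepares hWv
    corr := O
    corr_unitary := hO
    corr_pushing := fun o α s => ⟨L o α s, (hL o α s).mem_unitaryGroup, R o α s,
      (hR o α s).mem_unitaryGroup, hpush o α s⟩
    -- Cancels the one left factor that remains after telescoping.
    edge := fun o α => star (L o α 0)
    edge_defect := fun o α => by
      obtain ⟨k, z, hz, h⟩ := hL o α 0
      exact ⟨k, star z, by simpa using hz, by rw [h, star_smul, Matrix.star_eq_conjTranspose]⟩ },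
    fun o => ?_, seedCircuit_isLocal hW, seedCircuit_depth W,
    fun φ hφ => mem_branches_seedCircuit hWv hφ⟩
  -- One `1/√D` per Bell pair and one weight per fusion, with no dependence on the block.
  refine ⟨(1 / (Real.sqrt D : ℂ)) ^ (n + 1) * ∏ s, w (fuseOutcome (Cfg.ofConf o) s),
    fun α m => ?_⟩
  dsimp only
  have h1 : ∀ s, ∑ m', O o α s (m s) m' • ((1 / (Real.sqrt D : ℂ)) • wordProd (A α) m') =
      (1 / (Real.sqrt D : ℂ)) • (L o α s * wordProd (A α) (m s) * R o α s) := by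
    intro s
    rw [← sum_smul_wordProd (hpush o α s), Finset.smul_sum]
    exact Finset.sum_congr rfl fun m' _ => smul_comm _ _ _
  simp only [h1, hkw]
  rw [pathSum_smul, pathSum_conj _ _ _ _ (hLR o α) (hlast o α), Matrix.mul_smul, ← mul_assoc,
    Matrix.mem_unitaryGroup_iff'.1 (hL o α 0).mem_unitaryGroup, one_mul]

end Choices

/-! ### The final state in each branch, locality and depth -/

section Final

variable {K D d p : ℕ} [NeZero K] [NeZero D] [NeZero d] [NeZero p]
  {A : Fin K → MPSTensor d (Fin D)} {V : ProtocolGates A p} {n q : ℕ} [NeZero q]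

/-- The product of the matrices of all segments. -/
noncomputable def chainProd (T : MPSTensor d (Fin D)) (m : Fin (n + 1) → Fin q → Fin d) :
    Matrix (Fin D) (Fin D) ℂ :=
  (List.ofFn fun s => wordProd T (m s)).prod

/-- Once the outcome is fixed, the inserted matrices no longer depend on the configuration, and the
correction layer turns the defective chain into the clean product. The scalar `z'` is common to all
blocks, so the superposition survives. -/
theorem corrLayer_chain {P : ProtocolChoices V n q} (hP : P.Corrects)
    (o : Conf (quditDim K D d p (n := n) (q := q))) {σ : Fin ((n + 1) * q + 2) → Bool → Fin K}
        {z : ℂ}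
    {ψ : State (quditDim K D d p (n := n) (q := q))}
    (hψ : ∀ κ, ψ κ.conf = if fuseOutcome κ = fuseOutcome (Cfg.ofConf o) then
      z * if κ.BlocksAgree ∧ κ.sd = σ then
        pathSum (fun s => siteLoc A (List.finRange q) κ.eL (κ.ph s))
          (fun s => fuseMatrix V κ.eL (κ.bR s.castSucc, κ.bL s.succ, κ.an s))
          (κ.bL 0) (κ.bR (Fin.last n)) else 0 else 0) :
    ∃ z' : ℂ, ∀ κ, applyGates
        (edgeGate P o :: (List.finRange (n + 1)).map (corrGate P o)) ψ κ.conf =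
      if fuseOutcome κ = fuseOutcome (Cfg.ofConf o) ∧ κ.BlocksAgree ∧ κ.sd = σ then
        z' * chainProd (A κ.eL) κ.ph (κ.bL 0) (κ.bR (Fin.last n)) else 0 := by
  obtain ⟨C, hC⟩ := hP o
  refine ⟨z * C, fun κ => ?_⟩
  rw [applyGates_cons, corrLayer_apply]
  have h1 : ∀ κ : Cfg K D d p n q, (edgeGate P o).op.mulVec ψ κ.conf =
      if fuseOutcome κ = fuseOutcome (Cfg.ofConf o) ∧ κ.BlocksAgree ∧ κ.sd = σ then
        z * (P.edge o κ.eL * pathSum (fun s => (1 / (Real.sqrt D : ℂ)) • wordProd (A κ.eL) (κ.ph s))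
          (fun s => fuseMatrix V κ.eL (fuseOutcome (Cfg.ofConf o) s)))
          (κ.bL 0) (κ.bR (Fin.last n)) else 0 := by
    intro κ
    rw [(edgeGate_actsBy P o).mulVec_apply Cfg.conf_bijective]
    have h2 : ∀ x, ψ (edgeLens.set x κ).conf =
        if fuseOutcome κ = fuseOutcome (Cfg.ofConf o) ∧ κ.BlocksAgree ∧ κ.sd = σ then
          z * pathSum (fun s => (1 / (Real.sqrt D : ℂ)) • wordProd (A κ.eL) (κ.ph s))
            (fun s => fuseMatrix V κ.eL (fuseOutcome (Cfg.ofConf o) s)) x (κ.bR (Fin.last n))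
          else 0 := by
      intro x
      rw [hψ, mul_ite, mul_zero]
      -- The edge gate changes the left bond qudit of segment `0`, while the measured left bond
      -- qudits are those of the segments `s.succ`.
      have h3 : fuseOutcome (edgeLens.set x κ) = fuseOutcome κ := by
        funext s
        simp [fuseOutcome, edgeLens]
      rw [h3]
      simp only [siteLoc_finRange]
      by_cases hf : fuseOutcome κ = fuseOutcome (Cfg.ofConf o)
      · rw [if_pos hf]
        simp only [hf, true_and]
        refine if_congr Iff.rfl ?_ rfl
        have h4 : ∀ s, ((edgeLens.set x κ).bR s.castSucc, (edgeLens.set x κ).bL s.succ,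
            (edgeLens.set x κ).an s) = fuseOutcome (Cfg.ofConf o) s := fun s => by
          rw [← hf, ← h3]; rfl
        simp only [h4]
        simp [edgeLens]
      · rw [if_neg hf, if_neg fun h => hf h.1]
    simp only [h2]
    split_ifs
    · rw [Matrix.mul_apply, Finset.mul_sum]
      exact Finset.sum_congr rfl fun x _ => by simp only [edgeLens]; ring
    · simp
  simp only [h1]
  change (∑ m : Fin (n + 1) → Fin q → Fin d,
    (∏ s, P.corr o (κ.bl (siteOf s 0)) s (κ.ph s) (m s)) *
    if fuseOutcome κ = fuseOutcome (Cfg.ofConf o) ∧ κ.BlocksAgree ∧ κ.sd = σ then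
      z * (P.edge o κ.eL * pathSum (fun s => (1 / (Real.sqrt D : ℂ)) • wordProd (A κ.eL) (m s))
        (fun s => fuseMatrix V κ.eL (fuseOutcome (Cfg.ofConf o) s)))
        (κ.bL 0) (κ.bR (Fin.last n)) else 0) = _
  split_ifs with hc
  · simp only [hc.2.1.2]
    have h5 := hC κ.eL κ.ph
    -- Multilinearity exchanges the local sums in `Corrects` for the sum over all physical
    -- configurations produced by the layer.
    rw [← sum_prod_mul_pathSum (fun s => P.corr o κ.eL s (κ.ph s))
      (fun _ m' => (1 / (Real.sqrt D : ℂ)) • wordProd (A κ.eL) m'), Matrix.mul_sum] at h5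
    have h6 := congrFun (congrFun h5 (κ.bL 0)) (κ.bR (Fin.last n))
    rw [Matrix.sum_apply, Matrix.smul_apply, smul_eq_mul] at h6
    rw [chainProd, mul_assoc, ← h6, Finset.mul_sum]
    refine Finset.sum_congr rfl fun m _ => ?_
    rw [Matrix.mul_smul, Matrix.smul_apply, smul_eq_mul]
    ring
  · simp

/-- Before the layer all block qudits equal the edge value, so the sum over their values has a
single term and only Fourier coefficients remain. -/
theorem fourierLayer_chain {Z : Cfg K D d p n q → Prop} [DecidablePred Z] {f : Cfg K D d p n q → ℂ}
    (hZ : ∀ κ y, Z { κ with bl := y } ↔ Z κ) (hf : ∀ κ y, f { κ with bl := y } = f κ)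
    {ψ : State (quditDim K D d p (n := n) (q := q))}
    (hψ : ∀ κ, ψ κ.conf = if Z κ ∧ κ.BlocksAgree then f κ else 0)
    (κ : Cfg K D d p n q) :
    applyGates ((List.finRange ((n + 1) * q)).map (fourierGate K D d p)) ψ κ.conf =
      if Z κ ∧ κ.eR = κ.eL then (∏ x, fourierMatrix K (κ.bl x) κ.eL) * f κ else 0 := by
  rw [fourierLayer_apply, Finset.sum_eq_single fun _ => κ.eL]
  · rw [hψ, hf, mul_ite, mul_zero]
    refine if_congr ?_ rfl rfl
    rw [hZ]
    simp [Cfg.BlocksAgree]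
  · intro y _ hy
    rw [hψ, if_neg, mul_zero]
    rintro ⟨-, -, h⟩
    exact hy (funext h)
  · simp

/-- The Fourier coefficients multiply to a phase `exp(-2πi a Σ k_x / K)`, which the phase gate
inverts. The remaining modulus does not depend on `a`, so the blocks stay in phase. -/
theorem exp_mul_prod_fourierMatrix (a : Fin K) (k : Fin ((n + 1) * q) → Fin K) :
    Complex.exp (2 * Real.pi * Complex.I * (a.val : ℂ) / (K : ℂ) * ∑ x, ((k x).val : ℂ)) *
      ∏ x, fourierMatrix K (k x) a = (1 / (Real.sqrt K : ℂ)) ^ ((n + 1) * q) := by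
  simp only [fourierMatrix, div_eq_mul_inv _ (Real.sqrt K : ℂ), Finset.prod_mul_distrib, one_mul,
    Finset.prod_const, Finset.card_univ, Fintype.card_fin]
  rw [← mul_assoc, ← Complex.exp_sum, ← Complex.exp_add]
  have : 2 * Real.pi * Complex.I * (a.val : ℂ) / (K : ℂ) * ∑ x, ((k x).val : ℂ) +
      ∑ x, -(2 * Real.pi * Complex.I * ((k x).val : ℂ) * (a.val : ℂ) / (K : ℂ)) = 0 := by
    rw [Finset.mul_sum, ← Finset.sum_add_distrib]
    exact Finset.sum_eq_zero fun x _ => by ring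
  rw [this, Complex.exp_zero, one_mul]

theorem forall_fusedQudits {κ : Cfg K D d p n q} {o : Conf (quditDim K D d p (n := n) (q := q))} :
    (∀ x ∈ fusedQudits n q, κ.conf x = o x) ↔ fuseOutcome κ = fuseOutcome (Cfg.ofConf o) := by
  rw [funext_iff]
  simp only [fusedQudits, Finset.mem_biUnion, Finset.mem_univ, true_and, forall_exists_index,
    fuseOutcome, Prod.mk.injEq]
  constructor
  · intro h s
    exact ⟨h (.bondR s.castSucc) s (by simp), h (.bondL s.succ) s (by simp), h (.anc s) s (by simp)⟩
  · intro h x s hx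
    simp only [Finset.mem_insert, Finset.mem_singleton] at hx
    rcases hx with rfl | rfl | rfl
    · exact (h s).1
    · exact (h s).2.1
    · exact (h s).2.2

theorem mem_branches_protocol {P : ProtocolChoices V n q} (hP : P.Corrects)
    (hseed : ∀ φ ∈ P.seed.branches (ketZero _), ∃ (z : ℂ) (σ : _), ∀ κ,
      φ κ.conf = z * seedState σ κ)
    {φ : State (quditDim K D d p (n := n) (q := q))}
    (hφ : φ ∈ (protocol P).branches (ketZero _)) :
    ∃ (z : ℂ) (o : Cfg K D d p n q), ∀ κ, φ κ.conf =
      if fuseOutcome κ = fuseOutcome o ∧ κ.bl = o.bl ∧ κ.sd = o.sd then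
        if κ.eR = κ.eL then z * chainProd (A κ.eL) κ.ph (κ.bL 0) (κ.bR (Fin.last n)) else 0
      else 0 := by
  rw [protocol, AdaptiveCircuit.mem_branches_andThen] at hφ
  obtain ⟨χ, hχ, hφ⟩ := hφ
  obtain ⟨z, σ, hχ⟩ := hseed χ hχ
  rw [AdaptiveCircuit.branches, AdaptiveCircuit.branches_foldr_layer] at hφ
  obtain ⟨o, -, k, -, rfl⟩ := hφ
  have h1 := siteLayers_segState (V := V) (bellLayer_seedState (V := V) hχ) (List.nodup_finRange q)
  have h2 := fuseLayer_segState (V := V) h1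
  obtain ⟨z', h3⟩ := corrLayer_chain hP o (σ := σ) (z := z)
    (ψ := fun c => if ∀ x ∈ fusedQudits n q, c x = o x then
      applyGates ((List.finRange n).map (fuseGate V)) ((List.finRange q).foldr
        (fun t φ => applyGates ((List.finRange (n + 1)).map (siteGate V t)) φ)
        (applyGates ((List.finRange (n + 1)).map (bellGate V)) χ)) c else 0)
    (fun κ => by rw [h2]; exact if_congr forall_fusedQudits rfl rfl)
  have h4 := fourierLayer_chain
    (Z := fun κ => fuseOutcome κ = fuseOutcome (Cfg.ofConf o) ∧ κ.sd = σ)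
    (f := fun κ => z' * chainProd (A κ.eL) κ.ph (κ.bL 0) (κ.bR (Fin.last n)))
    (fun _ _ => Iff.rfl) (fun _ _ => rfl)
    (fun κ => (h3 κ).trans (if_congr (by tauto) rfl rfl))
  refine ⟨(1 / (Real.sqrt K : ℂ)) ^ ((n + 1) * q) * z',
    { Cfg.ofConf o with bl := (Cfg.ofConf k).bl, sd := σ }, fun κ => ?_⟩
  change (phaseGate K D d p k).op.mulVec _ κ.conf = _
  rw [(phaseGate_actsBy k).mulVec_apply Cfg.conf_bijective]
  simp only [Finset.univ_unique, Finset.sum_singleton, Matrix.of_apply, trivialLens]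
  have hm : (∀ x ∈ Finset.univ.image Qudit.block, κ.conf x = k x) ↔ κ.bl = (Cfg.ofConf k).bl := by
    rw [funext_iff]
    simp only [Finset.mem_image, Finset.mem_univ, true_and, forall_exists_index,
      forall_apply_eq_imp_iff]
    rfl
  simp only [hm]
  by_cases hb : κ.bl = (Cfg.ofConf k).bl
  · rw [if_pos hb]
    refine (congrArg (_ * ·) (h4 κ)).trans ?_
    have h5 := exp_mul_prod_fourierMatrix κ.eL (Cfg.ofConf k).bl
    simp only [hb]
    by_cases hc : (fuseOutcome κ = fuseOutcome (Cfg.ofConf o) ∧ κ.sd = σ) ∧ κ.eR = κ.eL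
    · rw [if_pos hc, if_pos ⟨hc.1.1, trivial, hc.1.2⟩, if_pos hc.2, ← h5]
      simp only [mul_assoc]
      rfl
    · rw [if_neg hc, mul_zero, ← ite_and, if_neg]
      exact fun h => hc ⟨⟨h.1.1, h.1.2.2⟩, h.2⟩
  · rw [if_neg hb, mul_zero, if_neg]
    exact fun h => hb h.2.1

theorem protocol_prepares {P : ProtocolChoices V n q} (hP : P.Corrects)
    (hseed : ∀ φ ∈ P.seed.branches (ketZero _), ∃ (z : ℂ) (σ : _), ∀ κ,
      φ κ.conf = z * seedState σ κ) :
    (protocol P).Prepares (outputQudits n q) (edgeEntangledMPS A p n q) := by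
  intro φ hφ hne
  obtain ⟨z, o, h⟩ := mem_branches_protocol hP hseed hφ
  refine ⟨z, o.conf, ?_, funext fun c => ?_⟩
  · rintro rfl
    refine hne (funext fun c => ?_)
    obtain ⟨κ, rfl⟩ := Cfg.conf_bijective.2 c
    simp [h]
  obtain ⟨κ, rfl⟩ := Cfg.conf_bijective.2 c
  rw [h]
  refine if_congr ?_ ?_ rfl
  · rw [Cfg.agree_iff (S := fun y => y ∈ outputQudits n q)]
    simp [outputQudits, -Bool.forall_bool]
    rw [Fin.forall_fin_succ (P := fun s => ¬ s = 0 → κ.bL s = o.bL s),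
      Fin.forall_fin_succ' (P := fun s => ¬ s = Fin.last n → κ.bR s = o.bR s)]
    simp [fuseOutcome, funext_iff, forall_and, Fin.castSucc_ne_last]
    tauto
  · have key : ∀ m : Fin ((n + 1) * q) → Fin d, (∀ s t, m (siteOf s t) = κ.ph s t) →
        (if κ.eR = κ.eL then z * chainProd (A κ.eL) κ.ph (κ.bL 0) (κ.bR (Fin.last n)) else 0) =
        z * wordProd (directSum A) m (κ.bL 0, κ.eL) (κ.bR (Fin.last n), κ.eR) := by
      intro m hm
      rw [wordProd_directSum, Matrix.blockDiagonal_apply, mul_ite, mul_zero]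
      -- The off-diagonal blocks of the direct sum vanish, matching the condition that the two edge
      -- block qudits agree.
      refine if_congr eq_comm ?_ rfl
      simp only [wordProd_flatten, hm]
      rfl
    exact key (fun x => κ.conf (.phys x)) (Cfg.conf_phys κ)

theorem protocol_isLocal {P : ProtocolChoices V n q} (hP : P.seed.IsLocal quditPos (q + 1)) :
    (protocol P).IsLocal quditPos (q + 1) := by
  refine hP.andThen ⟨?_, ?_, AdaptiveCircuit.IsLocal.foldr_layer (fun t => ⟨?_, ?_⟩) _
    ⟨?_, ?_, fun o => ⟨?_, ?_, ?_, ?_, fun k => ⟨?_, ?_, trivial⟩⟩⟩⟩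
  all_goals simp only [List.forall_mem_map, List.pairwise_map, List.forall_mem_cons,
    List.pairwise_cons]
  · exact fun s _ => bellGate_isLocalUnitary s
  · exact (List.nodup_finRange _).imp fun h => disjoint_bellGate h
  · exact fun s _ => siteGate_isLocalUnitary t s
  · exact (List.nodup_finRange _).imp fun h => disjoint_siteGate t h
  · exact fun s _ => fuseGate_isLocalUnitary s
  · exact (List.nodup_finRange _).imp fun h => disjoint_fuseGate h
  · exact ⟨edgeGate_isLocalUnitary P o, fun s _ => corrGate_isLocalUnitary P o s⟩
  · exact ⟨fun s _ => disjoint_edgeGate_corrGate P o s,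
      (List.nodup_finRange _).imp fun h => disjoint_corrGate P o h⟩
  · exact fun x _ => fourierGate_isLocalUnitary x
  · exact (List.nodup_finRange _).imp fun h => disjoint_fourierGate h
  · simpa using phaseGate_isLocalUnitary k
  · simp

/-- Four rounds for the seed, `q` for the sites, and one each for the Bell pairs, fusion basis
change, fusion measurement, corrections, Fourier gates, block measurement and phase gate. -/
theorem protocol_depth {P : ProtocolChoices V n q} (hP : P.seed.depth ≤ 4) :
    (protocol P).depth ≤ q + 11 := by
  refine (AdaptiveCircuit.depth_andThen _ _).trans ?_
  rw [AdaptiveCircuit.depth, AdaptiveCircuit.depth_foldr_layer]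
  simp only [AdaptiveCircuit.depth, List.length_reverse, List.length_finRange]
  have h1 : ∀ m : ℕ, (Finset.univ.sup fun _ : Conf (quditDim K D d p (n := n) (q := q)) => m) ≤ m :=
    fun m => Finset.sup_le fun _ _ => le_rfl
  have h2 := h1 (0 + 1)
  have h3 := h1 ((Finset.univ.sup fun _ : Conf (quditDim K D d p (n := n) (q := q)) => 0 + 1) +
    1 + 1 + 1)
  omega

end Final


/-! ### Projective frames -/

section Frames

/-- A finite family of unitaries that is a group up to phases and whose matrix elements are
orthogonal. -/
structure IsProjFrame {Γ ι : Type} [Fintype Γ] [Fintype ι] [DecidableEq ι]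
    (B : Γ → Matrix ι ι ℂ) : Prop where
  unitary : ∀ g, B g ∈ Matrix.unitaryGroup ι ℂ
  one : ∃ g, ∃ z : ℂ, ‖z‖ = 1 ∧ 1 = z • B g
  mul : ∀ g h, ∃ k, ∃ z : ℂ, ‖z‖ = 1 ∧ B g * B h = z • B k
  star : ∀ g, ∃ k, ∃ z : ℂ, ‖z‖ = 1 ∧ star (B g) = z • B k
  ortho : ∀ i j i' j', ∑ g, Star.star (B g i j) * B g i' j' =
    if i = i' ∧ j = j' then (Fintype.card Γ : ℂ) / Fintype.card ι else 0

theorem star_mul_self_of_norm {z : ℂ} (hz : ‖z‖ = 1) : star z * z = 1 := by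
  rw [Complex.star_def, mul_comm, Complex.mul_conj, Complex.normSq_eq_norm_sq, hz]
  simp

variable {ι : Type} [Fintype ι] [DecidableEq ι]

/-- Schur's lemma for projective representations. Conjugation by `B h` permutes the summands, the
phases cancelling against their conjugates, so the average commutes with the representation. An
eigenspace is invariant and nonzero, hence everything; the trace fixes the scalar. -/
theorem IsProjIrrep.twirl {G : Type} [Group G] [Fintype G] [Nonempty ι] {B : G → Matrix ι ι ℂ}
    (hB : IsProjIrrep B) (X : Matrix ι ι ℂ) :
    ∑ g, B g * X * star (B g) = ((Fintype.card G : ℂ) / Fintype.card ι * X.trace) • 1 := by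
  set T := ∑ g, B g * X * star (B g) with hT
  have hconj : ∀ h, B h * T * star (B h) = T := by
    intro h
    rw [hT, Finset.mul_sum, Finset.sum_mul]
    refine Fintype.sum_equiv (Equiv.mulLeft h) _ _ fun g => ?_
    obtain ⟨ω, hω, h1⟩ := hB.mul h g
    have h2 : B h * (B g * X * star (B g)) * star (B h) = (B h * B g) * X * star (B h * B g) := by
      rw [star_mul]; simp only [mul_assoc]
    rw [h2, h1, star_smul, smul_mul_assoc, mul_smul_comm, smul_mul_assoc, smul_smul,
      star_mul_self_of_norm hω, one_smul]
    rfl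
  have hcomm : ∀ h, B h * T = T * B h := by
    intro h
    conv_rhs => rw [← hconj h]
    rw [mul_assoc _ _ (B h), Matrix.mem_unitaryGroup_iff'.1 (hB.unitary h), mul_one]
  obtain ⟨c, hc⟩ := Module.End.exists_eigenvalue (Matrix.toLin' T)
  have hW := hB.irreducible (Module.End.eigenspace (Matrix.toLin' T) c) fun g v hv => by
    rw [Module.End.mem_eigenspace_iff, Matrix.toLin'_apply] at hv ⊢
    rw [Matrix.mulVec_mulVec, ← hcomm, ← Matrix.mulVec_mulVec, hv, Matrix.mulVec_smul]
  have htop : Module.End.eigenspace (Matrix.toLin' T) c = ⊤ := hW.resolve_left hc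
  have hTc : T = c • 1 := by
    apply Matrix.toLin'.injective
    refine LinearMap.ext fun v => ?_
    have hv : v ∈ Module.End.eigenspace (Matrix.toLin' T) c := htop ▸ Submodule.mem_top
    rw [Module.End.mem_eigenspace_iff.1 hv, map_smul, Matrix.toLin'_one]
    rfl
  have htr : T.trace = Fintype.card G * X.trace := by
    rw [hT, Matrix.trace_sum]
    have : ∀ g, (B g * X * star (B g)).trace = X.trace := fun g => by
      rw [Matrix.trace_mul_comm, ← mul_assoc, Matrix.mem_unitaryGroup_iff'.1 (hB.unitary g),
        one_mul]
    simp [this]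
  have hι : (Fintype.card ι : ℂ) ≠ 0 := Nat.cast_ne_zero.2 Fintype.card_ne_zero
  rw [hTc, Matrix.trace_smul, Matrix.trace_one, smul_eq_mul] at htr
  rw [hTc]
  congr 1
  field_simp
  rw [htr]

/-- Closure up to phases comes from the group law. Orthogonality of matrix elements is the twirl of
a matrix unit, read entry by entry. -/
theorem IsProjIrrep.isProjFrame {G : Type} [Group G] [Fintype G] [Nonempty ι]
    {B : G → Matrix ι ι ℂ} (hB : IsProjIrrep B) : IsProjFrame B := by
  have hu : ∀ g, star (B g) * B g = 1 := fun g => Matrix.mem_unitaryGroup_iff'.1 (hB.unitary g)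
  have hone : ∃ z : ℂ, ‖z‖ = 1 ∧ B 1 = z • 1 := by
    obtain ⟨ω, hω, h⟩ := hB.mul 1 1
    refine ⟨ω, hω, ?_⟩
    have := congrArg (star (B 1) * ·) h
    simp only [← mul_assoc, hu, one_mul, mul_one, mul_smul_comm] at this
    exact this
  refine ⟨hB.unitary, ?_, fun g h => ?_, fun g => ?_, fun i j i' j' => ?_⟩
  · obtain ⟨z, hz, h⟩ := hone
    exact ⟨1, star z, by simpa using hz, by rw [h, smul_smul, star_mul_self_of_norm hz, one_smul]⟩
  · obtain ⟨ω, hω, h⟩ := hB.mul g h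
    exact ⟨_, ω, hω, h⟩
  · obtain ⟨ω, hω, h⟩ := hB.mul g g⁻¹
    obtain ⟨z, hz, h1⟩ := hone
    rw [mul_inv_cancel, h1, smul_smul] at h
    have h2 := congrArg (star (B g) * ·) h
    simp only [← mul_assoc, hu, one_mul, mul_one, mul_smul_comm] at h2
    have hωz : ‖ω * z‖ = 1 := by rw [norm_mul, hω, hz, one_mul]
    refine ⟨g⁻¹, star (ω * z), by rwa [norm_star], ?_⟩
    rw [h2, smul_smul, star_mul_self_of_norm hωz, one_smul]
  · have h := congrFun (congrFun (hB.twirl (Matrix.single j' j 1)) i') i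
    rw [Matrix.sum_apply] at h
    have h1 : ∀ g, (B g * Matrix.single j' j (1 : ℂ) * star (B g) : Matrix ι ι ℂ) i' i =
        star (B g i j) * B g i' j' := by
      intro g
      rw [Matrix.mul_apply, Finset.sum_eq_single j]
      · rw [Matrix.mul_single_apply_same, Matrix.star_apply, mul_one, mul_comm]
      · intro k _ hk
        rw [Matrix.mul_single_apply_of_ne _ _ _ _ _ hk, zero_mul]
      · exact fun hj => absurd (Finset.mem_univ j) hj
    simp only [h1] at h
    rw [h, Matrix.smul_apply, Matrix.one_apply]
    by_cases hj : j = j'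
    · subst hj
      rw [Matrix.trace_single_eq_same]
      simp [eq_comm]
    · rw [Matrix.trace_single_eq_of_ne _ _ _ (Ne.symm hj)]
      simp [hj]

/-- Shift and clock matrices commute up to a character value, which gives closure up to phases. The
shift parameter is determined by the entry, and the sum over the clock parameter is a character sum
that vanishes unless the columns agree. -/
theorem weyl_isProjFrame (k : ℕ) [NeZero k] :
    IsProjFrame fun g : ZMod k × ZMod k => (Matrix.of fun i j : ZMod k =>
      if i = j + g.1 then ZMod.stdAddChar (g.2 * j) else 0) where
  unitary g := by
    rw [Matrix.mem_unitaryGroup_iff]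
    ext i i'
    rw [Matrix.mul_apply, Finset.sum_eq_single (i - g.1)]
    · simp only [Matrix.star_apply, Matrix.of_apply, sub_add_cancel, if_true, Matrix.one_apply]
      by_cases h : i = i'
      · rw [if_pos h.symm, if_pos h, mul_comm, star_mul_self_of_norm (AddChar.norm_apply _ _)]
      · rw [if_neg (Ne.symm h), if_neg h, star_zero, mul_zero]
    · intro j _ hj
      rw [Matrix.of_apply, if_neg, zero_mul]
      rintro rfl
      simp at hj
    · simp
  one := ⟨0, 1, by simp, by
    ext i j
    simp [Matrix.one_apply]⟩
  mul g h := ⟨g + h, ZMod.stdAddChar (g.2 * h.1), AddChar.norm_apply _ _, by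
    ext i j
    rw [Matrix.mul_apply, Finset.sum_eq_single (j + h.1)]
    · simp only [Matrix.of_apply, Matrix.smul_apply, smul_eq_mul, if_true, ite_mul, zero_mul,
        mul_ite, mul_zero, Prod.fst_add, Prod.snd_add, ← AddChar.map_add_eq_mul]
      refine if_congr (by rw [add_assoc, add_comm h.1]) ?_ rfl
      congr 1
      ring
    · intro k _ hk
      rw [Matrix.of_apply, Matrix.of_apply, if_neg hk, mul_zero]
    · simp⟩
  star g := ⟨-g, ZMod.stdAddChar (g.1 * g.2), AddChar.norm_apply _ _, by
    ext i j
    simp only [Matrix.star_apply, Matrix.of_apply, Matrix.smul_apply, smul_eq_mul, mul_ite,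
      mul_zero, Prod.fst_neg, Prod.snd_neg, ← AddChar.map_add_eq_mul, apply_ite star, star_zero,
      ← sub_eq_add_neg, eq_sub_iff_add_eq]
    by_cases h : i + g.1 = j
    · rw [if_pos h.symm, if_pos h, Complex.star_def, ← AddChar.map_neg_eq_conj, ← h]
      congr 1
      ring
    · rw [if_neg (Ne.symm h), if_neg h]⟩
  ortho i j i' j' := by
    have h1 : ∀ a b : ZMod k, star (Matrix.of (fun i j : ZMod k =>
        if i = j + a then ZMod.stdAddChar (b * j) else (0 : ℂ)) i j) *
        Matrix.of (fun i j : ZMod k => if i = j + a then ZMod.stdAddChar (b * j) else 0) i' j' =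
        if i = j + a ∧ i' = j' + a then ZMod.stdAddChar (b * (j' - j)) else 0 := by
      intro a b
      simp only [Matrix.of_apply, apply_ite star, star_zero, Complex.star_def,
        ← AddChar.map_neg_eq_conj, ite_mul, zero_mul, mul_ite, mul_zero, ← ite_and,
        ← AddChar.map_add_eq_mul]
      refine if_congr and_comm ?_ rfl
      congr 1
      ring
    rw [Fintype.sum_prod_type]
    simp only [h1]
    have h2 : ∀ a : ZMod k, ∑ b : ZMod k, (if i = j + a ∧ i' = j' + a then
        (ZMod.stdAddChar (b * (j' - j)) : ℂ) else 0) =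
        if a = i - j then (if i = i' ∧ j = j' then (k : ℂ) else 0) else 0 := by
      intro a
      by_cases ha : i = j + a
      · subst ha
        by_cases hj : j = j'
        · subst hj
          simp [eq_comm]
        · have := AddChar.sum_mulShift (j' - j) (ZMod.isPrimitive_stdAddChar k)
          rw [if_neg (sub_ne_zero.2 (Ne.symm hj))] at this
          by_cases hi : i' = j' + a
          · simp [hi, hj, this]
          · simp [hi, hj]
      · have ha' : a ≠ i - j := by
          rintro rfl
          simp at ha
        simp [ha, ha']
    simp only [h2, Finset.sum_ite_eq', Finset.mem_univ, if_true, Fintype.card_prod, ZMod.card,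
      Nat.cast_mul]
    rw [mul_div_cancel_right₀ _ (Nat.cast_ne_zero.2 (NeZero.ne k))]

end Frames


/-! ### Transport, tensor products and padding of frames -/

section FrameConstructions

variable {ι κ Γ Δ : Type} [Fintype ι] [DecidableEq ι] [Fintype κ] [DecidableEq κ] [Fintype Γ]
  [Fintype Δ]

theorem reindex_mem_unitaryGroup (e : ι ≃ κ) {U : Matrix ι ι ℂ}
    (hU : U ∈ Matrix.unitaryGroup ι ℂ) : Matrix.reindex e e U ∈ Matrix.unitaryGroup κ ℂ := by
  rw [Matrix.mem_unitaryGroup_iff] at hU ⊢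
  rw [Matrix.star_eq_conjTranspose, Matrix.conjTranspose_reindex, Matrix.reindex_apply,
    Matrix.reindex_apply, Matrix.submatrix_mul_equiv, ← Matrix.star_eq_conjTranspose, hU,
    Matrix.submatrix_one_equiv]

theorem IsProjFrame.reindex {B : Γ → Matrix ι ι ℂ} (hB : IsProjFrame B) (e : ι ≃ κ) :
    IsProjFrame fun g => Matrix.reindex e e (B g) where
  unitary g := reindex_mem_unitaryGroup e (hB.unitary g)
  one := by
    obtain ⟨g, z, hz, h⟩ := hB.one
    refine ⟨g, z, hz, ?_⟩
    rw [Matrix.reindex_apply, ← Matrix.submatrix_one_equiv e.symm, h]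
    rfl
  mul g h := by
    obtain ⟨k, z, hz, hk⟩ := hB.mul g h
    refine ⟨k, z, hz, ?_⟩
    rw [Matrix.reindex_apply, Matrix.reindex_apply, Matrix.submatrix_mul_equiv, hk]
    rfl
  star g := by
    obtain ⟨k, z, hz, hk⟩ := hB.star g
    refine ⟨k, z, hz, ?_⟩
    rw [Matrix.star_eq_conjTranspose, Matrix.conjTranspose_reindex, ← Matrix.star_eq_conjTranspose,
      hk]
    rfl
  ortho i j i' j' := by
    simpa [Fintype.card_congr e] using hB.ortho (e.symm i) (e.symm j) (e.symm i') (e.symm j')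

theorem IsProjFrame.kronecker {B : Γ → Matrix ι ι ℂ} (hB : IsProjFrame B) {W : Δ → Matrix κ κ ℂ}
    (hW : IsProjFrame W) : IsProjFrame fun g : Γ × Δ => B g.1 ⊗ₖ W g.2 where
  unitary g := Matrix.kronecker_mem_unitary (hB.unitary g.1) (hW.unitary g.2)
  one := by
    obtain ⟨g, z, hz, h⟩ := hB.one
    obtain ⟨g', z', hz', h'⟩ := hW.one
    refine ⟨(g, g'), z * z', by rw [norm_mul, hz, hz', one_mul], ?_⟩
    rw [← Matrix.one_kronecker_one, h, h', Matrix.smul_kronecker, Matrix.kronecker_smul, smul_smul]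
  mul g h := by
    obtain ⟨k, z, hz, hk⟩ := hB.mul g.1 h.1
    obtain ⟨k', z', hz', hk'⟩ := hW.mul g.2 h.2
    refine ⟨(k, k'), z * z', by rw [norm_mul, hz, hz', one_mul], ?_⟩
    rw [← Matrix.mul_kronecker_mul, hk, hk', Matrix.smul_kronecker, Matrix.kronecker_smul, smul_smul]
  star g := by
    obtain ⟨k, z, hz, hk⟩ := hB.star g.1
    obtain ⟨k', z', hz', hk'⟩ := hW.star g.2
    refine ⟨(k, k'), z * z', by rw [norm_mul, hz, hz', one_mul], ?_⟩
    rw [Matrix.star_eq_conjTranspose, Matrix.conjTranspose_kronecker, ← Matrix.star_eq_conjTranspose,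
      ← Matrix.star_eq_conjTranspose, hk, hk', Matrix.smul_kronecker, Matrix.kronecker_smul,
      smul_smul]
  ortho i j i' j' := by
    have h1 := hB.ortho i.1 j.1 i'.1 j'.1
    have h2 := hW.ortho i.2 j.2 i'.2 j'.2
    have h3 : ∀ g : Γ × Δ, Star.star ((B g.1 ⊗ₖ W g.2) i j) * (B g.1 ⊗ₖ W g.2) i' j' =
        (Star.star (B g.1 i.1 j.1) * B g.1 i'.1 j'.1) *
            (Star.star (W g.2 i.2 j.2) * W g.2 i'.2 j'.2) := by
      intro g
      simp only [Matrix.kroneckerMap_apply, star_mul']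
      ring
    simp only [h3]
    rw [Fintype.sum_prod_type]
    simp only
    rw [← Fintype.sum_mul_sum, h1, h2, mul_ite, ite_mul, zero_mul, mul_zero, ← ite_and]
    · refine if_congr ?_ ?_ rfl
      · simp only [Prod.ext_iff]
        tauto
      · simp only [Fintype.card_prod, Nat.cast_mul]
        rw [div_mul_div_comm]

theorem IsProjFrame.comp_equiv {B : Γ → Matrix ι ι ℂ} (hB : IsProjFrame B) (e : Δ ≃ Γ) :
    IsProjFrame fun g => B (e g) where
  unitary g := hB.unitary _
  one := by
    obtain ⟨g, z, hz, h⟩ := hB.one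
    exact ⟨e.symm g, z, hz, by rw [h, e.apply_symm_apply]⟩
  mul g h := by
    obtain ⟨k, z, hz, hk⟩ := hB.mul (e g) (e h)
    exact ⟨e.symm k, z, hz, by rw [hk, e.apply_symm_apply]⟩
  star g := by
    obtain ⟨k, z, hz, hk⟩ := hB.star (e g)
    exact ⟨e.symm k, z, hz, by rw [hk, e.apply_symm_apply]⟩
  ortho i j i' j' := by
    rw [e.sum_comp fun g => Star.star (B g i j) * B g i' j', hB.ortho, Fintype.card_congr e]

/-- Every matrix is repeated equally often, which rescales both sides of the orthogonality relation
alike. The repetition lets blocks with different groups share one index set. -/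
theorem IsProjFrame.pi {J : Type} [Fintype J] [DecidableEq J] {Γ : J → Type} [∀ α, Fintype (Γ α)]
    [∀ α, Nonempty (Γ α)] {α : J} {B : Γ α → Matrix ι ι ℂ} (hB : IsProjFrame B) :
    IsProjFrame fun f : ∀ α, Γ α => B (f α) where
  unitary f := hB.unitary _
  one := by
    obtain ⟨g, z, hz, h⟩ := hB.one
    exact ⟨Function.update (Classical.arbitrary _) α g, z, hz, by rw [h, Function.update_self]⟩
  mul f f' := by
    obtain ⟨k, z, hz, hk⟩ := hB.mul (f α) (f' α)
    exact ⟨Function.update f α k, z, hz, by rw [hk, Function.update_self]⟩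
  star f := by
    obtain ⟨k, z, hz, hk⟩ := hB.star (f α)
    exact ⟨Function.update f α k, z, hz, by rw [hk, Function.update_self]⟩
  ortho i j i' j' := by
    have h1 : (Fintype.card (∀ α, Γ α) : ℂ) =
        Fintype.card (Γ α) * Fintype.card (∀ j : {j // j ≠ α}, Γ j) := by
      rw [Fintype.card_congr (Equiv.piSplitAt α Γ), Fintype.card_prod, Nat.cast_mul]
    rw [← (Equiv.piSplitAt α Γ).symm.sum_comp, Fintype.sum_prod_type, h1]
    simp only [Equiv.piSplitAt_symm_apply, dif_pos, cast_eq, Finset.sum_const, Finset.card_univ,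
      nsmul_eq_mul]
    rw [← Finset.mul_sum, hB.ortho, mul_ite, mul_zero]
    refine if_congr Iff.rfl ?_ rfl
    ring

end FrameConstructions

/-! ### Unitary equivalence of matrices with the same Gram matrix -/

section Push

variable {ι : Type} [Fintype ι] [DecidableEq ι] {d : ℕ}

/-- Equal Gram matrices mean `‖M v‖ = ‖M' v‖`, so `M v ↦ M' v` is well defined and isometric on the
range of `M`. In finite dimension it extends to an isometry of the whole space, which is unitary. -/
theorem exists_unitary_mul_eq {m k : Type} [Fintype m] [DecidableEq m] [Fintype k] [DecidableEq k]
    {M M' : Matrix m k ℂ} (h : M.conjTranspose * M = M'.conjTranspose * M') :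
    ∃ O ∈ Matrix.unitaryGroup m ℂ, O * M = M' := by
  let f := Matrix.toEuclideanLin M
  let f' := Matrix.toEuclideanLin M'
  have hinner : ∀ v w, inner ℂ (f v) (f w) = inner ℂ (f' v) (f' w) := by
    intro v w
    have key : ∀ P : Matrix m k ℂ, (Matrix.toEuclideanLin P).adjoint (Matrix.toEuclideanLin P w) =
        Matrix.toEuclideanLin (P.conjTranspose * P) w := by
      intro P
      rw [← Matrix.toEuclideanLin_conjTranspose_eq_adjoint, Matrix.toEuclideanLin,
        Matrix.toEuclideanLin, Matrix.toEuclideanLin, Matrix.toLpLin_mul_same]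
      rfl
    rw [← LinearMap.adjoint_inner_right, ← LinearMap.adjoint_inner_right, key, key, h]
  have hnorm : ∀ v, ‖f v‖ = ‖f' v‖ := fun v => by
    rw [@norm_eq_sqrt_re_inner ℂ, @norm_eq_sqrt_re_inner ℂ, hinner]
  have hker : LinearMap.ker f ≤ LinearMap.ker f' := by
    intro v hv
    rw [LinearMap.mem_ker] at hv ⊢
    rw [← norm_eq_zero, ← hnorm, hv, norm_zero]
  let g : LinearMap.range f →ₗ[ℂ] EuclideanSpace ℂ m :=
    ((LinearMap.ker f).liftQ f' hker) ∘ₗ f.quotKerEquivRange.symm.toLinearMap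
  have hg : ∀ v, g ⟨f v, LinearMap.mem_range_self f v⟩ = f' v := by
    intro v
    simp only [g, LinearMap.comp_apply, LinearEquiv.coe_coe]
    rw [LinearMap.quotKerEquivRange_symm_apply_image, Submodule.mkQ_apply, Submodule.liftQ_apply]
  let L : EuclideanSpace ℂ m →ₗᵢ[ℂ] EuclideanSpace ℂ m := LinearIsometry.extend
    (S := LinearMap.range f) ⟨g, fun x => by
      obtain ⟨_, v, rfl⟩ := x
      rw [hg, ← hnorm]
      rfl⟩
  have hL : ∀ v, L (f v) = f' v := fun v =>
    (LinearIsometry.extend_apply _ ⟨f v, LinearMap.mem_range_self f v⟩).trans (hg v)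
  have hO : Matrix.toEuclideanLin (Matrix.toEuclideanLin.symm L.toLinearMap) = L.toLinearMap :=
    LinearEquiv.apply_symm_apply _ _
  refine ⟨Matrix.toEuclideanLin.symm L.toLinearMap, ?_, ?_⟩
  · rw [Matrix.mem_unitaryGroup_iff', Matrix.star_eq_conjTranspose]
    apply Matrix.toEuclideanLin.injective
    refine LinearMap.ext fun v => ext_inner_left ℂ fun w => ?_
    rw [Matrix.toEuclideanLin, Matrix.toLpLin_mul_same, Matrix.toLpLin_one, LinearMap.comp_apply,
      ← Matrix.toEuclideanLin, Matrix.toEuclideanLin_conjTranspose_eq_adjoint, hO,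
      LinearMap.adjoint_inner_right]
    exact L.inner_map_map w v
  · apply Matrix.toEuclideanLin.injective
    refine LinearMap.ext fun v => ?_
    rw [Matrix.toEuclideanLin, Matrix.toLpLin_mul_same, LinearMap.comp_apply]
    exact (congrArg (· (f v)) hO).trans (hL v)

end Push


/-! ### Pushing defects through blocks of sites -/

section Pushable

variable {ι κ Γ Δ : Type} [Fintype ι] [DecidableEq ι] [Fintype κ] [DecidableEq κ] [Fintype Γ]
  [Fintype Δ] {d : ℕ}

theorem mul_virtualToPhysical_iff {q : ℕ} {T : MPSTensor d ι} {L R : Matrix ι ι ℂ}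
    {O : Matrix (Fin q → Fin d) (Fin q → Fin d) ℂ} :
    O * virtualToPhysical T q = virtualToPhysical T q * (L.transpose ⊗ₖ R) ↔
      ∀ m : Fin q → Fin d, ∑ m', O m m' • wordProd T m' = L * wordProd T m * R := by
  refine ⟨sum_smul_wordProd, fun h => ?_⟩
  ext m ⟨i, j⟩
  have := congrFun (congrFun (h m) i) j
  rw [Matrix.sum_apply] at this
  simp only [Matrix.smul_apply, smul_eq_mul, Matrix.mul_apply, Finset.sum_mul] at this
  simp only [Matrix.mul_apply, virtualToPhysical, Fintype.sum_prod_type, Matrix.kroneckerMap_apply,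
    Matrix.transpose_apply]
  rw [this, Finset.sum_comm]
  exact Finset.sum_congr rfl fun _ _ => Finset.sum_congr rfl fun _ _ => by ring

/-- Every matrix of the family can be pushed through `q` sites by a unitary, staying in the
family. -/
def Pushable (T : MPSTensor d ι) (q : ℕ) (B : Γ → Matrix ι ι ℂ) : Prop :=
  ∀ g, ∃ h, ∃ O ∈ Matrix.unitaryGroup (Fin q → Fin d) ℂ,
    ∀ m : Fin q → Fin d, ∑ m', O m m' • wordProd T m' = B h * wordProd T m * B g

theorem transpose_mem_unitaryGroup {U : Matrix ι ι ℂ} (hU : U ∈ Matrix.unitaryGroup ι ℂ) :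
    U.transpose ∈ Matrix.unitaryGroup ι ℂ := by
  rw [Matrix.mem_unitaryGroup_iff]
  have := congrArg Matrix.transpose (Matrix.mem_unitaryGroup_iff'.1 hU)
  rw [Matrix.transpose_mul, Matrix.transpose_one] at this
  exact this

/-- If the unitary `U` commutes with `M†M`, then `MU` and `M` have the same Gram matrix, so a
physical unitary carries `M` to `MU`. -/
theorem Pushable.of_commute {T : MPSTensor d ι} {q : ℕ} {B : Γ → Matrix ι ι ℂ}
    (hB : ∀ g, B g ∈ Matrix.unitaryGroup ι ℂ)
    (h : ∀ g, ∃ h, Commute ((B h).transpose ⊗ₖ B g)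
      ((virtualToPhysical T q).conjTranspose * virtualToPhysical T q)) : Pushable T q B := by
  intro g
  obtain ⟨g', hc⟩ := h g
  clear h
  set M := virtualToPhysical T q
  set U := (B g').transpose ⊗ₖ B g
  have hU : U.conjTranspose * U = 1 := Matrix.mem_unitaryGroup_iff'.1
    (Matrix.kronecker_mem_unitary (transpose_mem_unitaryGroup (hB g')) (hB g))
  obtain ⟨O, hO, hOM⟩ := exists_unitary_mul_eq (M := M) (M' := M * U) (by
    rw [Matrix.conjTranspose_mul, Matrix.mul_assoc, ← Matrix.mul_assoc M.conjTranspose, ← hc.eq,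
      ← Matrix.mul_assoc, hU, Matrix.one_mul])
  exact ⟨g', O, hO, mul_virtualToPhysical_iff.1 hOM⟩

theorem wordProd_append {a b : ℕ} (T : MPSTensor d ι) (m : Fin a → Fin d) (m' : Fin b → Fin d) :
    wordProd T (Fin.append m m') = wordProd T m * wordProd T m' := by
  rw [wordProd, wordProd, wordProd, ← List.prod_append, ← List.ofFn_fin_append]
  congr 2
  funext x
  exact x.addCases (fun y => by simp) fun y => by simp

theorem IsProjFrame.exists_mul_eq_smul_one {B : Γ → Matrix ι ι ℂ} (hB : IsProjFrame B) (g : Γ) :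
    ∃ k, ∃ z : ℂ, ‖z‖ = 1 ∧ B k * B g = z • 1 := by
  obtain ⟨k, z, hz, hk⟩ := hB.star g
  refine ⟨k, Star.star z, by simpa using hz, ?_⟩
  have := Matrix.mem_unitaryGroup_iff'.1 (hB.unitary g)
  rw [hk, smul_mul_assoc] at this
  rw [← this, smul_smul, star_mul_self_of_norm hz, one_smul]

theorem Pushable.zero {T : MPSTensor d ι} {B : Γ → Matrix ι ι ℂ} (hB : IsProjFrame B) :
    Pushable T 0 B := by
  intro g
  obtain ⟨k, z, hz, hk⟩ := hB.exists_mul_eq_smul_one g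
  refine ⟨k, z • 1, smul_mem_unitaryGroup (one_mem _) hz, fun m => ?_⟩
  rw [Fintype.sum_eq_single m fun m' h => absurd (Subsingleton.elim _ _) h]
  simp [wordProd, hk]

/-- The right part emits `B h'` on its left. The left part is given, on its right, the member `B k`
inverse to `B h'` up to a phase, so the inner pair cancels and only the outer matrices remain. -/
theorem Pushable.add {T : MPSTensor d ι} {a b : ℕ} {B : Γ → Matrix ι ι ℂ} (hB : IsProjFrame B)
    (ha : Pushable T a B) (hb : Pushable T b B) : Pushable T (a + b) B := by
  intro g
  obtain ⟨h', O₂, hO₂, h₂⟩ := hb g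
  obtain ⟨k, z, hz, hk⟩ := hB.exists_mul_eq_smul_one h'
  obtain ⟨h, O₁, hO₁, h₁⟩ := ha k
  let e := Fin.appendEquiv (α := Fin d) a b
  have hz0 : z ≠ 0 := by
    rintro rfl
    simp at hz
  -- The phase left by the inner cancellation is absorbed into the physical unitary.
  refine ⟨h, z⁻¹ • Matrix.reindex e e (O₁ ⊗ₖ O₂), smul_mem_unitaryGroup
    (reindex_mem_unitaryGroup e (Matrix.kronecker_mem_unitary hO₁ hO₂)) (by simp [hz]),
    e.forall_congr_right.1 fun x => ?_⟩
  rw [← e.sum_comp, Fintype.sum_prod_type]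
  have h3 : ∀ y y', wordProd T (e (y, y')) = wordProd T y * wordProd T y' := wordProd_append T
  rw [← Prod.mk.eta (p := x)]
  simp only [h3, Matrix.smul_apply, Matrix.reindex_apply, Matrix.submatrix_apply,
    e.symm_apply_apply, Matrix.kroneckerMap_apply, smul_eq_mul]
  calc _ = z⁻¹ • ((∑ y, O₁ x.1 y • wordProd T y) * ∑ y, O₂ x.2 y • wordProd T y) := by
        rw [Finset.sum_mul_sum, Finset.smul_sum]
        refine Finset.sum_congr rfl fun y _ => ?_
        rw [Finset.smul_sum]
        refine Finset.sum_congr rfl fun y' _ => ?_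
        rw [smul_mul_smul_comm, smul_smul]
    _ = _ := by
        rw [h₁, h₂]
        have : B h * wordProd T x.1 * B k * (B h' * wordProd T x.2 * B g) =
            B h * wordProd T x.1 * (B k * B h') * wordProd T x.2 * B g := by
          simp only [Matrix.mul_assoc]
        rw [this, hk, Matrix.mul_smul, Matrix.mul_one, smul_mul_assoc, smul_mul_assoc, smul_smul,
          inv_mul_cancel₀ hz0, one_smul, Matrix.mul_assoc (B h)]

theorem Pushable.mul {T : MPSTensor d ι} {b : ℕ} {B : Γ → Matrix ι ι ℂ} (hB : IsProjFrame B)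
    (h : Pushable T b B) : ∀ k, Pushable T (b * k) B
  | 0 => Pushable.zero hB
  | k + 1 => (Pushable.mul hB h k).add hB h

theorem wordProd_reindex_kronecker {q : ℕ} {l : Type} [Fintype l] [DecidableEq l]
    (T : MPSTensor d ι) (e : ι × κ ≃ l) (m : Fin q → Fin d) :
    wordProd (fun x => Matrix.reindex e e (T x ⊗ₖ (1 : Matrix κ κ ℂ))) m =
      Matrix.reindex e e (wordProd T m ⊗ₖ 1) := by
  simp only [wordProd, List.ofFn_eq_map]
  induction List.finRange q with
  | nil => simp
  | cons t s ih =>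
    rw [List.map_cons, List.prod_cons, ih, List.map_cons, List.prod_cons, Matrix.reindex_apply,
      Matrix.reindex_apply, Matrix.submatrix_mul_equiv, ← Matrix.mul_kronecker_mul, Matrix.one_mul,
      Matrix.reindex_apply]

/-- The tensor is trivial on the added factor, so `W` passes through it freely and is cancelled on
the other side by its inverse up to a phase. -/
theorem Pushable.kronecker {T : MPSTensor d ι} {q : ℕ} {B : Γ → Matrix ι ι ℂ} (h : Pushable T q B)
    {W : Δ → Matrix κ κ ℂ} (hW : IsProjFrame W) {l : Type} [Fintype l] [DecidableEq l]
    (e : ι × κ ≃ l) :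
    Pushable (fun x => Matrix.reindex e e (T x ⊗ₖ (1 : Matrix κ κ ℂ))) q
      fun g : Γ × Δ => Matrix.reindex e e (B g.1 ⊗ₖ W g.2) := by
  intro g
  obtain ⟨h, O, hO, hp⟩ := h g.1
  obtain ⟨k, z, hz, hk⟩ := hW.exists_mul_eq_smul_one g.2
  refine ⟨(h, k), z • O, smul_mem_unitaryGroup hO hz, fun m => ?_⟩
  simp only [wordProd_reindex_kronecker]
  rw [Matrix.reindex_apply, Matrix.reindex_apply, Matrix.reindex_apply, Matrix.submatrix_mul_equiv,
    Matrix.submatrix_mul_equiv, ← Matrix.mul_kronecker_mul, ← Matrix.mul_kronecker_mul,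
    Matrix.mul_one, hk, ← hp, Matrix.kronecker_smul]
  ext i j
  simp only [Matrix.sum_apply, Matrix.smul_apply, Matrix.submatrix_apply,
    Matrix.kroneckerMap_apply, Finset.sum_mul, smul_eq_mul, Finset.mul_sum, Matrix.reindex_apply]
  exact Finset.sum_congr rfl fun _ _ => by ring

theorem Pushable.pi {T : MPSTensor d ι} {q : ℕ} {J : Type} [DecidableEq J] {Γ : J → Type}
    {α : J} {B : Γ α → Matrix ι ι ℂ} (h : Pushable T q B) :
    Pushable T q fun f : ∀ α, Γ α => B (f α) := by
  intro f
  obtain ⟨g, hg⟩ := h (f α)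
  exact ⟨Function.update f α g, by
    beta_reduce
    rwa [Function.update_self]⟩

theorem Pushable.comp_equiv {T : MPSTensor d ι} {q : ℕ} {B : Γ → Matrix ι ι ℂ} (h : Pushable T q B)
    (e : Δ ≃ Γ) : Pushable T q fun g => B (e g) := by
  intro f
  obtain ⟨g, hg⟩ := h (e f)
  exact ⟨e.symm g, by
    beta_reduce
    rwa [e.apply_symm_apply]⟩

end Pushable


/-! ### Construction of the gates that do not depend on the length -/

section Gates

variable {K D d : ℕ} [NeZero K] [NeZero D] [NeZero d]

theorem exists_bell : ∃ U ∈ Matrix.unitaryGroup (Fin D × Fin D) ℂ,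
    ∀ i j, U (i, j) (0, 0) = if i = j then 1 / (Real.sqrt D : ℂ) else 0 := by
  obtain ⟨U, hU, h⟩ := exists_unitary_extension (ι := Fin D × Fin D) {(0, 0)}
    (fun x _ => if x.1 = x.2 then 1 / (Real.sqrt D : ℂ) else 0) (by
      rintro _ rfl _ rfl
      have hs : (Real.sqrt D : ℂ) * Real.sqrt D = D := by
        rw [← Complex.ofReal_mul, Real.mul_self_sqrt (Nat.cast_nonneg _)]
        simp
      have hD : (D : ℂ) ≠ 0 := Nat.cast_ne_zero.2 (NeZero.ne D)
      simp [Fintype.sum_prod_type, apply_ite (starRingEnd ℂ), ← mul_inv, hs, hD])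
  exact ⟨U, hU, fun i j => h _ _ rfl⟩

/-- Left-canonical form says exactly that the columns with physical input `0` are orthonormal. -/
theorem IsLeftCanonical.exists_site {T : MPSTensor d (Fin D)} (hT : IsLeftCanonical T) :
    ∃ U ∈ Matrix.unitaryGroup (Fin D × Fin d) ℂ, ∀ i j m, U (i, m) (j, 0) = T m i j := by
  obtain ⟨U, hU, h⟩ := exists_unitary_extension (ι := Fin D × Fin d) {c | c.2 = 0}
    (fun x c => T x.2 x.1 c.1) (by
      rintro ⟨j, _⟩ rfl ⟨j', _⟩ rfl
      have := congrFun (congrFun hT j) j'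
      rw [Matrix.sum_apply, Matrix.one_apply] at this
      rw [Fintype.sum_prod_type_right]
      simpa [Matrix.mul_apply] using this)
  exact ⟨U, hU, fun i j m => h _ _ rfl⟩

/-- The frame relation gives squared norm `η / D` for the columns, compensated by `√(D/η)` in each
factor. Storing the outcome in an ancilla of dimension `η`, with both bonds reset to `0`, provides
enough rows. -/
theorem IsProjFrame.exists_fuse {η : ℕ} [NeZero η] {B : Fin η → Matrix (Fin D) (Fin D) ℂ}
    (hB : IsProjFrame B) : ∃ U ∈ Matrix.unitaryGroup (Fin D × Fin D × Fin η) ℂ,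
      (∀ k i j, U (0, 0, k) (i, j, 0) = (Real.sqrt (D / η) : ℂ) * B k i j) ∧
      ∀ l i j, ¬(l.1 = 0 ∧ l.2.1 = 0) → U l (i, j, 0) = 0 := by
  obtain ⟨U, hU, h⟩ := exists_unitary_extension (ι := Fin D × Fin D × Fin η) {c | c.2.2 = 0}
    (fun x c => if x.1 = 0 ∧ x.2.1 = 0 then (Real.sqrt (D / η) : ℂ) * B x.2.2 c.1 c.2.1 else 0) (by
      rintro ⟨i, j, _⟩ rfl ⟨i', j', _⟩ rfl
      have hs : (Real.sqrt (D / η) : ℂ) * Real.sqrt (D / η) = D / η := by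
        rw [← Complex.ofReal_mul, Real.mul_self_sqrt (by positivity)]
        simp
      have hD : (D : ℂ) ≠ 0 := Nat.cast_ne_zero.2 (NeZero.ne D)
      have hη : (η : ℂ) ≠ 0 := Nat.cast_ne_zero.2 (NeZero.ne η)
      rw [Fintype.sum_prod_type,
        Fintype.sum_eq_single 0 fun x hx => Finset.sum_eq_zero fun y _ => by simp [hx],
        Fintype.sum_prod_type, Fintype.sum_eq_single 0 fun x hx => Finset.sum_eq_zero fun y _ => by
          simp [hx]]
      simp only [and_self, if_true, star_mul', Complex.star_def, Complex.conj_ofReal]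
      calc _ = ((D : ℂ) / η) * ∑ k, Star.star (B k i j) * B k i' j' := by
            rw [Finset.mul_sum, ← hs]
            exact Finset.sum_congr rfl fun k _ => by rw [Complex.star_def]; ring
        _ = _ := by
            rw [hB.ortho]
            simp only [Fintype.card_fin, Prod.mk.injEq, and_true, mul_ite, mul_zero]
            refine if_congr Iff.rfl ?_ rfl
            field_simp)
  refine ⟨U, hU, fun k i j => ?_, fun l i j hl => ?_⟩
  · rw [h _ _ rfl, if_pos ⟨rfl, rfl⟩]
  · rw [h _ _ rfl, if_neg hl]

theorem exists_protocolGates (T : Fin K → MPSTensor d (Fin D)) (hT : ∀ α, IsLeftCanonical (T α))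
    {η : ℕ} [NeZero η] {B : Fin K → Fin η → Matrix (Fin D) (Fin D) ℂ}
    (hB : ∀ α, IsProjFrame (B α)) {q : ℕ} (hp : ∀ α, Pushable (T α) q (B α)) :
    ∃ V : ProtocolGates T η, PushableDefects V q := by
  obtain ⟨U, hU, hU0⟩ := exists_bell (D := D)
  choose S hS hS0 using fun α => (hT α).exists_site
  choose F hF hF0 hF1 using fun α => (hB α).exists_fuse
  let V : ProtocolGates T η := {
    bell := U
    bell_unitary := hU
    bell_zero := hU0
    site := S
    site_unitary := hS
    site_zero := hS0
    η := η
    defect := B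
    defect_unitary := fun α => (hB α).unitary
    label := ⟨fun k => (0, 0, k), fun k k' h => by simpa using h⟩
    fuse := F
    fuse_unitary := hF
    fuse_label := hF0
    fuse_other := fun α l i j hl => hF1 α l i j fun h => hl ⟨l.2.2, by
      obtain ⟨a, b, c⟩ := l
      obtain ⟨rfl, rfl⟩ := h
      rfl⟩ }
  refine ⟨V, fun α => ?_, fun α M M' => ?_, fun α M => ?_, fun α M => ?_⟩
  · exact (hB α).one
  · rintro ⟨k, z, hz, rfl⟩ ⟨k', z', hz', rfl⟩
    obtain ⟨l, w, hw, h⟩ := (hB α).mul k k'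
    refine ⟨l, z * z' * w, by simp [hz, hz', hw], ?_⟩
    rw [smul_mul_smul_comm, mul_smul _ w]
    exact congrArg _ h
  · rintro ⟨k, z, hz, rfl⟩
    obtain ⟨l, w, hw, h⟩ := (hB α).star k
    refine ⟨l, star z * w, by simp [hz, hw], ?_⟩
    rw [star_smul, mul_smul]
    exact congrArg _ h
  · rintro ⟨k, z, hz, rfl⟩
    obtain ⟨l, O, hO, h⟩ := hp α k
    refine ⟨B α l, ⟨l, 1, by simp, (one_smul ℂ _).symm⟩, z • O, smul_mem_unitaryGroup hO hz, ?_⟩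
    rw [Matrix.smul_mul, Matrix.kronecker_smul, Matrix.mul_smul]
    exact congrArg _ (mul_virtualToPhysical_iff.2 h)

end Gates

/-! ### Common bond dimension and common outcomes for all blocks -/

section Inflation

variable {K d : ℕ} (D : Fin K → ℕ) (A : ∀ α, MPSTensor d (Fin (D α)))

/-- Bond indices of an inflated block. -/
def inflateEquiv (α : Fin K) : Fin (D α) × Fin (commonDim D / D α) ≃ Fin (commonDim D) :=
  (finProdFinEquiv (m := D α) (n := commonDim D / D α)).trans (finCongr (mul_commonDim_div D α))

theorem inflate_eq (α : Fin K) : inflate D A α = fun m =>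
    Matrix.reindex (inflateEquiv D α) (inflateEquiv D α)
      (A α m ⊗ₖ (1 : Matrix (Fin (commonDim D / D α)) _ ℂ)) := rfl

theorem IsLeftCanonical.inflate {A : ∀ α, MPSTensor d (Fin (D α))} {α : Fin K}
    (h : IsLeftCanonical (A α)) : IsLeftCanonical (inflate D A α) := by
  rw [inflate_eq, IsLeftCanonical]
  simp only [Matrix.reindex_apply, Matrix.conjTranspose_submatrix, Matrix.submatrix_mul_equiv,
    Matrix.conjTranspose_kronecker, ← Matrix.mul_kronecker_mul, Matrix.conjTranspose_one,
    Matrix.one_mul]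
  have : ∑ m, ((A α m).conjTranspose * A α m) ⊗ₖ
      (1 : Matrix (Fin (commonDim D / D α)) (Fin (commonDim D / D α)) ℂ) = 1 := by
    rw [← Matrix.one_kronecker_one, ← h]
    ext i j
    simp [Matrix.sum_apply, Finset.sum_mul]
  rw [← Matrix.submatrix_one_equiv (inflateEquiv D α).symm, ← this]
  ext i j
  simp [Matrix.sum_apply]

variable [∀ α, NeZero (D α)]

instance commonDim_div_neZero (α : Fin K) : NeZero (commonDim D / D α) :=
  ⟨fun h => NeZero.ne (commonDim D) (by rw [← mul_commonDim_div D α, h, mul_zero])⟩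

/-- The matrices `B ⊗ 1` alone would not resolve the inflated bond space when `k > 1`; tensoring
with the Weyl matrices restores orthogonality. Pushing through `q` sites repeats the pushing through
`b` sites. -/
theorem HasPushableIrrep.exists_defects {ι κ : Type} [Fintype ι] [DecidableEq ι] [Nonempty ι]
    [Fintype κ] [DecidableEq κ] {T : MPSTensor d ι} {b : ℕ} (h : HasPushableIrrep T b) {q : ℕ}
    (hq : b ∣ q) {k : ℕ} [NeZero k] (e : ι × Fin k ≃ κ) :
    ∃ (Γ : Type) (_ : Fintype Γ) (_ : Nonempty Γ) (B : Γ → Matrix κ κ ℂ), IsProjFrame B ∧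
      Pushable (fun m => Matrix.reindex e e (T m ⊗ₖ (1 : Matrix (Fin k) (Fin k) ℂ))) q B := by
  obtain ⟨G, hG, hfin, B, hB, hc⟩ := h
  obtain ⟨c, rfl⟩ := hq
  have := Fintype.ofFinite G
  have hW := (weyl_isProjFrame k).reindex (ZMod.finEquiv k).symm.toEquiv
  exact ⟨G × (ZMod k × ZMod k), inferInstance, ⟨1, 0, 0⟩, _,
    (hB.isProjFrame.kronecker hW).reindex e,
    ((Pushable.of_commute hB.unitary hc).mul hB.isProjFrame c).kronecker hW e⟩

/-- An outcome is a tuple with one component for each block, of which block `α` uses only its own.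
-/
theorem exists_defects_inflate {A : ∀ α, MPSTensor d (Fin (D α))} {b : Fin K → ℕ}
    (hpush : ∀ α, HasPushableIrrep (A α) (b α)) {q : ℕ} (hq : ∀ α, b α ∣ q) :
    ∃ (η : ℕ) (_ : NeZero η) (B : Fin K → Fin η → Matrix (Fin (commonDim D)) (Fin (commonDim D)) ℂ),
      (∀ α, IsProjFrame (B α)) ∧ ∀ α, Pushable (inflate D A α) q (B α) := by
  choose Γ hΓ hne B hB hp using fun α => (hpush α).exists_defects (hq α) (inflateEquiv D α)
  let e : Fin (Fintype.card (∀ α, Γ α)) ≃ ∀ α, Γ α := (Fintype.equivFin _).symm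
  exact ⟨Fintype.card (∀ α, Γ α), ⟨Fintype.card_ne_zero⟩, fun α i => B α (e i α),
    fun α => (hB α).pi.comp_equiv e, fun α => (hp α).pi.comp_equiv e⟩

end Inflation


/-! ### Recovering the matrix product state by measuring the edges -/

section EdgeMeasurement

theorem exists_unitary_row {ι : Type} [Fintype ι] [DecidableEq ι] {w : ι → ℂ} (hw : w ≠ 0) :
    ∃ U ∈ Matrix.unitaryGroup ι ℂ, ∃ o, ∃ z : ℂ, z ≠ 0 ∧ ∀ e, U o e = z * w e := by
  obtain ⟨o, ho⟩ := Function.ne_iff.1 hw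
  have hpos : 0 < ∑ i, ‖w i‖ ^ 2 := Finset.sum_pos' (fun i _ => by positivity)
    ⟨o, Finset.mem_univ o, by have := norm_pos_iff.2 ho; positivity⟩
  set r := Real.sqrt (∑ i, ‖w i‖ ^ 2)
  have hr : 0 < r := Real.sqrt_pos.2 hpos
  have hr' : (r : ℂ) ≠ 0 := Complex.ofReal_ne_zero.2 hr.ne'
  have hrr : (r : ℂ) * r = ∑ i, star (w i) * w i := by
    rw [← Complex.ofReal_mul, Real.mul_self_sqrt hpos.le, Complex.ofReal_sum]
    refine Finset.sum_congr rfl fun i _ => ?_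
    rw [Complex.star_def, mul_comm, Complex.mul_conj, Complex.normSq_eq_norm_sq]
  obtain ⟨U, hU, h⟩ := exists_unitary_extension (ι := ι) {o} (fun i _ => (r : ℂ)⁻¹ * w i) (by
    rintro _ rfl _ rfl
    simp only [star_mul', if_true]
    calc _ = (r : ℂ)⁻¹ * (r : ℂ)⁻¹ * ∑ i, star (w i) * w i := by
          rw [Finset.mul_sum]
          refine Finset.sum_congr rfl fun i _ => ?_
          rw [star_inv₀, Complex.star_def, Complex.conj_ofReal]
          ring
      _ = 1 := by rw [← hrr]; field_simp)
  -- The extension prescribes a column; the transpose makes it a row without conjugation, as the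
  -- overlap with the edges is bilinear.
  exact ⟨U.transpose, transpose_mem_unitaryGroup hU, o, (r : ℂ)⁻¹, inv_ne_zero hr',
    fun e => h e o rfl⟩

variable {K d : ℕ} (D : Fin K → ℕ) (μ : Fin K → ℂ) (A : ∀ α, MPSTensor d (Fin (D α)))

theorem wordProd_blockTensor {N : ℕ} (m : Fin N → Fin d) :
    wordProd (blockTensor D μ A) m =
      Matrix.blockDiagonal' fun α => μ α ^ N • wordProd (A α) m := by
  have : ∀ l : List (Fin N), (l.map fun x => blockTensor D μ A (m x)).prod =
      Matrix.blockDiagonal' fun α => μ α ^ l.length • (l.map fun x => A α (m x)).prod := by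
    intro l
    induction l with
    | nil =>
      simp only [List.map_nil, List.prod_nil, List.length_nil, pow_zero, one_smul]
      exact Matrix.blockDiagonal'_one.symm
    | cons t l ih =>
      rw [List.map_cons, List.prod_cons, ih, blockTensor, ← Matrix.blockDiagonal'_mul]
      congr 1
      funext α
      rw [smul_mul_smul_comm, List.map_cons, List.prod_cons, List.length_cons, pow_succ']
  simpa only [wordProd, List.ofFn_eq_map, List.length_finRange] using this (List.finRange N)

theorem mps_blockTensor {N : ℕ} (X : Matrix (Σ α, Fin (D α)) (Σ α, Fin (D α)) ℂ)
    (m : Fin N → Fin d) : mps (blockTensor D μ A) N X m =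
      ∑ α, ∑ i, ∑ j, μ α ^ N * X ⟨α, j⟩ ⟨α, i⟩ * wordProd (A α) m i j := by
  rw [mps, wordProd_blockTensor, Matrix.trace, Fintype.sum_sigma]
  refine Finset.sum_congr rfl fun α _ => Finset.sum_congr rfl fun i _ => ?_
  rw [Matrix.diag_apply, Matrix.mul_apply, Fintype.sum_sigma, Fintype.sum_eq_single α]
  · refine Finset.sum_congr rfl fun j _ => ?_
    rw [Matrix.blockDiagonal'_apply_eq, Matrix.smul_apply, smul_eq_mul]
    ring
  · intro β hβ
    refine Finset.sum_eq_zero fun j _ => ?_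
    rw [Matrix.blockDiagonal'_apply_ne _ _ _ (Ne.symm hβ), zero_mul]

variable [∀ α, NeZero (D α)]

/-- The edge state on which the boundary matrix `X` is obtained. -/
noncomputable def edgeWeight (N : ℕ) (X : Matrix (Σ α, Fin (D α)) (Σ α, Fin (D α)) ℂ)
    (e : (Fin (commonDim D) × Fin K) × (Fin (commonDim D) × Fin K)) : ℂ :=
  let x := (inflateEquiv D e.1.2).symm e.1.1
  let y := (inflateEquiv D e.1.2).symm e.2.1
  if e.1.2 = e.2.2 ∧ x.2 = 0 ∧ y.2 = 0 then μ e.1.2 ^ N * X ⟨e.1.2, y.1⟩ ⟨e.1.2, x.1⟩ else 0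

/-- The inflated words are `W ⊗ 1`, so fixing the multiplicity index to `0` at both edges recovers
the entries of `W`. The weights then supply `μ_α^N` and the transposed block of `X`, which together
form the trace. -/
theorem sum_edgeWeight {N : ℕ} (X : Matrix (Σ α, Fin (D α)) (Σ α, Fin (D α)) ℂ)
    (m : Fin N → Fin d) :
    ∑ e, edgeWeight D μ N X e * edgeEntangledAmp (inflate D A) m e =
      mps (blockTensor D μ A) N X m := by
  rw [mps_blockTensor, Fintype.sum_prod_type, Fintype.sum_prod_type_right]
  refine Finset.sum_congr rfl fun α _ => ?_
  rw [← (inflateEquiv D α).sum_comp, Fintype.sum_prod_type]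
  refine Finset.sum_congr rfl fun i _ => ?_
  rw [Fintype.sum_eq_single 0]
  · rw [Fintype.sum_prod_type_right, Fintype.sum_eq_single α]
    · rw [← (inflateEquiv D α).sum_comp, Fintype.sum_prod_type]
      refine Finset.sum_congr rfl fun j _ => ?_
      rw [Fintype.sum_eq_single 0]
      · rw [edgeEntangledAmp, wordProd_directSum, Matrix.blockDiagonal_apply_eq, inflate_eq,
          wordProd_reindex_kronecker]
        simp [edgeWeight]
      · intro x hx
        simp [edgeWeight, hx]
    · intro β hβ
      refine Finset.sum_eq_zero fun j _ => ?_
      simp [edgeWeight, Ne.symm hβ]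
  · intro x hx
    refine Finset.sum_eq_zero fun y _ => ?_
    simp [edgeWeight, hx]

end EdgeMeasurement

end MPSPrep


open MPSPrep
theorem theorem2 {K d : ℕ} [NeZero K] [NeZero d] (D : Fin K → ℕ) [∀ α, NeZero (D α)]
    (μ : Fin K → ℂ) (A : ∀ α, MPSTensor d (Fin (D α)))
    (hcanonical : ∀ α, IsLeftCanonical (A α)) (hnormal : ∀ α, IsNormal (A α))
    (b : Fin K → ℕ) (hb : ∀ α, 0 < b α) (hpush : ∀ α, HasPushableIrrep (A α) (b α))
    (q : ℕ) [NeZero q] (hq : ∀ α, b α ∣ q) :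
    ∃ (p : ℕ) (_ : NeZero p) (V : ProtocolGates (inflate D A) p) (T r : ℕ), ∀ n : ℕ,
      (∃ P : ProtocolChoices V n q,
        (protocol P).depth ≤ T ∧ (protocol P).IsLocal quditPos r ∧
        (protocol P).Prepares (outputQudits n q) (edgeEntangledMPS (inflate D A) p n q)) ∧
      ∀ X : Matrix (Σ α, Fin (D α)) (Σ α, Fin (D α)) ℂ,
        mps (blockTensor D μ A) ((n + 1) * q) X ≠ 0 →
        ∃ W ∈ Matrix.unitaryGroup
            ((Fin (commonDim D) × Fin K) × (Fin (commonDim D) × Fin K)) ℂ,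
          ∃ o, ∃ z : ℂ, z ≠ 0 ∧
            edgeMeasuredMPS (inflate D A) ((n + 1) * q) W o =
              z • mps (blockTensor D μ A) ((n + 1) * q) X := by
  obtain ⟨η, hη, B, hB, hp⟩ := exists_defects_inflate D hpush hq
  obtain ⟨V, hV⟩ := exists_protocolGates (inflate D A) (fun α => (hcanonical α).inflate D) hB hp
  -- The ancilla dimension is the number of defects; all the constants are fixed before `n`.
  refine ⟨η, hη, V, q + 11, q + 1, fun n => ⟨?_, fun X hX => ?_⟩⟩
  · obtain ⟨P, hP, hloc, hdepth, hseed⟩ := hV.exists_choices n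
    exact ⟨P, protocol_depth hdepth, protocol_isLocal hloc, protocol_prepares hP hseed⟩
  -- A vanishing edge vector would give a vanishing state, so the vector can be normalized and
  -- completed to a basis.
  · have hw : edgeWeight D μ ((n + 1) * q) X ≠ 0 := by
      intro h
      refine hX (funext fun m => ?_)
      rw [← sum_edgeWeight, h]
      simp
    obtain ⟨W, hW, o, z, hz, h⟩ := exists_unitary_row hw
    refine ⟨W, hW, o, z, hz, funext fun m => ?_⟩
    rw [edgeMeasuredMPS, Pi.smul_apply, smul_eq_mul, ← sum_edgeWeight, Finset.mul_sum]
    exact Finset.sum_congr rfl fun e _ => by rw [h, mul_assoc]
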